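/- **Setting.** Let $M$ be a smooth manifold of dimension $2m+1$ with a contact metric structure $(\phi,\xi,\lambda,g)$: a contact form $\lambda$ with Reeb field $\xi$, a Riemannian metric $g$ and a $(1,1)$-tensor $\phi$ such that, with $\omega=d\lambda$ (i.e. $\omega_{ij}=\partial_i\lambda_j-\partial_j\lambda_i$), $$\lambda(X)=g(X,\xi),\quad \omega(X,Y)=g(X,\phi Y),\quad g(\phi X,\phi Y)=g(X,Y)-\lambda(X)\lambda(Y),\quad \phi^2=-1+\xi\otimes\lambda,\quad \phi\xi=0,\quad \lambda\circ\phi=0 .$$ Put $\mathcal P=\{X-i\phi X: X\in\ker\lambda\}$ and $\bar{\mathcal P}=\{X+i\phi X: X\in\ker\lambda\}$. The structure is *Sasakian* if $\mathcal L_\xi g=0$ and $[\mathcal P,\mathcal P]\subset\mathcal P$. A function $a\in C^\infty(U,\mathbb C)$ on an open set $U\subset M$ is *CR-holomorphic* (resp. *CR-antiholomorphic*) if it is annihilated by $\bar{\mathcal P}|_U$ (resp. $\mathcal P|_U$), and *$\xi$-invariant* if $\xi a=0$; an element of $C^\infty(U,\mathbb C)[[\nu]]$ has one of these properties if all its coefficients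 do. **The operators $\ast$ and $\Delta$** are defined in local coordinates $x^i$ as follows (sums over repeated indices). * *Connection.* Let $\nabla^g$ be the Levi-Civita connection and $\nabla=\nabla^g+S$ the contact metric connection with $S^i_{jk}=-\frac12\phi^i_l\nabla^g_k\phi^l_j-\frac12\lambda_j\nabla^g_k\xi^i+\xi^i\nabla^g_k\lambda_j$ and coefficients $\Gamma^i_{jk}$, where $\nabla_kv^i=\partial_kv^i+\Gamma^i_{jk}v^j$. Let $T^i_{jk}=S^i_{jk}-S^i_{kj}$, and let $R^i_{jkl}$ be given by $[\nabla_k,\nabla_l]v^i=R^i_{jkl}v^j+T^j_{kl}\nabla_jv^i$. * *Wick product.* Let $(g^{ij})$ be the inverse of $(g_{ij})$, $\pi^{ij}=g^{il}\phi^j_l$ and $h^{ij}=g^{ij}+i\pi^{ij}$. On formal power series in $y^1,\dots,y^{2m+1}$ and $\nu$ whose coefficients are smooth complex functions of $x$, let $$a\circ b=\exp\Big(\frac\nu2h^{ij}\frac{\partial^2}{\partial y^i\partial z^j}\Big)a(y)b(z)\Big|_{z=y}.$$ Extend $\circ$ to differential forms in $x$ with such coefficients, and let $[\cdot,\cdot]$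 be the graded commutator. A form is called *transverse* if its coefficients are annihilated by $\xi^i\partial/\partial y^i$. Give $y^i$ the degree $1$ and $\nu$ the degree $2$. * *Differentials.* Let $\delta=dx^i\wedge\partial/\partial y^i$, let $d_\nabla=dx^i\wedge\big(\partial/\partial x^i-y^j\Gamma^k_{ji}\,\partial/\partial y^k\big)$, and let $\delta^\ast=y^i(\delta_i^j-\lambda_i\xi^j)\,\iota_{\partial/\partial x^j}$. On forms of form degree $n$ and of degree $k$ in the $y$'s, let $\delta^{-1}$ be $\frac1{k+n}\delta^\ast$ on $\{b:\iota_\xi b=0\}$ and $\frac1{k+n-1}\delta^\ast$ on $\{\lambda\wedge b\}$, and $0$ where the denominator vanishes. * *Fedosov connection.* Let $T=\frac12T_{kij}y^kdx^i\wedge dx^j$ with $T_{kij}=\omega_{kn}T^n_{ij}$, and $R=\frac14R_{ijkl}y^iy^jdx^k\wedge dx^l$ with $R_{ijkl}=-\omega_{in}R^n_{jkl}$, so that $d_\nabla^2a=\frac i\nu[R,a]$ for transverse $a$. Let $r$ be the unique transverse $1$-form of degree at least $2$ with $r=\delta^{-1}(T+R)+\delta^{-1}\big(d_\nabla r+\frac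 i\nu r\circ r\big)$, and let $Db=d_\nabla b-\delta b+\frac i\nu[r,b]$. * *Quantum lift.* For $a\in C^\infty(U,\mathbb C)[[\nu]]$ let $Qa$ be the unique transverse series with $Qa=a+\delta^{-1}\big((D+\delta)Qa\big)$. Define $$\Delta a=\big(\iota_\xi DQa\big)\big|_{y=0},\qquad a\ast b=(Qa\circ Qb)\big|_{y=0}.$$ These operators are local, so they act on $C^\infty(U,\mathbb C)[[\nu]]$ for every open $U\subset M$. A *quantum observable* on $U$ is an element $c\in C^\infty(U,\mathbb C)[[\nu]]$ with $\Delta c=0$. **Theorem.** Let $U$ be an open subset of a Sasakian manifold $M$ and let $a\in C^\infty(U,\mathbb C)[[\nu]]$ be $\xi$-invariant. 1. If $a$ is CR-holomorphic, then $\Delta a=0$, i.e. $a$ is a quantum observable on $U$, and $c\ast a=c\cdot a$ for every quantum observable $c$ on $U$. 2. If $a$ is CR-antiholomorphic, then $\Delta a=0$, and $a\ast c=a\cdot c$ for every quantum observable $c$ on $U$. -/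

import Mathlib

open scoped Manifold ContDiff
open Bundle

noncomputable section

namespace ContactWick

/-- The model space `ℝⁿ`, in which charts take their values. -/
abbrev Model (n : ℕ) := EuclideanSpace ℝ (Fin n)

/-- The partial derivative `∂f/∂xⁱ` of a function on `ℝⁿ`. -/
def pd {n : ℕ} {F : Type*} [NormedAddCommGroup F] [NormedSpace ℝ F]
    (i : Fin n) (f : Model n → F) (u : Model n) : F :=
  fderiv ℝ f u (EuclideanSpace.single i (1 : ℝ))

/-! ### Contact metric structures -/

section Manifold

variable {n : ℕ} {M : Type*} [TopologicalSpace M] [ChartedSpace (Model n) M]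

/-- The coordinate vector `∂/∂xʲ` of the chart `e`, at the point with coordinates `u`. -/
def coordVec (e : OpenPartialHomeomorph M (Model n)) (u : Model n) (j : Fin n) :
    TangentSpace (𝓡 n) (e.symm u) :=
  mfderiv (𝓡 n) (𝓡 n) e.symm u (EuclideanSpace.single j (1 : ℝ) : Model n)

/-- The `i`-th component, in the chart `e`, of a tangent vector at the point with coordinates
`u`. -/
def coordComp (e : OpenPartialHomeomorph M (Model n)) (u : Model n)
    (v : TangentSpace (𝓡 n) (e.symm u)) (i : Fin n) : ℝ :=
  (EuclideanSpace.proj i : Model n →L[ℝ] ℝ) (mfderiv (𝓡 n) (𝓡 n) e (e.symm u) v)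

end Manifold

/-- A contact metric structure `(φ, ξ, λ, g)` on a smooth manifold `M`: a smooth Riemannian metric
`g`, a smooth 1-form `λ`, a smooth vector field `ξ` and a smooth endomorphism `φ` of `TM` with
`λ(X) = g(X, ξ)`, `dλ(X, Y) = g(X, φ Y)`, `g(φ X, φ Y) = g(X, Y) - λ(X) λ(Y)`, `φ² = -1 + ξ ⊗ λ`,
`λ(ξ) = 1`, `φ ξ = 0` and `λ ∘ φ = 0`.

The exterior derivative is `(dλ)ᵢⱼ = ∂ᵢ λⱼ - ∂ⱼ λᵢ` in every chart of the maximal smooth atlas. That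
`λ` is a contact form (`dλ` is nondegenerate on `ker λ`) and that `ξ` is its Reeb field are
consequences, see `ContactMetric.eq_zero_of_form_eq_zero` and
`ContactMetric.metric_reeb_phi`. -/
structure ContactMetric (n : ℕ) (M : Type*) [TopologicalSpace M] [ChartedSpace (Model n) M]
    [IsManifold (𝓡 n) ∞ M] where
  metric : ContMDiffRiemannianMetric (𝓡 n) ∞ (Model n) (fun x : M => TangentSpace (𝓡 n) x)
  form : ∀ x : M, TangentSpace (𝓡 n) x →L[ℝ] ℝ
  reeb : ∀ x : M, TangentSpace (𝓡 n) x
  phi : ∀ x : M, TangentSpace (𝓡 n) x →L[ℝ] TangentSpace (𝓡 n) x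
  form_smooth : ContMDiff (𝓡 n) ((𝓡 n).prod 𝓘(ℝ, Model n →L[ℝ] ℝ)) ∞
    (fun x => TotalSpace.mk' (Model n →L[ℝ] ℝ) x (form x))
  reeb_smooth : ContMDiff (𝓡 n) ((𝓡 n).prod 𝓘(ℝ, Model n)) ∞
    (fun x => TotalSpace.mk' (Model n) x (reeb x))
  phi_smooth : ContMDiff (𝓡 n) ((𝓡 n).prod 𝓘(ℝ, Model n →L[ℝ] Model n)) ∞
    (fun x => TotalSpace.mk' (Model n →L[ℝ] Model n) x (phi x))
  form_eq : ∀ (x : M) (v : TangentSpace (𝓡 n) x), form x v = metric.inner x v (reeb x)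
  extDeriv_form : ∀ e ∈ IsManifold.maximalAtlas (𝓡 n) ∞ M, ∀ u ∈ e.target, ∀ i j : Fin n,
    pd i (fun w => form (e.symm w) (coordVec e w j)) u
      - pd j (fun w => form (e.symm w) (coordVec e w i)) u
      = metric.inner (e.symm u) (coordVec e u i) (phi (e.symm u) (coordVec e u j))
  metric_phi : ∀ (x : M) (v w : TangentSpace (𝓡 n) x),
    metric.inner x (phi x v) (phi x w) = metric.inner x v w - form x v * form x w
  phi_phi : ∀ (x : M) (v : TangentSpace (𝓡 n) x), phi x (phi x v) = -v + form x v • reeb x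
  form_reeb : ∀ x : M, form x (reeb x) = 1
  phi_reeb : ∀ x : M, phi x (reeb x) = 0
  form_phi : ∀ (x : M) (v : TangentSpace (𝓡 n) x), form x (phi x v) = 0

/-- Components, in a coordinate chart with values in `ℝⁿ`, of the tensors of a contact metric
structure: `g u i j = gᵢⱼ`, `lam u i = λᵢ`, `xi u i = ξⁱ`, `phi u i j = φⁱⱼ`. -/
structure CoordData (n : ℕ) where
  g : Model n → Matrix (Fin n) (Fin n) ℝ
  lam : Model n → Fin n → ℝ
  xi : Model n → Fin n → ℝ
  phi : Model n → Matrix (Fin n) (Fin n) ℝ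

namespace ContactMetric

variable {n : ℕ} {M : Type*} [TopologicalSpace M] [ChartedSpace (Model n) M]
  [IsManifold (𝓡 n) ∞ M]

/-- `dλ = g(·, φ ·)` is nondegenerate on `ker λ`. As `ker λ` is a hyperplane, this says that `M` has
odd dimension `2m + 1` and that `λ ∧ (dλ)ᵐ` vanishes nowhere. -/
theorem eq_zero_of_form_eq_zero (S : ContactMetric n M) (x : M) (v : TangentSpace (𝓡 n) x)
    (hv : S.form x v = 0) (h : ∀ w, S.metric.inner x v (S.phi x w) = 0) : v = 0 := by
  by_contra hne
  have h1 := h (S.phi x v)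
  rw [S.phi_phi, hv, zero_smul, add_zero, map_neg, neg_eq_zero] at h1
  exact absurd h1 (S.metric.pos x v hne).ne'

/-- `dλ(ξ, ·) = g(ξ, φ ·) = 0`. -/
theorem metric_reeb_phi (S : ContactMetric n M) (x : M) (w : TangentSpace (𝓡 n) x) :
    S.metric.inner x (S.reeb x) (S.phi x w) = 0 := by
  rw [S.metric.symm, ← S.form_eq, S.form_phi]

/-- The components of the contact metric structure in the chart `e`. -/
def coord (S : ContactMetric n M) (e : OpenPartialHomeomorph M (Model n)) : CoordData n where
  g u := Matrix.of fun i j => S.metric.inner (e.symm u) (coordVec e u i) (coordVec e u j)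
  lam u i := S.form (e.symm u) (coordVec e u i)
  xi u i := coordComp e u (S.reeb (e.symm u)) i
  phi u := Matrix.of fun i j => coordComp e u (S.phi (e.symm u) (coordVec e u j)) i

end ContactMetric

/-! ### Tensor calculus in a chart -/

namespace CoordData

variable {n : ℕ} (D : CoordData n)

/-- `gⁱʲ`. -/
def gInv (u : Model n) : Matrix (Fin n) (Fin n) ℝ := (D.g u)⁻¹

/-- `ωᵢⱼ = (dλ)ᵢⱼ = ∂ᵢ λⱼ - ∂ⱼ λᵢ`. -/
def omega (u : Model n) (i j : Fin n) : ℝ :=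
  pd i (fun w => D.lam w j) u - pd j (fun w => D.lam w i) u

/-- The Lie derivative `(L_ξ g)ᵢⱼ = ξᵏ ∂ₖ gᵢⱼ + gₖⱼ ∂ᵢ ξᵏ + gᵢₖ ∂ⱼ ξᵏ`. -/
def lieReebMetric (u : Model n) (i j : Fin n) : ℝ :=
  ∑ k, (D.xi u k * pd k (fun w => D.g w i j) u + D.g u k j * pd i (fun w => D.xi w k) u
    + D.g u i k * pd j (fun w => D.xi w k) u)

/-- The fibre at `u` of the holomorphic distribution `𝒫 = {X - i φ X | X ∈ ker λ}`. -/
def holDist (u : Model n) : Set (Fin n → ℂ) :=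
  {Z | ∃ X : Fin n → ℝ, ∑ i, D.lam u i * X i = 0 ∧
    ∀ i, Z i = (X i : ℂ) - Complex.I * ((∑ j, D.phi u i j * X j : ℝ) : ℂ)}

/-- The Levi-Civita Christoffel symbols `Γⁱⱼₖ = ½ gⁱˡ (∂ⱼ gₗₖ + ∂ₖ gₗⱼ - ∂ₗ gⱼₖ)`. -/
def lcGamma (u : Model n) (i j k : Fin n) : ℝ :=
  1 / 2 * ∑ l, D.gInv u i l * (pd j (fun w => D.g w l k) u + pd k (fun w => D.g w l j) u
    - pd l (fun w => D.g w j k) u)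

/-- `(∇ᵍ)ₖ φˡⱼ`. -/
def lcPhi (u : Model n) (k l j : Fin n) : ℝ :=
  pd k (fun w => D.phi w l j) u
    + ∑ m, (D.lcGamma u l m k * D.phi u m j - D.lcGamma u m j k * D.phi u l m)

/-- `(∇ᵍ)ₖ ξⁱ`. -/
def lcXi (u : Model n) (k i : Fin n) : ℝ :=
  pd k (fun w => D.xi w i) u + ∑ m, D.lcGamma u i m k * D.xi u m

/-- `(∇ᵍ)ₖ λⱼ`. -/
def lcLam (u : Model n) (k j : Fin n) : ℝ :=
  pd k (fun w => D.lam w j) u - ∑ m, D.lcGamma u m j k * D.lam u m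

/-- The potential `Sⁱⱼₖ = -½ φⁱₗ (∇ᵍ)ₖ φˡⱼ - ½ λⱼ (∇ᵍ)ₖ ξⁱ + ξⁱ (∇ᵍ)ₖ λⱼ` of the contact metric
connection. -/
def potential (u : Model n) (i j k : Fin n) : ℝ :=
  -(1 / 2) * ∑ l, D.phi u i l * D.lcPhi u k l j - 1 / 2 * (D.lam u j * D.lcXi u k i)
    + D.xi u i * D.lcLam u k j

/-- The coefficients of the contact metric connection `∇ = ∇ᵍ + S`. The last index is the direction
of differentiation: `∇ₖ vⁱ = ∂ₖ vⁱ + Γⁱⱼₖ vʲ`. -/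
def gamma (u : Model n) (i j k : Fin n) : ℝ := D.lcGamma u i j k + D.potential u i j k

/-- The torsion `Tⁱⱼₖ = Sⁱⱼₖ - Sⁱₖⱼ`. -/
def torsion (u : Model n) (i j k : Fin n) : ℝ := D.potential u i j k - D.potential u i k j

/-- The curvature `Rⁱⱼₖₗ`, where `[∇ₖ, ∇ₗ] vⁱ = Rⁱⱼₖₗ vʲ + Tʲₖₗ ∇ⱼ vⁱ`. -/
def curvature (u : Model n) (i j k l : Fin n) : ℝ :=
  pd k (fun w => D.gamma w i j l) u - pd l (fun w => D.gamma w i j k) u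
    + ∑ m, (D.gamma u i m k * D.gamma u m j l - D.gamma u i m l * D.gamma u m j k)

/-- The bivector `πⁱʲ = gⁱˡ φʲₗ`, that is, `π(α, β) = ḡ(α, φᵗ β)`. -/
def bivector (u : Model n) (i j : Fin n) : ℝ := ∑ l, D.gInv u i l * D.phi u j l

/-- The Wick tensor `hⁱʲ = gⁱʲ + i πⁱʲ`. -/
def wickTensor (u : Model n) : Matrix (Fin n) (Fin n) ℂ :=
  Matrix.of fun i j => (D.gInv u i j : ℂ) + Complex.I * (D.bivector u i j : ℂ)

/-- The projector `Pⁱⱼ = δⁱⱼ - ξⁱ λⱼ`. -/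
def proj (u : Model n) (i j : Fin n) : ℝ := (if i = j then 1 else 0) - D.xi u i * D.lam u j

end CoordData

/-- The Lie bracket `[Z, W]ⁱ = Zʲ ∂ⱼ Wⁱ - Wʲ ∂ⱼ Zⁱ` of complex vector fields in a chart. -/
def complexBracket {n : ℕ} (Z W : Model n → Fin n → ℂ) (u : Model n) : Fin n → ℂ :=
  fun i => ∑ j, (Z u j * pd j (fun w => W w i) u - W u j * pd j (fun w => Z w i) u)

namespace ContactMetric

variable {n : ℕ} {M : Type*} [TopologicalSpace M] [ChartedSpace (Model n) M]
  [IsManifold (𝓡 n) ∞ M]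

/-- K-contact: `ξ` is a Killing field of `g`. -/
def IsKContact (S : ContactMetric n M) : Prop :=
  ∀ e ∈ IsManifold.maximalAtlas (𝓡 n) ∞ M, ∀ u ∈ e.target, ∀ i j : Fin n,
    (S.coord e).lieReebMetric u i j = 0

/-- The almost CR structure is integrable: `[𝒫, 𝒫] ⊆ 𝒫`. -/
def IsCRIntegrable (S : ContactMetric n M) : Prop :=
  ∀ e ∈ IsManifold.maximalAtlas (𝓡 n) ∞ M, ∀ Z W : Model n → Fin n → ℂ,
    ContDiffOn ℝ ∞ Z e.target → ContDiffOn ℝ ∞ W e.target →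
    (∀ u ∈ e.target, Z u ∈ (S.coord e).holDist u) →
    (∀ u ∈ e.target, W u ∈ (S.coord e).holDist u) →
    ∀ u ∈ e.target, complexBracket Z W u ∈ (S.coord e).holDist u

/-- A contact metric structure is Sasakian if it is K-contact and its CR structure is integrable. -/
def IsSasakian (S : ContactMetric n M) : Prop := S.IsKContact ∧ S.IsCRIntegrable

end ContactMetric

/-! ### The formal Wick algebra -/

/-- The space `ℂ[[y¹, …, yⁿ]][[ν]]` underlying the fibre of the bundle of formal Wick algebras. -/
abbrev Wick (n : ℕ) := PowerSeries (MvPowerSeries (Fin n) ℂ)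

namespace Wick

variable {n : ℕ}

/-- The coefficient of `νᵏ y^α`. -/
def cf (k : ℕ) (α : Fin n →₀ ℕ) (a : Wick n) : ℂ := MvPowerSeries.coeff α (PowerSeries.coeff k a)

/-- The series with given coefficients. -/
def ofCf (f : ℕ → (Fin n →₀ ℕ) → ℂ) : Wick n :=
  PowerSeries.mk fun k => ((fun α => f k α : (Fin n →₀ ℕ) → ℂ) : MvPowerSeries (Fin n) ℂ)

/-- Scalars. -/
def const (z : ℂ) : Wick n := PowerSeries.C (MvPowerSeries.C z)

/-- The fibre coordinate `yⁱ`. -/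
def y (i : Fin n) : Wick n := PowerSeries.C (MvPowerSeries.X i)

/-- `∂/∂yⁱ`. -/
def dy (i : Fin n) (a : Wick n) : Wick n :=
  PowerSeries.mk fun k => MvPowerSeries.pderiv ℂ i (PowerSeries.coeff k a)

/-- `h^{i₁j₁} ⋯ h^{iₖjₖ} (∂_{i₁} ⋯ ∂_{iₖ} a) (∂_{j₁} ⋯ ∂_{jₖ} b)`. -/
def bidiff (h : Matrix (Fin n) (Fin n) ℂ) : ℕ → Wick n → Wick n → Wick n
  | 0, a, b => a * b
  | k + 1, a, b => ∑ i, ∑ j, const (h i j) * bidiff h k (dy i a) (dy j b)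

/-- The product `a ∘ b = exp(½ ν hⁱʲ ∂/∂yⁱ ∂/∂zʲ) a(y) b(z) |_{z = y}`
`= ∑ₖ (ν/2)ᵏ / k! · h^{i₁j₁} ⋯ h^{iₖjₖ} (∂_{i₁} ⋯ ∂_{iₖ} a) (∂_{j₁} ⋯ ∂_{jₖ} b)`. -/
def circ (h : Matrix (Fin n) (Fin n) ℂ) (a b : Wick n) : Wick n :=
  PowerSeries.mk fun N => ∑ kl ∈ Finset.HasAntidiagonal.antidiagonal N,
    ((1 / 2 : ℂ) ^ kl.1 / (kl.1.factorial : ℂ)) • PowerSeries.coeff kl.2 (bidiff h kl.1 a b)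

/-- `(i/ν) a`, for `a` without term of order `ν⁰`. It is applied only to commutators, which have
none. -/
def iDivNu (a : Wick n) : Wick n :=
  PowerSeries.mk fun k => Complex.I • PowerSeries.coeff (k + 1) a

/-- Multiplication of the part of each degree `m` in the `y`s by `c m`. -/
def weight (c : ℕ → ℂ) (a : Wick n) : Wick n := ofCf fun k α => c α.degree * cf k α a

/-- Restriction to `y = 0`. -/
def atZero (a : Wick n) : PowerSeries ℂ := PowerSeries.mk fun k => cf k 0 a

end Wick

open Wick

/-- Sections of the bundle of formal Wick algebras over a chart. -/
abbrev WSec (n : ℕ) := Model n → Wick n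

/-- Elements of `𝒲 ⊗ Λ₁`: the form `bᵢ dxⁱ` is given by its components `bᵢ`. -/
abbrev WForm1 (n : ℕ) := Fin n → WSec n

/-- Elements of `𝒲 ⊗ Λ₂`: the form `½ Bᵢⱼ dxⁱ ∧ dxʲ`, with `Bᵢⱼ` antisymmetric, is given by its
components `Bᵢⱼ`. -/
abbrev WForm2 (n : ℕ) := Fin n → Fin n → WSec n

/-- `∂/∂xⁱ`, acting on the coefficients of a section. -/
def dx {n : ℕ} (i : Fin n) (a : WSec n) : WSec n :=
  fun u => ofCf fun k α => pd i (fun w => cf k α (a w)) u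

/-- The limit of a sequence of sections whose coefficients of `ν`-degree `d` (where `ν` has degree
`2` and each `yⁱ` has degree `1`) do not change any more from the `d`-th member on. -/
def stableLimit {n : ℕ} (f : ℕ → WSec n) : WSec n :=
  fun u => ofCf fun k α => cf k α (f (2 * k + α.degree) u)

namespace CoordData

variable {n : ℕ} (D : CoordData n)

/-- The fibrewise product of sections. -/
def mul (a b : WSec n) : WSec n := fun u => circ (D.wickTensor u) (a u) (b u)

/-- `(i/ν) [a, b] = (i/ν) (a ∘ b - b ∘ a)`. -/
def comm (a b : WSec n) : WSec n := fun u => iDivNu (D.mul a b u - D.mul b a u)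

/-- The covariant derivative `∇ᵢ a = ∂a/∂xⁱ - yʲ Γᵏⱼᵢ ∂a/∂yᵏ`. -/
def nabla (i : Fin n) (a : WSec n) : WSec n := fun u =>
  dx i a u - ∑ j, ∑ k, const (D.gamma u k j i : ℂ) * (y j * dy k (a u))

/-- `d_∇` on `𝒲 ⊗ Λ₁`. -/
def dNabla1 (b : WForm1 n) : WForm2 n := fun i j => D.nabla i (b j) - D.nabla j (b i)

/-- The torsion element `T = ½ Tₖᵢⱼ yᵏ dxⁱ ∧ dxʲ` with `Tₖᵢⱼ = ωₖₘ Tᵐᵢⱼ`. -/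
def torsionElt : WForm2 n := fun i j u =>
  ∑ k, const ((∑ m, D.omega u k m * D.torsion u m i j : ℝ) : ℂ) * y k

/-- The curvature element `R = ¼ Rᵢⱼₖₗ yⁱ yʲ dxᵏ ∧ dxˡ` with `Rᵢⱼₖₗ = -ωᵢₘ Rᵐⱼₖₗ`; the sign is the one
for which `d_∇² a = (i/ν) [R, a]`. -/
def curvatureElt : WForm2 n := fun k l u =>
  ∑ i, ∑ j, const ((1 / 2 * ∑ m, -D.omega u i m * D.curvature u m j k l : ℝ) : ℂ) * (y i * y j)

/-- `(i/ν) r ∘ r` for a 1-form `r`. -/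
def sqForm (r : WForm1 n) : WForm2 n := fun i j => D.comm (r i) (r j)

/-- `δ* = yⁱ Pʲᵢ i(∂/∂xʲ)` on 1-forms. -/
def deltaStar1 (b : WForm1 n) : WSec n := fun u =>
  ∑ i, ∑ j, const (D.proj u j i : ℂ) * (y i * b j u)

/-- `δ* = yⁱ Pʲᵢ i(∂/∂xʲ)` on 2-forms. -/
def deltaStar2 (B : WForm2 n) : WForm1 n := fun k u =>
  ∑ i, ∑ j, const (D.proj u j i : ℂ) * (y i * B j k u)

/-- The component `λ ∧ i_ξ b` of a 1-form `b` in `𝒲 ⊗ Λ^λ`. -/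
def lamPart1 (b : WForm1 n) : WForm1 n := fun j u =>
  const (D.lam u j : ℂ) * ∑ l, const (D.xi u l : ℂ) * b l u

/-- The component `λ ∧ i_ξ B` of a 2-form `B` in `𝒲 ⊗ Λ^λ`. -/
def lamPart2 (B : WForm2 n) : WForm2 n := fun j k u =>
  const (D.lam u j : ℂ) * (∑ l, const (D.xi u l : ℂ) * B l k u)
    - const (D.lam u k : ℂ) * (∑ l, const (D.xi u l : ℂ) * B l j u)

/-- `δ⁻¹` on 1-forms: with `m` the degree in the `y`s, it is `δ* / (m + 1)` on `𝒲 ⊗ Λ^ξ`, and on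
`𝒲 ⊗ Λ^λ` it is `δ* / m` for `m > 0` and `0` for `m = 0`. -/
def deltaInv1 (b : WForm1 n) : WSec n := D.deltaStar1 fun j u =>
  weight (fun m => 1 / ((m : ℂ) + 1)) (b j u - D.lamPart1 b j u)
    + weight (fun m => if m = 0 then 0 else 1 / (m : ℂ)) (D.lamPart1 b j u)

/-- `δ⁻¹` on 2-forms: with `m` the degree in the `y`s, it is `δ* / (m + 2)` on `𝒲 ⊗ Λ^ξ` and
`δ* / (m + 1)` on `𝒲 ⊗ Λ^λ`. -/
def deltaInv2 (B : WForm2 n) : WForm1 n := D.deltaStar2 fun j k u =>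
  weight (fun m => 1 / ((m : ℂ) + 2)) (B j k u - D.lamPart2 B j k u)
    + weight (fun m => 1 / ((m : ℂ) + 1)) (D.lamPart2 B j k u)

/-! ### The Fedosov connection, the quantum lift and the quantization -/

/-- `r ↦ δ⁻¹(T + R) + δ⁻¹(d_∇ r + (i/ν) r ∘ r)`. -/
def fedosovStep (r : WForm1 n) : WForm1 n :=
  D.deltaInv2 (D.torsionElt + D.curvatureElt) + D.deltaInv2 (D.dNabla1 r + D.sqForm r)

/-- The iterates of `fedosovStep`, starting from `0`. -/
def fedosovIter (N : ℕ) : WForm1 n := D.fedosovStep^[N] 0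

/-- The 1-form `r` of the canonical abelian connection: the solution of
`r = δ⁻¹(T + R) + δ⁻¹(d_∇ r + (i/ν) r ∘ r)` in elements of `ν`-degree at least `2`, obtained by
iteration. -/
def fedosovForm : WForm1 n := fun i => stableLimit fun N => D.fedosovIter N i

/-- `(D + δ) b = d_∇ b + (i/ν) [r, b]` for a section `b`. -/
def connPlusDelta (b : WSec n) : WForm1 n := fun i => D.nabla i b + D.comm (D.fedosovForm i) b

/-- The Fedosov connection `D b = d_∇ b - δ b + (i/ν) [r, b]` on sections. -/
def conn (b : WSec n) : WForm1 n := fun i => D.connPlusDelta b i - fun u => dy i (b u)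

/-- A function with values in `ℂ[[ν]]` as a section of the bundle of formal Wick algebras. -/
def embed (a : Model n → PowerSeries ℂ) : WSec n :=
  fun u => PowerSeries.map (MvPowerSeries.C (σ := Fin n) (R := ℂ)) (a u)

/-- The iterates of `b ↦ a + δ⁻¹((D + δ) b)`, starting from `a`. -/
def liftIter (a : Model n → PowerSeries ℂ) (N : ℕ) : WSec n :=
  (fun b => embed a + D.deltaInv1 (D.connPlusDelta b))^[N] (embed a)

/-- The quantum lift `Q a`: the solution `b` of `b = a + δ⁻¹((D + δ) b)`, obtained by iteration. -/
def lift (a : Model n → PowerSeries ℂ) : WSec n := stableLimit (D.liftIter a)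

/-- `i_ξ Π b` for a 1-form `b`, where `Π b = λ · (i_ξ b)|_{y = 0}` on 1-forms. -/
def reebPi1 (b : WForm1 n) (u : Model n) : PowerSeries ℂ :=
  ∑ i, PowerSeries.C (D.xi u i : ℂ) * (PowerSeries.C (D.lam u i : ℂ) *
    atZero (∑ j, const (D.xi u j : ℂ) * b j u))

/-- `Δ a = i_ξ Π D Q a`. -/
def delta (a : Model n → PowerSeries ℂ) : Model n → PowerSeries ℂ :=
  D.reebPi1 (D.conn (D.lift a))

/-- `a ∗ b = Π (Q a ∘ Q b)`. -/
def star (a b : Model n → PowerSeries ℂ) : Model n → PowerSeries ℂ :=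
  fun u => atZero (D.mul (D.lift a) (D.lift b) u)

end CoordData

/-! ### Observables on open subsets of the manifold -/

section Observables

variable {n : ℕ} {M : Type*} [TopologicalSpace M] [ChartedSpace (Model n) M]

/-- `a` is a formal power series in `ν` whose coefficients are smooth complex functions on `U`,
that is, `a ∈ C^∞(U)[[ν]]`. Values outside `U` are irrelevant. -/
def SmoothOn (U : Set M) (a : PowerSeries (M → ℂ)) : Prop :=
  ∀ k, ContMDiffOn (𝓡 n) 𝓘(ℝ, ℂ) ∞ (PowerSeries.coeff k a) U

/-- The coordinate expression of `a` in the chart `e`. -/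
def inChart (e : OpenPartialHomeomorph M (Model n)) (a : PowerSeries (M → ℂ)) :
    Model n → PowerSeries ℂ :=
  fun u => PowerSeries.mk fun k => PowerSeries.coeff k a (e.symm u)

/-- The differential of a complex-valued function, applied to a real tangent vector. -/
def diff (f : M → ℂ) (p : M) (v : TangentSpace (𝓡 n) p) : ℂ :=
  (mfderiv (𝓡 n) 𝓘(ℝ, ℂ) f p v : ℂ)

end Observables

namespace ContactMetric

variable {n : ℕ} {M : Type*} [TopologicalSpace M] [ChartedSpace (Model n) M]
  [IsManifold (𝓡 n) ∞ M] (S : ContactMetric n M)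

/-- The function `Δ a` on the domain of the chart `e`, computed in the coordinates `e`. -/
def deltaIn (e : OpenPartialHomeomorph M (Model n)) (a : PowerSeries (M → ℂ)) :
    PowerSeries (M → ℂ) :=
  PowerSeries.mk fun k p => PowerSeries.coeff k ((S.coord e).delta (inChart e a) (e p))

/-- The function `a ∗ b` on the domain of the chart `e`, computed in the coordinates `e`. -/
def starIn (e : OpenPartialHomeomorph M (Model n)) (a b : PowerSeries (M → ℂ)) :
    PowerSeries (M → ℂ) :=
  PowerSeries.mk fun k p =>
    PowerSeries.coeff k ((S.coord e).star (inChart e a) (inChart e b) (e p))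

/-- The functions `a` and `b` on the domain of the chart `e` have equal coefficients on
`U ∩ e.source`. -/
def EqIn (U : Set M) (e : OpenPartialHomeomorph M (Model n)) (a b : PowerSeries (M → ℂ)) : Prop :=
  ∀ k, Set.EqOn (PowerSeries.coeff k a) (PowerSeries.coeff k b) (U ∩ e.source)

/-- Quantum observables on `U`: the elements `a` of `C^∞(U)[[ν]]` with `Δ a = 0` on `U`. -/
def IsQuantumObservable (U : Set M) (a : PowerSeries (M → ℂ)) : Prop :=
  SmoothOn (n := n) U a ∧
    ∀ e ∈ IsManifold.maximalAtlas (𝓡 n) ∞ M, EqIn U e (S.deltaIn e a) 0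

/-- `ξ a = 0` on `U`. -/
def IsReebInvariant (U : Set M) (a : PowerSeries (M → ℂ)) : Prop :=
  ∀ k, ∀ p ∈ U, diff (PowerSeries.coeff k a) p (S.reeb p) = 0

/-- `a` is annihilated by the vectors `X + i φ X`, `X ∈ ker λ`, of the antiholomorphic
distribution over `U`. -/
def IsCRHolomorphic (U : Set M) (a : PowerSeries (M → ℂ)) : Prop :=
  ∀ k, ∀ p ∈ U, ∀ v : TangentSpace (𝓡 n) p, S.form p v = 0 →
    diff (PowerSeries.coeff k a) p v
      + Complex.I * diff (PowerSeries.coeff k a) p (S.phi p v) = 0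

/-- `a` is annihilated by the vectors `X - i φ X`, `X ∈ ker λ`, of the holomorphic
distribution over `U`. -/
def IsCRAntiholomorphic (U : Set M) (a : PowerSeries (M → ℂ)) : Prop :=
  ∀ k, ∀ p ∈ U, ∀ v : TangentSpace (𝓡 n) p, S.form p v = 0 →
    diff (PowerSeries.coeff k a) p v
      - Complex.I * diff (PowerSeries.coeff k a) p (S.phi p v) = 0

end ContactMetric

end ContactWick

end

/-! A CR-holomorphic, `ξ`-invariant function is one that is constant along the complex distribution
`N = E₋ᵢ ⊕ ℂξ`, where `E_s` is the eigenspace of `φ` for `s`; in the antiholomorphic case `N = Eᵢ ⊕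
ℂξ`. The proof shows that the whole Fedosov construction respects such an `N`, in the following
sense. The series in `y` whose homogeneous parts vanish on `N` form an ideal, stable under
derivatives in directions of `N`. Since one index of the Wick tensor lies in `N`
(`wickTensor_row_mem`, `wickTensor_col_mem`), the Wick product with a factor from this ideal, placed
on the matching side, stays in the ideal. Geometrically, `N` is isotropic for `ω`, contains `ξ`, and
is preserved by the contact metric connection because `∇φ = 0` (`matPd_phi`); hence the curvature
preserves it too. The torsion preserves `N` exactly because of the Sasakian condition: on `E_s` this
is involutivity, and on pairs with `ξ` it is `L_ξ φ = 0` (`torsion_mem`). These facts are collected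
in `Polarization`. By induction along the Fedosov recursion, `r(p)` vanishes on `N` for every `p` in
`N` (`adapted1_fedosovForm`). By a second induction, `Qa - a` vanishes on `N` (`lift_sub_mem`). The
contraction of `D Qa` with `ξ` then vanishes on `N` as well, and its value at `y = 0` is zero, so
`Δa = 0` (`delta_eq_zero`). In `Qc ∘ Qa = Qc ∘ (Qa - a) + Qc · a` the first term vanishes on `N`
when the rows of the Wick tensor lie in `N`, which leaves `c · a` at `y = 0` (`star_eq_mul_right`);
the other order is the mirror image with columns (`star_eq_mul_left`). -/

noncomputable section

namespace ContactWick

open Finset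

variable {n : ℕ}

/-! ### Evaluation of the homogeneous parts of a power series -/

/-- The value at `v` of the homogeneous part of degree `d` of a power series. -/
def homEval (d : ℕ) (v : Fin n → ℂ) : MvPowerSeries (Fin n) ℂ →ₗ[ℂ] ℂ where
  toFun f := ∑ α ∈ univ.finsuppAntidiag d, MvPowerSeries.coeff α f * ∏ i, v i ^ α i
  map_add' f g := by simp [add_mul, sum_add_distrib]
  map_smul' c f := by simp [mul_sum, mul_assoc]

lemma homEval_apply (d : ℕ) (v : Fin n → ℂ) (f : MvPowerSeries (Fin n) ℂ) :
    homEval d v f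
      = ∑ α ∈ univ.finsuppAntidiag d, MvPowerSeries.coeff α f * ∏ i, v i ^ α i := rfl

lemma homEval_zero (v : Fin n → ℂ) (f : MvPowerSeries (Fin n) ℂ) :
    homEval 0 v f = MvPowerSeries.coeff 0 f := by
  simp [homEval_apply]

/-- `homEval d v f` is the coefficient of `t^d` in `f(tv)`, and `f ↦ f(tv)` is multiplicative. This
is what makes vanishing on a subspace an ideal property. -/
lemma homEval_mul (d : ℕ) (v : Fin n → ℂ) (f g : MvPowerSeries (Fin n) ℂ) :
    homEval d v (f * g) = ∑ p ∈ antidiagonal d, homEval p.1 v f * homEval p.2 v g := by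
  classical
  have hR : ∀ p : ℕ × ℕ, homEval p.1 v f * homEval p.2 v g
      = ∑ q ∈ univ.finsuppAntidiag p.1 ×ˢ univ.finsuppAntidiag p.2,
        (MvPowerSeries.coeff q.1 f * ∏ i, v i ^ q.1 i)
          * (MvPowerSeries.coeff q.2 g * ∏ i, v i ^ q.2 i) := fun p => by
    rw [homEval_apply, homEval_apply, sum_mul_sum, sum_product]
  simp only [hR]
  simp only [homEval_apply, MvPowerSeries.coeff_mul, sum_mul]
  rw [sum_sigma', sum_sigma']
  -- Both sides sum over pairs of exponents of total degree `d`, grouped once by their sum and once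
  -- by their two degrees.
  refine sum_bij' (fun (x : Σ _ : Fin n →₀ ℕ, (Fin n →₀ ℕ) × (Fin n →₀ ℕ)) _ =>
      (⟨(∑ i, x.2.1 i, ∑ i, x.2.2 i), x.2⟩ : Σ _ : ℕ × ℕ, (Fin n →₀ ℕ) × (Fin n →₀ ℕ)))
    (fun x _ => ⟨x.2.1 + x.2.2, x.2⟩) ?_ ?_ ?_ ?_ ?_
  · rintro ⟨α, β, γ⟩ h
    simp only [mem_sigma, mem_finsuppAntidiag, HasAntidiagonal.mem_antidiagonal, subset_univ, and_true] at h
    obtain ⟨h1, h2⟩ := h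
    subst h2
    simpa [sum_add_distrib] using h1
  · rintro ⟨p, β, γ⟩ h
    simp only [mem_sigma, mem_finsuppAntidiag, HasAntidiagonal.mem_antidiagonal,
      mem_product, subset_univ, and_true] at h
    simp only [mem_sigma, mem_finsuppAntidiag, HasAntidiagonal.mem_antidiagonal, subset_univ,
      and_true]
    change ∑ i, (β i + γ i) = d
    rw [sum_add_distrib, h.2.1, h.2.2, h.1]
  · rintro ⟨α, β, γ⟩ h
    simp only [mem_sigma, mem_finsuppAntidiag, HasAntidiagonal.mem_antidiagonal] at h
    simp [h.2]
  · rintro ⟨⟨p, q⟩, β, γ⟩ h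
    simp only [mem_sigma, mem_finsuppAntidiag, mem_product, subset_univ, and_true] at h
    simp [h.2.1, h.2.2]
  · rintro ⟨α, β, γ⟩ h
    simp only [mem_sigma, mem_finsuppAntidiag, HasAntidiagonal.mem_antidiagonal] at h
    rw [← h.2]
    simp only [Finsupp.add_apply, pow_add, prod_mul_distrib]
    ring

lemma homEval_X_mul_zero (v : Fin n → ℂ) (i : Fin n) (f : MvPowerSeries (Fin n) ℂ) :
    homEval 0 v (MvPowerSeries.X i * f) = 0 := by
  simp [homEval_zero]

lemma homEval_X (d : ℕ) (v : Fin n → ℂ) (i : Fin n) :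
    homEval d v (MvPowerSeries.X i) = if d = 1 then v i else 0 := by
  classical
  rw [homEval_apply]
  simp only [MvPowerSeries.coeff_X, ite_mul, zero_mul, one_mul]
  rw [sum_ite_eq']
  have : (Finsupp.single i 1 ∈ univ.finsuppAntidiag d) ↔ d = 1 := by
    simp [mem_finsuppAntidiag, eq_comm, Finsupp.single_apply]
  simp only [this]
  split_ifs
  · rw [prod_eq_single i] <;> simp +contextual [eq_comm]
  · rfl

lemma homEval_X_mul_succ (d : ℕ) (v : Fin n → ℂ) (i : Fin n) (f : MvPowerSeries (Fin n) ℂ) :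
    homEval (d + 1) v (MvPowerSeries.X i * f) = v i * homEval d v f := by
  rw [homEval_mul, sum_eq_single (1, d)]
  · simp [homEval_X]
  · rintro ⟨a, b⟩ h hne
    simp only [HasAntidiagonal.mem_antidiagonal] at h
    rw [homEval_X]
    split_ifs with h1
    · simp only at h1; subst h1
      exact absurd (by simp; omega) hne
    · simp
  · simp [add_comm]

/-- The left side is what the analytic product rule produces from the monomials. The shift `α = β +
eᵢ` turns the factor `αᵢ` into the `βᵢ + 1` of the formal derivative; exponents with `αᵢ = 0`
contribute nothing. -/
lemma sum_monomial_deriv (d : ℕ) (v : Fin n → ℂ) (i : Fin n) (f : MvPowerSeries (Fin n) ℂ) :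
    ∑ α ∈ univ.finsuppAntidiag (d + 1), MvPowerSeries.coeff α f
        * ((∏ j ∈ univ.erase i, v j ^ α j) * ((α i : ℂ) * v i ^ (α i - 1)))
      = homEval d v (MvPowerSeries.pderiv ℂ i f) := by
  classical
  rw [homEval_apply, ← sum_filter_of_ne (p := fun α : Fin n →₀ ℕ => α i ≠ 0)]
  · refine sum_bij' (fun (α : Fin n →₀ ℕ) _ => α - Finsupp.single i 1)
      (fun (β : Fin n →₀ ℕ) _ => β + Finsupp.single i 1)
      ?_ ?_ ?_ ?_ ?_
    · intro α h
      simp only [mem_filter, mem_finsuppAntidiag, subset_univ, and_true] at h ⊢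
      have h1 : α = (α - Finsupp.single i 1) + Finsupp.single i 1 := by
        rw [tsub_add_cancel_of_le]
        simpa [Finsupp.single_le_iff] using Nat.one_le_iff_ne_zero.2 h.2
      have h2 := h.1
      rw [h1] at h2
      change ∑ j, ((α - Finsupp.single i 1 : Fin n →₀ ℕ) j + Finsupp.single i 1 j) = d + 1 at h2
      rw [sum_add_distrib] at h2
      simpa [Finsupp.single_apply] using h2
    · intro β h
      simp only [mem_filter, mem_finsuppAntidiag, subset_univ, and_true] at h ⊢
      simp [sum_add_distrib, h, Finsupp.single_apply]
    · intro α h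
      simp only [mem_filter] at h
      rw [tsub_add_cancel_of_le]
      simpa [Finsupp.single_le_iff] using Nat.one_le_iff_ne_zero.2 h.2
    · intro β h
      simp
    · intro α h
      simp only [mem_filter] at h
      have h1 : α - Finsupp.single i 1 + Finsupp.single i 1 = α := by
        rw [tsub_add_cancel_of_le]
        simpa [Finsupp.single_le_iff] using Nat.one_le_iff_ne_zero.2 h.2
      rw [MvPowerSeries.coeff_pderiv, h1, ← mul_prod_erase univ _ (mem_univ i)]
      have h2 : ∀ j ∈ univ.erase i, v j ^ (α - Finsupp.single i 1 : Fin n →₀ ℕ) j = v j ^ α j := by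
        intro j hj
        simp [(ne_of_mem_erase hj).symm]
      rw [prod_congr rfl h2]
      have h3 : (α - Finsupp.single i 1 : Fin n →₀ ℕ) i = α i - 1 := by simp
      rw [h3]
      have h4 : ((α i - 1 : ℕ) : ℂ) + 1 = α i := by
        exact_mod_cast Nat.succ_pred_eq_of_ne_zero h.2
      rw [h4]
      ring
  · intro α _ h h0
    simp [h0] at h

lemma hasDerivAt_homEval_zero {f : ℝ → MvPowerSeries (Fin n) ℂ} {V : ℝ → Fin n → ℂ}
    {f' : MvPowerSeries (Fin n) ℂ} {t : ℝ}
    (hf : ∀ α, HasDerivAt (fun s => MvPowerSeries.coeff α (f s)) (MvPowerSeries.coeff α f') t) :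
    HasDerivAt (fun s => homEval 0 (V s) (f s)) (homEval 0 (V t) f') t := by
  simpa only [homEval_zero] using hf 0

/-- The chain rule for the evaluation of the homogeneous parts of a power series. -/
lemma hasDerivAt_homEval_succ (d : ℕ) {f : ℝ → MvPowerSeries (Fin n) ℂ} {V : ℝ → Fin n → ℂ}
    {f' : MvPowerSeries (Fin n) ℂ} {V' : Fin n → ℂ} {t : ℝ}
    (hf : ∀ α, HasDerivAt (fun s => MvPowerSeries.coeff α (f s)) (MvPowerSeries.coeff α f') t)
    (hV : ∀ i, HasDerivAt (fun s => V s i) (V' i) t) :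
    HasDerivAt (fun s => homEval (d + 1) (V s) (f s))
      (homEval (d + 1) (V t) f'
        + ∑ i, V' i * homEval d (V t) (MvPowerSeries.pderiv ℂ i (f t))) t := by
  have key : ∀ α : Fin n →₀ ℕ, HasDerivAt
      (fun s => MvPowerSeries.coeff α (f s) * ∏ i, V s i ^ α i)
      (MvPowerSeries.coeff α f' * ∏ i, V t i ^ α i + MvPowerSeries.coeff α (f t)
        * ∑ i, (∏ j ∈ univ.erase i, V t j ^ α j) • ((α i : ℂ) * V t i ^ (α i - 1) * V' i)) t :=
    fun α => (hf α).mul (HasDerivAt.fun_finsetProd fun i _ => (hV i).pow (α i))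
  have := HasDerivAt.fun_sum fun α (_ : α ∈ univ.finsuppAntidiag (d + 1)) => key α
  convert! this using 1
  rw [sum_add_distrib, ← homEval_apply]
  congr 1
  simp only [← sum_monomial_deriv, mul_sum, smul_eq_mul]
  rw [sum_comm]
  refine sum_congr rfl fun α _ => sum_congr rfl fun i _ => ?_
  ring

/-! ### Series vanishing on a subspace -/

namespace Wick

lemma cf_ofCf (f : ℕ → (Fin n →₀ ℕ) → ℂ) (k : ℕ) (α : Fin n →₀ ℕ) : cf k α (ofCf f) = f k α := by
  exact congrFun (PowerSeries.coeff_mk k fun k => (f k : MvPowerSeries (Fin n) ℂ)) α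

lemma cf_add (k : ℕ) (α : Fin n →₀ ℕ) (a b : Wick n) : cf k α (a + b) = cf k α a + cf k α b := by
  simp [cf]

lemma cf_sub (k : ℕ) (α : Fin n →₀ ℕ) (a b : Wick n) : cf k α (a - b) = cf k α a - cf k α b := by
  simp [cf]

lemma cf_smul (k : ℕ) (α : Fin n →₀ ℕ) (z : ℂ) (a : Wick n) : cf k α (z • a) = z * cf k α a := by
  simp [cf]

lemma cf_sum {ι : Type*} (s : Finset ι) (k : ℕ) (α : Fin n →₀ ℕ) (f : ι → Wick n) :
    cf k α (∑ j ∈ s, f j) = ∑ j ∈ s, cf k α (f j) := by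
  simp [cf]

lemma ext_cf {a b : Wick n} (h : ∀ k α, cf k α a = cf k α b) : a = b := by
  ext k α
  exact h k α

/-- The series `a` vanishes on the subspace `N` of the fibre: this is said of the homogeneous parts
of its coefficients. -/
def VanishesOn (N : Submodule ℂ (Fin n → ℂ)) : Submodule ℂ (Wick n) where
  carrier := {a | ∀ k d, ∀ v ∈ N, homEval d v (PowerSeries.coeff k a) = 0}
  zero_mem' := by simp
  add_mem' ha hb k d v hv := by simp [ha k d v hv, hb k d v hv]
  smul_mem' c a ha k d v hv := by simp [ha k d v hv]

variable {N : Submodule ℂ (Fin n → ℂ)} {a b : Wick n}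

/-- The ideal property. -/
lemma mul_mem_vanishesOn (a : Wick n) (hb : b ∈ VanishesOn N) : a * b ∈ VanishesOn N := by
  intro k d v hv
  rw [PowerSeries.coeff_mul, map_sum]
  refine sum_eq_zero fun p _ => ?_
  rw [homEval_mul]
  exact sum_eq_zero fun q _ => by rw [hb p.2 q.2 v hv, mul_zero]

lemma coeff_const_mul (z : ℂ) (a : Wick n) (k : ℕ) :
    PowerSeries.coeff k (const z * a) = MvPowerSeries.C z * PowerSeries.coeff k a := by
  simp [const]

lemma const_mul (z : ℂ) (a : Wick n) : const z * a = z • a := by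
  ext k
  rw [coeff_const_mul, ← MvPowerSeries.smul_eq_C_mul]
  rfl

lemma coeff_dy (i : Fin n) (a : Wick n) (k : ℕ) :
    PowerSeries.coeff k (dy i a) = MvPowerSeries.pderiv ℂ i (PowerSeries.coeff k a) := by
  simp [dy]

lemma dy_add (i : Fin n) (a b : Wick n) : dy i (a + b) = dy i a + dy i b := by
  ext1 k; simp [coeff_dy]

lemma dy_sub (i : Fin n) (a b : Wick n) : dy i (a - b) = dy i a - dy i b := by
  ext1 k; simp [coeff_dy]

lemma dy_zero (i : Fin n) : dy i (0 : Wick n) = 0 := by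
  ext1 k; simp [coeff_dy]

lemma dy_smul (i : Fin n) (z : ℂ) (a : Wick n) : dy i (z • a) = z • dy i a := by
  ext1 k; simp [coeff_dy]

/-- The derivative of a series in a direction. -/
def dirDy (v : Fin n → ℂ) (a : Wick n) : Wick n := ∑ i, v i • dy i a

/-- The line `w + t v` stays in `N`, so `a` is zero along it; its derivative at `t = 0` is the
derivative of `a` in the direction `v`, one degree lower. -/
lemma dirDy_mem_vanishesOn (ha : a ∈ VanishesOn N) {v : Fin n → ℂ} (hv : v ∈ N) :
    dirDy v a ∈ VanishesOn N := by
  intro k d w hw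
  have h1 := hasDerivAt_homEval_succ (t := 0) d (f := fun _ => PowerSeries.coeff k a) (f' := 0)
    (V := fun t => w + (t : ℂ) • v) (V' := v) (fun α => by simpa using hasDerivAt_const _ _)
    (fun i => by
      have h := ((Complex.ofRealCLM.hasDerivAt (x := (0 : ℝ))).mul_const (v i)).const_add (w i)
      simpa using h)
  have h2 : (fun s : ℝ => homEval (d + 1) (w + (s : ℂ) • v) (PowerSeries.coeff k a))
      = fun _ => 0 := by
    funext s
    exact ha k (d + 1) _ (N.add_mem hw (N.smul_mem _ hv))
  rw [h2] at h1
  have h3 := h1.unique (hasDerivAt_const _ _)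
  simpa [dirDy, coeff_dy] using h3

/-! ### The Wick product -/

variable (h : Matrix (Fin n) (Fin n) ℂ)

lemma bidiff_succ (k : ℕ) (a b : Wick n) :
    bidiff h (k + 1) a b = ∑ i, ∑ j, h i j • bidiff h k (dy i a) (dy j b) := by
  simp only [bidiff, const_mul]

lemma bidiff_add_right (k : ℕ) (a b c : Wick n) :
    bidiff h k a (b + c) = bidiff h k a b + bidiff h k a c := by
  induction k generalizing a b c with
  | zero => simp [bidiff, mul_add]
  | succ k ih => simp [bidiff_succ, dy_add, ih, sum_add_distrib]

lemma bidiff_smul_right (k : ℕ) (z : ℂ) (a b : Wick n) :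
    bidiff h k a (z • b) = z • bidiff h k a b := by
  induction k generalizing a b with
  | zero => simp [bidiff]
  | succ k ih => simp [bidiff_succ, dy_smul, ih, smul_sum, smul_comm z]

/-- Exchanging the factors costs only a transposition of the tensor, so every statement about the
left factor follows from the one about the right factor. -/
lemma bidiff_transpose (k : ℕ) (a b : Wick n) : bidiff h.transpose k b a = bidiff h k a b := by
  induction k generalizing a b with
  | zero => simp [bidiff, mul_comm]
  | succ k ih =>
    simp only [bidiff_succ, ih, Matrix.transpose_apply]
    rw [sum_comm]

/-- `bidiff` as a linear map in its second argument. -/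
def bidiffRight (k : ℕ) (a : Wick n) : Wick n →ₗ[ℂ] Wick n where
  toFun := bidiff h k a
  map_add' := bidiff_add_right h k a
  map_smul' z b := bidiff_smul_right h k z a b

/-- For fixed `i`, the sum over `j` differentiates `b` in the direction of the row `h i`, which lies
in `N`. So the right factor never leaves the ideal, whatever happens to the left one. -/
lemma bidiff_mem_vanishesOn (hN : ∀ i, h i ∈ N) (k : ℕ) (a : Wick n) (hb : b ∈ VanishesOn N) :
    bidiff h k a b ∈ VanishesOn N := by
  induction k generalizing a b with
  | zero => exact mul_mem_vanishesOn a hb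
  | succ k ih =>
    rw [bidiff_succ]
    refine Submodule.sum_mem _ fun i _ => ?_
    have : ∑ j, h i j • bidiff h k (dy i a) (dy j b)
        = bidiffRight h k (dy i a) (dirDy (h i) b) := by
      simp [dirDy]; rfl
    rw [this]
    exact ih _ (dirDy_mem_vanishesOn hb (hN i))

lemma coeff_circ (a b : Wick n) (k : ℕ) : PowerSeries.coeff k (circ h a b)
    = ∑ kl ∈ antidiagonal k,
      ((1 / 2 : ℂ) ^ kl.1 / (kl.1.factorial : ℂ)) • PowerSeries.coeff kl.2 (bidiff h kl.1 a b) := by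
  simp [circ]

lemma circ_transpose (a b : Wick n) : circ h.transpose b a = circ h a b := by
  ext1 k
  simp only [coeff_circ, bidiff_transpose]

lemma circ_add_right (a b c : Wick n) : circ h a (b + c) = circ h a b + circ h a c := by
  ext1 k
  simp [coeff_circ, bidiff_add_right, sum_add_distrib]

lemma circ_smul_right (z : ℂ) (a b : Wick n) : circ h a (z • b) = z • circ h a b := by
  ext1 k
  simp [coeff_circ, bidiff_smul_right, smul_sum, smul_comm z]

/-- The Wick product as a bilinear map. -/
def circBilin : Wick n →ₗ[ℂ] Wick n →ₗ[ℂ] Wick n :=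
  LinearMap.mk₂ ℂ (circ h)
    (fun a b c => by simp only [← circ_transpose h, circ_add_right])
    (fun z a b => by simp only [← circ_transpose h, circ_smul_right])
    (circ_add_right h) (fun z a b => circ_smul_right h z a b)

lemma circBilin_apply (a b : Wick n) : circBilin h a b = circ h a b := rfl

lemma circ_mem_of_right (hN : ∀ i, h i ∈ N) (a : Wick n) (hb : b ∈ VanishesOn N) :
    circ h a b ∈ VanishesOn N := by
  intro k d v hv
  rw [coeff_circ, map_sum]
  refine sum_eq_zero fun p _ => ?_
  rw [map_smul, bidiff_mem_vanishesOn h hN p.1 a hb p.2 d v hv, smul_zero]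

lemma circ_mem_of_left (hN : ∀ j, (fun i => h i j) ∈ N) (ha : a ∈ VanishesOn N) (b : Wick n) :
    circ h a b ∈ VanishesOn N := by
  rw [← circ_transpose]
  exact circ_mem_of_right _ hN b ha

lemma bidiff_zero_right (k : ℕ) (a : Wick n) : bidiff h k a 0 = 0 :=
  map_zero (bidiffRight h k a)

/-- Every term of positive order in the exponential differentiates `b`. -/
lemma circ_eq_mul_of_right (a : Wick n) (hb : ∀ i, dy i b = 0) : circ h a b = a * b := by
  ext1 k
  rw [coeff_circ, sum_eq_single (0, k)]
  · simp [bidiff]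
  · rintro ⟨p, q⟩ hp hne
    rcases p with _ | p
    · simp only [HasAntidiagonal.mem_antidiagonal, zero_add] at hp
      exact absurd (by simp [hp]) hne
    · simp [bidiff_succ, hb, bidiff_zero_right]
  · simp

lemma circ_eq_mul_of_left (ha : ∀ i, dy i a = 0) (b : Wick n) : circ h a b = a * b := by
  rw [← circ_transpose, circ_eq_mul_of_right _ _ ha, mul_comm]

/-- The Wick product with tensor `h` is compatible with the subspace `N`: one of the two factors is
differentiated only in the directions of `N`. -/
def Compatible (N : Submodule ℂ (Fin n → ℂ)) : Prop :=
  (∀ i, h i ∈ N) ∨ ∀ j, (fun i => h i j) ∈ N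

/-- If `a` vanishes on `N` and `b` is constant on `N`, then `a ∘ b` and `b ∘ a` vanish on `N`. -/
lemma circ_mem_vanishesOn {h : Matrix (Fin n) (Fin n) ℂ} (hN : Compatible h N)
    (ha : a ∈ VanishesOn N) {c : Wick n} (hc : ∀ i, dy i c = 0) (hb : b - c ∈ VanishesOn N) :
    circ h a b ∈ VanishesOn N ∧ circ h b a ∈ VanishesOn N := by
  have hl : circ h a b = circ h a (b - c) + a * c := by
    rw [← circ_eq_mul_of_right h a hc, ← circ_add_right, sub_add_cancel]
  have hr : circ h b a = circ h (b - c) a + c * a := by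
    rw [← circ_eq_mul_of_left h hc, ← circBilin_apply, ← circBilin_apply, ← circBilin_apply,
      ← LinearMap.add_apply, ← map_add, sub_add_cancel]
  have hca : c * a ∈ VanishesOn N := mul_mem_vanishesOn c ha
  have hac : a * c ∈ VanishesOn N := mul_comm c a ▸ hca
  -- With rows in `N` the right factor has to lie in the ideal: `b ∘ a` qualifies directly, `a ∘ b`
  -- after subtracting from `b` its part `c`, which multiplies classically. With columns the roles
  -- are exchanged.
  rcases hN with hN | hN
  · exact ⟨hl ▸ (VanishesOn N).add_mem (circ_mem_of_right h hN a hb) hac,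
      circ_mem_of_right h hN b ha⟩
  · exact ⟨circ_mem_of_left h hN ha b,
      hr ▸ (VanishesOn N).add_mem (circ_mem_of_left h hN hb a) hca⟩

lemma coeff_iDivNu (a : Wick n) (k : ℕ) :
    PowerSeries.coeff k (iDivNu a) = Complex.I • PowerSeries.coeff (k + 1) a := by
  simp [iDivNu]

lemma iDivNu_mem_vanishesOn (ha : a ∈ VanishesOn N) : iDivNu a ∈ VanishesOn N := by
  intro k d v hv
  rw [coeff_iDivNu, map_smul, ha (k + 1) d v hv, smul_zero]

/-- `iDivNu` as a linear map. -/
def iDivNuLin : Wick n →ₗ[ℂ] Wick n where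
  toFun := iDivNu
  map_add' a b := by ext1 k; simp [coeff_iDivNu]
  map_smul' z a := by ext1 k; simp [coeff_iDivNu, smul_comm z]

/-- `(i/ν) (a ∘ b - b ∘ a)` as a bilinear map. -/
def commBilin : Wick n →ₗ[ℂ] Wick n →ₗ[ℂ] Wick n :=
  (circBilin h - (circBilin h).flip).compr₂ iDivNuLin

/-- Used with `c = 0` for `r ∘ r`, and with `c` the function being lifted for the commutator of `r`
with its lift. -/
lemma commBilin_mem_vanishesOn {h : Matrix (Fin n) (Fin n) ℂ} (hN : Compatible h N)
    (ha : a ∈ VanishesOn N) {c : Wick n} (hc : ∀ i, dy i c = 0) (hb : b - c ∈ VanishesOn N) :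
    commBilin h a b ∈ VanishesOn N :=
  iDivNu_mem_vanishesOn ((VanishesOn N).sub_mem (circ_mem_vanishesOn hN ha hc hb).1
    (circ_mem_vanishesOn hN ha hc hb).2)

/-! ### Weights -/

/-- The degree-dependent factors in `δ⁻¹` are scalars on each homogeneous part; vanishing is tested
degree by degree so that they do no harm. -/
lemma homEval_coeff_weight (c : ℕ → ℂ) (a : Wick n) (k d : ℕ) (v : Fin n → ℂ) :
    homEval d v (PowerSeries.coeff k (weight c a)) = c d * homEval d v (PowerSeries.coeff k a) := by
  rw [homEval_apply, homEval_apply, mul_sum]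
  refine sum_congr rfl fun α hα => ?_
  have h1 : MvPowerSeries.coeff α (PowerSeries.coeff k (weight c a))
      = c α.degree * MvPowerSeries.coeff α (PowerSeries.coeff k a) := cf_ofCf _ k α
  rw [h1, Finsupp.degree_eq_sum, (mem_finsuppAntidiag.1 hα).1, mul_assoc]

lemma weight_mem_vanishesOn (c : ℕ → ℂ) (ha : a ∈ VanishesOn N) : weight c a ∈ VanishesOn N := by
  intro k d v hv
  rw [homEval_coeff_weight, ha k d v hv, mul_zero]

/-- `weight c` as a linear map. -/
def weightLin (c : ℕ → ℂ) : Wick n →ₗ[ℂ] Wick n where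
  toFun := weight c
  map_add' a b := by
    refine ext_cf fun k α => ?_
    simp only [weight, cf_ofCf, cf_add, mul_add]
  map_smul' z a := by
    refine ext_cf fun k α => ?_
    simp only [weight, cf_ofCf, cf_smul, mul_left_comm, RingHom.id_apply]

/-! ### Multiplication by a linear form -/

lemma homEval_coeff_y_mul_zero (a : Wick n) (i : Fin n) (k : ℕ) (v : Fin n → ℂ) :
    homEval 0 v (PowerSeries.coeff k (y i * a)) = 0 := by
  simp only [y, PowerSeries.coeff_C_mul, homEval_X_mul_zero]

lemma homEval_coeff_y_mul_succ (a : Wick n) (i : Fin n) (k d : ℕ) (v : Fin n → ℂ) :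
    homEval (d + 1) v (PowerSeries.coeff k (y i * a))
      = v i * homEval d v (PowerSeries.coeff k a) := by
  simp only [y, PowerSeries.coeff_C_mul, homEval_X_mul_succ]

/-- If the values of `b` in the directions `p v`, `v ∈ N`, vanish on `N`, then so does
`yⁱ pʲᵢ bⱼ`. -/
lemma sum_y_mul_mem_vanishesOn {p : Fin n → Fin n → ℂ} {b : Fin n → Wick n}
    (h : ∀ v ∈ N, ∑ j, (∑ i, p j i * v i) • b j ∈ VanishesOn N) :
    ∑ i, ∑ j, p j i • (y i * b j) ∈ VanishesOn N := by
  intro k d v hv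
  -- A factor `yⁱ` kills degree `0`; in degree `d + 1`, evaluation at `v` replaces it by `vⁱ` and so
  -- contracts `b` with `p v`.
  rcases d with _ | d
  · simp [homEval_coeff_y_mul_zero]
  · have h1 := h v hv k d v hv
    simp only [map_sum, map_smul, PowerSeries.coeff_smul, homEval_coeff_y_mul_succ,
      smul_eq_mul] at h1 ⊢
    rw [sum_comm, ← h1]
    refine sum_congr rfl fun j _ => ?_
    rw [sum_mul]
    exact sum_congr rfl fun i _ => by ring

end Wick

end ContactWick

end

/-! ### The Fedosov construction over a polarization -/

noncomputable section

namespace ContactWick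

open Finset Wick

variable {n : ℕ}

/-! ### Partial derivatives -/

section PartialDerivatives

variable {F : Type*} [NormedAddCommGroup F] [NormedSpace ℝ F] {Ω : Set (Model n)}

lemma contDiffOn_pd (hΩ : IsOpen Ω) {f : Model n → F} (hf : ContDiffOn ℝ ∞ f Ω) (i : Fin n) :
    ContDiffOn ℝ ∞ (pd i f) Ω :=
  (hf.fderiv_of_isOpen hΩ (m := ∞) le_rfl).clm_apply contDiffOn_const

lemma _root_.ContDiffOn.differentiableAt_of_isOpen (hΩ : IsOpen Ω) {f : Model n → F}
    (hf : ContDiffOn ℝ ∞ f Ω) {u : Model n} (hu : u ∈ Ω) : DifferentiableAt ℝ f u :=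
  (hf.contDiffAt (hΩ.mem_nhds hu)).differentiableAt (by simp)

lemma hasDerivAt_pd {f : Model n → F} {u : Model n} (hf : DifferentiableAt ℝ f u) (i : Fin n) :
    HasDerivAt (fun t : ℝ => f (u + t • EuclideanSpace.single i (1 : ℝ))) (pd i f u) 0 := by
  have h1 : HasDerivAt (fun t : ℝ => u + t • EuclideanSpace.single i (1 : ℝ))
      (EuclideanSpace.single i (1 : ℝ)) 0 := by
    simpa using ((hasDerivAt_id (0 : ℝ)).smul_const (EuclideanSpace.single i (1 : ℝ))).const_add u
  have h2 : HasFDerivAt f (fderiv ℝ f u) (u + (0 : ℝ) • EuclideanSpace.single i (1 : ℝ)) := by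
    simpa using hf.hasFDerivAt
  exact h2.comp_hasDerivAt 0 h1

lemma pd_congr {f g : Model n → F} (hΩ : IsOpen Ω) {u : Model n} (hu : u ∈ Ω)
    (h : ∀ w ∈ Ω, f w = g w) (i : Fin n) : pd i f u = pd i g u := by
  rw [pd, pd, Filter.EventuallyEq.fderiv_eq (Filter.eventually_of_mem (hΩ.mem_nhds hu) h)]

lemma pd_const (c : F) (i : Fin n) (u : Model n) : pd i (fun _ => c) u = 0 := by
  simp [pd]

lemma pd_add {f g : Model n → F} {u : Model n} (hf : DifferentiableAt ℝ f u)
    (hg : DifferentiableAt ℝ g u) (i : Fin n) :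
    pd i (fun w => f w + g w) u = pd i f u + pd i g u := by
  rw [pd, fderiv_fun_add hf hg]; rfl

lemma pd_sub {f g : Model n → F} {u : Model n} (hf : DifferentiableAt ℝ f u)
    (hg : DifferentiableAt ℝ g u) (i : Fin n) :
    pd i (fun w => f w - g w) u = pd i f u - pd i g u := by
  rw [pd, fderiv_fun_sub hf hg]; rfl

lemma pd_sum {ι : Type*} (s : Finset ι) {f : ι → Model n → F} {u : Model n}
    (hf : ∀ j ∈ s, DifferentiableAt ℝ (f j) u) (i : Fin n) :
    pd i (fun w => ∑ j ∈ s, f j w) u = ∑ j ∈ s, pd i (f j) u := by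
  rw [pd, fderiv_fun_sum hf]; simp [pd]

lemma pd_mul {𝔸 : Type*} [NormedCommRing 𝔸] [NormedAlgebra ℝ 𝔸] {f g : Model n → 𝔸} {u : Model n}
    (hf : DifferentiableAt ℝ f u) (hg : DifferentiableAt ℝ g u) (i : Fin n) :
    pd i (fun w => f w * g w) u = pd i f u * g u + f u * pd i g u := by
  rw [pd, fderiv_fun_mul hf hg]; simp [pd]; ring

lemma pd_clm {G : Type*} [NormedAddCommGroup G] [NormedSpace ℝ G] (L : F →L[ℝ] G)
    {f : Model n → F} {u : Model n} (hf : DifferentiableAt ℝ f u) (i : Fin n) :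
    pd i (fun w => L (f w)) u = L (pd i f u) := by
  have := (L.hasFDerivAt.comp u hf.hasFDerivAt).fderiv
  rw [pd]
  change fderiv ℝ (L ∘ f) u _ = _
  rw [this]; rfl

lemma pd_ofReal {f : Model n → ℝ} {u : Model n} (hf : DifferentiableAt ℝ f u) (i : Fin n) :
    pd i (fun w => ((f w : ℝ) : ℂ)) u = ((pd i f u : ℝ) : ℂ) :=
  pd_clm Complex.ofRealCLM hf i

lemma contDiffOn_ofReal {f : Model n → ℝ} (hf : ContDiffOn ℝ ∞ f Ω) :
    ContDiffOn ℝ ∞ (fun w => ((f w : ℝ) : ℂ)) Ω :=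
  Complex.ofRealCLM.contDiff.comp_contDiffOn hf

end PartialDerivatives

/-! ### Smooth sections of the bundle of formal Wick algebras -/

/-- The coefficients of the section `f` are smooth on `Ω`. -/
def SmoothSec (Ω : Set (Model n)) (f : WSec n) : Prop :=
  ∀ k α, ContDiffOn ℝ ∞ (fun u => cf k α (f u)) Ω

namespace SmoothSec

variable {Ω : Set (Model n)} {f g : WSec n}

lemma const (a : Wick n) : SmoothSec Ω fun _ => a := fun _ _ => contDiffOn_const

lemma add (hf : SmoothSec Ω f) (hg : SmoothSec Ω g) : SmoothSec Ω fun u => f u + g u := by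
  intro k α; simpa only [cf_add] using (hf k α).add (hg k α)

lemma sub (hf : SmoothSec Ω f) (hg : SmoothSec Ω g) : SmoothSec Ω fun u => f u - g u := by
  intro k α; simpa only [cf_sub] using (hf k α).sub (hg k α)

lemma smul {z : Model n → ℂ} (hz : ContDiffOn ℝ ∞ z Ω) (hf : SmoothSec Ω f) :
    SmoothSec Ω fun u => z u • f u := by
  intro k α; simpa only [cf_smul] using hz.mul (hf k α)

lemma sum {ι : Type*} (s : Finset ι) {f : ι → WSec n} (hf : ∀ j, SmoothSec Ω (f j)) :
    SmoothSec Ω fun u => ∑ j ∈ s, f j u := by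
  intro k α; simpa only [cf_sum] using ContDiffOn.sum fun j _ => hf j k α

lemma mul (hf : SmoothSec Ω f) (hg : SmoothSec Ω g) : SmoothSec Ω fun u => f u * g u := by
  classical
  intro k α
  simp only [cf, PowerSeries.coeff_mul, map_sum, MvPowerSeries.coeff_mul]
  exact ContDiffOn.sum fun p _ => ContDiffOn.sum fun q _ => (hf _ _).mul (hg _ _)

lemma dy (hf : SmoothSec Ω f) (i : Fin n) : SmoothSec Ω fun u => Wick.dy i (f u) := by
  intro k α
  simp only [cf, coeff_dy, MvPowerSeries.coeff_pderiv]
  exact (hf _ _).mul contDiffOn_const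

lemma dx (hΩ : IsOpen Ω) (hf : SmoothSec Ω f) (i : Fin n) : SmoothSec Ω (ContactWick.dx i f) := by
  intro k α
  simp only [ContactWick.dx, cf_ofCf]
  exact contDiffOn_pd hΩ (hf k α) i

lemma bidiff {h : Model n → Matrix (Fin n) (Fin n) ℂ}
    (hh : ∀ i j, ContDiffOn ℝ ∞ (fun u => h u i j) Ω) (k : ℕ) (hf : SmoothSec Ω f)
    (hg : SmoothSec Ω g) : SmoothSec Ω fun u => Wick.bidiff (h u) k (f u) (g u) := by
  induction k generalizing f g with
  | zero => exact hf.mul hg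
  | succ k ih =>
    simp only [bidiff_succ]
    exact sum _ fun i => sum _ fun j => smul (hh i j) (ih (hf.dy i) (hg.dy j))

lemma circ {h : Model n → Matrix (Fin n) (Fin n) ℂ}
    (hh : ∀ i j, ContDiffOn ℝ ∞ (fun u => h u i j) Ω) (hf : SmoothSec Ω f)
    (hg : SmoothSec Ω g) : SmoothSec Ω fun u => Wick.circ (h u) (f u) (g u) := by
  intro k α
  simp only [cf, coeff_circ, map_sum, map_smul, smul_eq_mul]
  exact ContDiffOn.sum fun p _ => contDiffOn_const.mul (bidiff hh p.1 hf hg _ _)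

lemma iDivNu (hf : SmoothSec Ω f) : SmoothSec Ω fun u => Wick.iDivNu (f u) := by
  intro k α
  simp only [cf, coeff_iDivNu, map_smul, smul_eq_mul]
  exact contDiffOn_const.mul (hf _ _)

lemma weight (c : ℕ → ℂ) (hf : SmoothSec Ω f) : SmoothSec Ω fun u => Wick.weight c (f u) := by
  intro k α
  simp only [Wick.weight, cf_ofCf]
  exact contDiffOn_const.mul (hf _ _)

lemma stableLimit {f : ℕ → WSec n} (hf : ∀ N, SmoothSec Ω (f N)) :
    SmoothSec Ω (ContactWick.stableLimit f) := by
  intro k α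
  simp only [ContactWick.stableLimit, cf_ofCf]
  exact hf _ k α

end SmoothSec

/-- All monomials of `y`-degree `d` at order `νᵏ` are read off from one iterate, the one of index
`2k + d`. Hence vanishing of every iterate on `N` passes to the limit without any appeal to
stabilization. -/
lemma homEval_coeff_stableLimit (f : ℕ → WSec n) (u : Model n) (k d : ℕ) (v : Fin n → ℂ) :
    homEval d v (PowerSeries.coeff k (stableLimit f u))
      = homEval d v (PowerSeries.coeff k (f (2 * k + d) u)) := by
  rw [homEval_apply, homEval_apply]
  refine sum_congr rfl fun α hα => ?_
  have h1 : MvPowerSeries.coeff α (PowerSeries.coeff k (stableLimit f u))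
      = cf k α (f (2 * k + α.degree) u) := cf_ofCf _ k α
  rw [h1, Finsupp.degree_eq_sum, (mem_finsuppAntidiag.1 hα).1]; rfl

lemma dx_sub {Ω : Set (Model n)} (hΩ : IsOpen Ω) {f g : WSec n} (hf : SmoothSec Ω f)
    (hg : SmoothSec Ω g) {u : Model n} (hu : u ∈ Ω) (i : Fin n) :
    dx i (fun w => f w - g w) u = dx i f u - dx i g u := by
  refine ext_cf fun k α => ?_
  simp only [dx, cf_ofCf, cf_sub]
  exact pd_sub ((hf k α).differentiableAt_of_isOpen hΩ hu)
    ((hg k α).differentiableAt_of_isOpen hΩ hu) i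

lemma dx_sum_smul {Ω : Set (Model n)} (hΩ : IsOpen Ω) {z : Model n → Fin n → ℂ}
    {f : Fin n → WSec n} (hz : ∀ j, ContDiffOn ℝ ∞ (fun w => z w j) Ω)
    (hf : ∀ j, SmoothSec Ω (f j)) {u : Model n} (hu : u ∈ Ω) (i : Fin n) :
    dx i (fun w => ∑ j, z w j • f j w) u
      = ∑ j, (pd i (fun w => z w j) u • f j u + z u j • dx i (f j) u) := by
  refine ext_cf fun k α => ?_
  simp only [dx, cf_ofCf, cf_sum, cf_smul, cf_add]
  have h1 := fun j => (hz j).differentiableAt_of_isOpen hΩ hu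
  have h2 := fun j => (hf j k α).differentiableAt_of_isOpen hΩ hu
  rw [pd_sum _ fun j _ => (h1 j).fun_mul (h2 j)]
  exact sum_congr rfl fun j _ => pd_mul (h1 j) (h2 j) i

namespace CoordData

variable (D : CoordData n)

/-! ### Polarizations -/

/-- The tensors built from `D` which enter the Fedosov construction are smooth on the open set
`Ω`. -/
structure IsSmoothOn (Ω : Set (Model n)) : Prop where
  isOpen : IsOpen Ω
  gamma : ∀ i j k, ContDiffOn ℝ ∞ (fun u => D.gamma u i j k) Ω
  lam : ∀ i, ContDiffOn ℝ ∞ (fun u => D.lam u i) Ω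
  xi : ∀ i, ContDiffOn ℝ ∞ (fun u => D.xi u i) Ω
  omega : ∀ i j, ContDiffOn ℝ ∞ (fun u => D.omega u i j) Ω
  torsion : ∀ i j k, ContDiffOn ℝ ∞ (fun u => D.torsion u i j k) Ω
  curvature : ∀ i j k l, ContDiffOn ℝ ∞ (fun u => D.curvature u i j k l) Ω
  wick : ∀ i j, ContDiffOn ℝ ∞ (fun u => D.wickTensor u i j) Ω

/-- An isotropic subbundle `N` of the complexified tangent bundle over `Ω` which contains `ξ`, is
preserved by the contact metric connection, by its torsion and its curvature, and is compatible with
the Wick product. -/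
structure Polarization (Ω : Set (Model n)) (N : Model n → Submodule ℂ (Fin n → ℂ)) : Prop where
  smooth : D.IsSmoothOn Ω
  extend : ∀ u ∈ Ω, ∀ v ∈ N u, ∃ V : Model n → Fin n → ℂ,
    (∀ j, ContDiffOn ℝ ∞ (fun w => V w j) Ω) ∧ (∀ w ∈ Ω, V w ∈ N w) ∧ V u = v
  parallel : ∀ V : Model n → Fin n → ℂ, (∀ j, ContDiffOn ℝ ∞ (fun w => V w j) Ω) →
    (∀ w ∈ Ω, V w ∈ N w) → ∀ u ∈ Ω, ∀ i,
      (fun k => pd i (fun w => V w k) u + ∑ j, (D.gamma u k j i : ℂ) * V u j) ∈ N u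
  torsion_eq : ∀ u ∈ Ω, ∀ i j k, D.torsion u i j k = D.gamma u i j k - D.gamma u i k j
  torsion_mem : ∀ u ∈ Ω, ∀ p ∈ N u, ∀ q ∈ N u,
    (fun m => ∑ i, ∑ j, (D.torsion u m i j : ℂ) * (p i * q j)) ∈ N u
  curvature_mem : ∀ u ∈ Ω, ∀ v ∈ N u, ∀ k l,
    (fun m => ∑ j, (D.curvature u m j k l : ℂ) * v j) ∈ N u
  isotropic : ∀ u ∈ Ω, ∀ p ∈ N u, ∀ q ∈ N u, ∑ i, ∑ j, (D.omega u i j : ℂ) * (p i * q j) = 0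
  xi_mem : ∀ u ∈ Ω, (fun i => (D.xi u i : ℂ)) ∈ N u
  compatible : ∀ u ∈ Ω, Compatible (D.wickTensor u) (N u)

/-- The part `yʲ Γᵏⱼᵢ ∂/∂yᵏ` of the covariant derivative. -/
def gammaDy (u : Model n) (i : Fin n) : Wick n →ₗ[ℂ] Wick n where
  toFun a := ∑ j, ∑ k, (D.gamma u k j i : ℂ) • (y j * dy k a)
  map_add' a b := by simp only [dy_add, mul_add, smul_add, sum_add_distrib]
  map_smul' z a := by
    simp only [dy_smul, mul_smul_comm, smul_sum, RingHom.id_apply, smul_comm z]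

lemma nabla_apply (i : Fin n) (a : WSec n) (u : Model n) :
    D.nabla i a u = dx i a u - D.gammaDy u i (a u) := by
  simp only [nabla, const_mul]; rfl

lemma comm_apply (a b : WSec n) (u : Model n) :
    D.comm a b u = commBilin (D.wickTensor u) (a u) (b u) := rfl

variable {D} {Ω : Set (Model n)} {N : Model n → Submodule ℂ (Fin n → ℂ)}

/-! ### Smoothness of all ingredients of the Fedosov construction -/

namespace IsSmoothOn

variable (hD : D.IsSmoothOn Ω)
include hD

lemma proj (i j : Fin n) : ContDiffOn ℝ ∞ (fun u => D.proj u i j) Ω :=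
  contDiffOn_const.sub ((hD.xi i).mul (hD.lam j))

lemma nabla {a : WSec n} (ha : SmoothSec Ω a) (i : Fin n) : SmoothSec Ω (D.nabla i a) := by
  unfold CoordData.nabla
  simp only [const_mul]
  exact (ha.dx hD.isOpen i).sub (.sum _ fun j => .sum _ fun k =>
    .smul (contDiffOn_ofReal (hD.gamma k j i)) ((SmoothSec.const _).mul (ha.dy k)))

lemma comm {a b : WSec n} (ha : SmoothSec Ω a) (hb : SmoothSec Ω b) :
    SmoothSec Ω (D.comm a b) :=
  ((ha.circ hD.wick hb).sub (hb.circ hD.wick ha)).iDivNu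

lemma torsionElt (i j : Fin n) : SmoothSec Ω (D.torsionElt i j) := by
  unfold CoordData.torsionElt
  simp only [const_mul]
  exact .sum _ fun k => .smul (contDiffOn_ofReal (ContDiffOn.sum fun m _ =>
    (hD.omega k m).mul (hD.torsion m i j))) (.const _)

lemma curvatureElt (k l : Fin n) : SmoothSec Ω (D.curvatureElt k l) := by
  unfold CoordData.curvatureElt
  simp only [const_mul]
  exact .sum _ fun i => .sum _ fun j => .smul (contDiffOn_ofReal (contDiffOn_const.mul
    (ContDiffOn.sum fun m _ => (hD.omega i m).neg.mul (hD.curvature m j k l)))) (.const _)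

lemma lamPart1 {b : WForm1 n} (hb : ∀ i, SmoothSec Ω (b i)) (i : Fin n) :
    SmoothSec Ω (D.lamPart1 b i) := by
  unfold CoordData.lamPart1
  simp only [const_mul]
  exact .smul (contDiffOn_ofReal (hD.lam i)) (.sum _ fun l =>
    .smul (contDiffOn_ofReal (hD.xi l)) (hb l))

lemma lamPart2 {B : WForm2 n} (hB : ∀ i j, SmoothSec Ω (B i j)) (i j : Fin n) :
    SmoothSec Ω (D.lamPart2 B i j) := by
  unfold CoordData.lamPart2
  simp only [const_mul]
  exact .sub
    (.smul (contDiffOn_ofReal (hD.lam i)) (.sum _ fun l =>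
      .smul (contDiffOn_ofReal (hD.xi l)) (hB l j)))
    (.smul (contDiffOn_ofReal (hD.lam j)) (.sum _ fun l =>
      .smul (contDiffOn_ofReal (hD.xi l)) (hB l i)))

lemma deltaInv1 {b : WForm1 n} (hb : ∀ i, SmoothSec Ω (b i)) : SmoothSec Ω (D.deltaInv1 b) := by
  unfold CoordData.deltaInv1 CoordData.deltaStar1
  simp only [const_mul]
  exact .sum _ fun i => .sum _ fun j => .smul (contDiffOn_ofReal (hD.proj j i)) <|
    (SmoothSec.const _).mul <|
      (((hb j).sub (hD.lamPart1 hb j)).weight _).add ((hD.lamPart1 hb j).weight _)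

lemma deltaInv2 {B : WForm2 n} (hB : ∀ i j, SmoothSec Ω (B i j)) (k : Fin n) :
    SmoothSec Ω (D.deltaInv2 B k) := by
  unfold CoordData.deltaInv2 CoordData.deltaStar2
  simp only [const_mul]
  exact .sum _ fun i => .sum _ fun j => .smul (contDiffOn_ofReal (hD.proj j i)) <|
    (SmoothSec.const _).mul <|
      (((hB j k).sub (hD.lamPart2 hB j k)).weight _).add ((hD.lamPart2 hB j k).weight _)

lemma fedosovStep {r : WForm1 n} (hr : ∀ i, SmoothSec Ω (r i)) (i : Fin n) :
    SmoothSec Ω (D.fedosovStep r i) :=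
  (hD.deltaInv2 (fun i j => (hD.torsionElt i j).add (hD.curvatureElt i j)) i).add
    (hD.deltaInv2 (fun i j => ((hD.nabla (hr j) i).sub (hD.nabla (hr i) j)).add
      (hD.comm (hr i) (hr j))) i)

lemma fedosovIter (N : ℕ) (i : Fin n) : SmoothSec Ω (D.fedosovIter N i) := by
  induction N generalizing i with
  | zero => exact .const 0
  | succ N ih =>
    rw [CoordData.fedosovIter, Function.iterate_succ_apply']
    exact hD.fedosovStep ih i

lemma fedosovForm (i : Fin n) : SmoothSec Ω (D.fedosovForm i) :=
  .stableLimit fun N => hD.fedosovIter N i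

lemma connPlusDelta {b : WSec n} (hb : SmoothSec Ω b) (i : Fin n) :
    SmoothSec Ω (D.connPlusDelta b i) :=
  (hD.nabla hb i).add (hD.comm (hD.fedosovForm i) hb)

lemma liftIter {a : Model n → PowerSeries ℂ} (ha : SmoothSec Ω (embed a)) (N : ℕ) :
    SmoothSec Ω (D.liftIter a N) := by
  induction N with
  | zero => exact ha
  | succ N ih =>
    rw [CoordData.liftIter, Function.iterate_succ_apply']
    exact ha.add (hD.deltaInv1 (hD.connPlusDelta ih))

lemma lift {a : Model n → PowerSeries ℂ} (ha : SmoothSec Ω (embed a)) :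
    SmoothSec Ω (D.lift a) :=
  .stableLimit fun N => hD.liftIter ha N

end IsSmoothOn

/-- The contractions of the 1-form `b` with vectors of `N` vanish on `N`. -/
def Adapted1 (Ω : Set (Model n)) (N : Model n → Submodule ℂ (Fin n → ℂ)) (b : WForm1 n) : Prop :=
  ∀ u ∈ Ω, ∀ p ∈ N u, ∑ i, p i • b i u ∈ VanishesOn (N u)

/-- The contractions of the 2-form `B` with two vectors of `N` vanish on `N`. -/
def Adapted2 (Ω : Set (Model n)) (N : Model n → Submodule ℂ (Fin n → ℂ)) (B : WForm2 n) : Prop :=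
  ∀ u ∈ Ω, ∀ p ∈ N u, ∀ q ∈ N u, ∑ i, ∑ j, (p i * q j) • B i j u ∈ VanishesOn (N u)

lemma Adapted2.add {B C : WForm2 n} (hB : Adapted2 Ω N B) (hC : Adapted2 Ω N C) :
    Adapted2 Ω N (B + C) := by
  intro u hu p hp q hq
  simpa [smul_add, sum_add_distrib] using
    (VanishesOn (N u)).add_mem (hB u hu p hp q hq) (hC u hu p hp q hq)

lemma Adapted1.add {b c : WForm1 n} (hb : Adapted1 Ω N b) (hc : Adapted1 Ω N c) :
    Adapted1 Ω N (b + c) := by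
  intro u hu p hp
  simpa [smul_add, sum_add_distrib] using
    (VanishesOn (N u)).add_mem (hb u hu p hp) (hc u hu p hp)

/-- The bracket in terms of the covariant derivative and the torsion. -/
lemma complexBracket_eq {u : Model n}
    (hT : ∀ i j k, D.torsion u i j k = D.gamma u i j k - D.gamma u i k j)
    (P Q : Model n → Fin n → ℂ) : complexBracket P Q u
      = (∑ i, P u i • fun k => pd i (fun w => Q w k) u + ∑ j, (D.gamma u k j i : ℂ) * Q u j)
        - (∑ i, Q u i • fun k => pd i (fun w => P w k) u + ∑ j, (D.gamma u k j i : ℂ) * P u j)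
        + fun m => ∑ i, ∑ j, (D.torsion u m i j : ℂ) * (P u i * Q u j) := by
  funext k
  simp only [complexBracket, Pi.add_apply, Pi.sub_apply, Finset.sum_apply, Pi.smul_apply,
    smul_eq_mul, hT, mul_add, sum_add_distrib, mul_sum, Complex.ofReal_sub, sub_mul,
    sum_sub_distrib]
  have h4 : ∑ i, ∑ j, P u i * ((D.gamma u k j i : ℂ) * Q u j)
      = ∑ i, ∑ j, (D.gamma u k j i : ℂ) * (P u i * Q u j) :=
    sum_congr rfl fun i _ => sum_congr rfl fun j _ => by ring
  have h5 : ∑ i, ∑ j, Q u i * ((D.gamma u k j i : ℂ) * P u j)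
      = ∑ i, ∑ j, (D.gamma u k i j : ℂ) * (P u i * Q u j) := by
    rw [sum_comm]
    exact sum_congr rfl fun i _ => sum_congr rfl fun j _ => by ring
  rw [h4, h5]
  ring

/-! ### The Fedosov recursion preserves vanishing along the polarization -/

namespace Polarization

variable (hP : D.Polarization Ω N)
include hP

/-- The projection is `v - λ(v) ξ`, and `ξ` lies in `N`. This is needed for the projector inside
`δ*`. -/
lemma proj_mem {u : Model n} (hu : u ∈ Ω) {v : Fin n → ℂ} (hv : v ∈ N u) :
    (fun j => ∑ i, (D.proj u j i : ℂ) * v i) ∈ N u := by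
  have h : (fun j => ∑ i, (D.proj u j i : ℂ) * v i)
      = v - (∑ i, (D.lam u i : ℂ) * v i) • fun i => (D.xi u i : ℂ) := by
    funext j
    simp only [proj, Complex.ofReal_sub, sub_mul, sum_sub_distrib, Pi.sub_apply, Pi.smul_apply,
      smul_eq_mul, sum_mul]
    congr 1
    · rw [sum_eq_single j] <;> simp +contextual [eq_comm]
    · exact sum_congr rfl fun i _ => by push_cast; ring
  rw [h]
  exact (N u).sub_mem hv ((N u).smul_mem _ (hP.xi_mem u hu))

/-- Covariant derivatives of a section which vanishes on `N` vanish on `N`. -/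
lemma nabla_mem {a : WSec n} (ha : SmoothSec Ω a) (h : ∀ u ∈ Ω, a u ∈ VanishesOn (N u))
    {u : Model n} (hu : u ∈ Ω) (i : Fin n) : D.nabla i a u ∈ VanishesOn (N u) := by
  intro k d v hv
  -- The fibre `N` varies with the point, so the test vector is extended to a section `V` of `N`,
  -- and the zero function `t ↦ a(V)` along a coordinate line is differentiated.
  obtain ⟨V, hV, hVN, hVu⟩ := hP.extend u hu v hv
  have hΩ := hP.smooth.isOpen
  set γ : ℝ → Model n := fun t => u + t • EuclideanSpace.single i (1 : ℝ) with hγ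
  have hγ0 : γ 0 = u := by simp [hγ]
  have hγc : ContinuousAt γ 0 := by fun_prop
  have hev : ∀ᶠ t in nhds (0 : ℝ), γ t ∈ Ω :=
    hγc.eventually_mem (by rw [hγ0]; exact hΩ.mem_nhds hu)
  have hzero : (fun t => homEval d (V (γ t)) (PowerSeries.coeff k (a (γ t))))
      =ᶠ[nhds 0] fun _ => 0 := by
    filter_upwards [hev] with t ht
    exact h _ ht k d _ (hVN _ ht)
  have hf : ∀ α, HasDerivAt (fun t => MvPowerSeries.coeff α (PowerSeries.coeff k (a (γ t))))
      (MvPowerSeries.coeff α (PowerSeries.coeff k (dx i a u))) 0 := by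
    intro α
    have h1 := hasDerivAt_pd ((ha k α).differentiableAt_of_isOpen hΩ hu) i
    have h2 : MvPowerSeries.coeff α (PowerSeries.coeff k (dx i a u))
        = pd i (fun w => cf k α (a w)) u := cf_ofCf _ k α
    rw [h2]
    exact h1
  have hV' : ∀ j, HasDerivAt (fun t => V (γ t) j) (pd i (fun w => V w j) u) 0 := fun j =>
    hasDerivAt_pd ((hV j).differentiableAt_of_isOpen hΩ hu) i
  rw [nabla_apply, map_sub, map_sub, sub_eq_zero]
  rcases d with _ | d
  · have h1 := (hasDerivAt_homEval_zero (V := fun t => V (γ t)) hf).congr_of_eventuallyEq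
      hzero.symm
    rw [hγ0, hVu] at h1
    rw [h1.unique (hasDerivAt_const _ _)]
    simp only [gammaDy, LinearMap.coe_mk, AddHom.coe_mk, map_sum, map_smul, PowerSeries.coeff_smul,
      homEval_coeff_y_mul_zero, smul_zero, sum_const_zero]
  · have h1 := (hasDerivAt_homEval_succ d hf hV').congr_of_eventuallyEq hzero.symm
    rw [hγ0, hVu] at h1
    have h2 := h1.unique (hasDerivAt_const _ _)
    -- The chain rule produces the derivative of `a` along `∂ᵢV`. Since `∇ᵢV` lies in `N`, the
    -- derivative along it vanishes, which trades `∂ᵢV` for the connection term of `∇ᵢa`.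
    have h3 := dirDy_mem_vanishesOn (h u hu) (hP.parallel V hV hVN u hu i) k d v hv
    rw [hVu] at h3
    simp only [dirDy, map_sum, map_smul, PowerSeries.coeff_smul, smul_eq_mul, coeff_dy, add_mul,
      sum_add_distrib] at h3
    simp only [gammaDy, LinearMap.coe_mk, AddHom.coe_mk, map_sum, map_smul, PowerSeries.coeff_smul,
      smul_eq_mul, homEval_coeff_y_mul_succ, coeff_dy]
    rw [sum_comm]
    have h4 : ∀ x, ∑ y, (D.gamma u x y i : ℂ)
        * (v y * homEval d v (MvPowerSeries.pderiv ℂ x (PowerSeries.coeff k (a u))))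
        = (∑ j, (D.gamma u x j i : ℂ) * v j)
          * homEval d v (MvPowerSeries.pderiv ℂ x (PowerSeries.coeff k (a u))) := fun x => by
      rw [sum_mul]; exact sum_congr rfl fun j _ => by ring
    rw [sum_congr rfl fun x _ => h4 x]
    linear_combination h2 - h3

/-- The bracket of two sections of `N` belongs to `N`. -/
lemma bracket_mem {P Q : Model n → Fin n → ℂ} (hPs : ∀ j, ContDiffOn ℝ ∞ (fun w => P w j) Ω)
    (hPN : ∀ w ∈ Ω, P w ∈ N w) (hQs : ∀ j, ContDiffOn ℝ ∞ (fun w => Q w j) Ω)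
    (hQN : ∀ w ∈ Ω, Q w ∈ N w) {u : Model n} (hu : u ∈ Ω) : complexBracket P Q u ∈ N u := by
  rw [complexBracket_eq (hP.torsion_eq u hu)]
  exact (N u).add_mem ((N u).sub_mem
    ((N u).sum_mem fun i _ => (N u).smul_mem (P u i) (hP.parallel Q hQs hQN u hu i))
    ((N u).sum_mem fun i _ => (N u).smul_mem (Q u i) (hP.parallel P hPs hPN u hu i)))
    (hP.torsion_mem u hu _ (hPN u hu) _ (hQN u hu))

lemma nabla_sum_smul {z : Model n → Fin n → ℂ}
    {f : Fin n → WSec n} (hz : ∀ j, ContDiffOn ℝ ∞ (fun w => z w j) Ω)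
    (hf : ∀ j, SmoothSec Ω (f j)) {u : Model n} (hu : u ∈ Ω) (i : Fin n) :
    D.nabla i (fun w => ∑ j, z w j • f j w) u
      = ∑ j, (pd i (fun w => z w j) u • f j u + z u j • D.nabla i (f j) u) := by
  simp only [nabla_apply, dx_sum_smul hP.smooth.isOpen hz hf hu, map_sum, map_smul, smul_sub,
    sum_add_distrib, sum_sub_distrib]
  abel

/-- By Cartan's formula `(d_∇ r)(P, Q) = ∇_P(r(Q)) - ∇_Q(r(P)) - r([P, Q])` for sections `P`, `Q` of
`N`. The first two terms vanish on `N` by `nabla_mem`, the last because `N` is involutive. -/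
lemma adapted2_dNabla1 {r : WForm1 n} (hs : ∀ i, SmoothSec Ω (r i)) (hr : Adapted1 Ω N r) :
    Adapted2 Ω N (D.dNabla1 r) := by
  intro u hu p hp q hq
  obtain ⟨P, hPs, hPN, rfl⟩ := hP.extend u hu p hp
  obtain ⟨Q, hQs, hQN, rfl⟩ := hP.extend u hu q hq
  have key : ∀ {P Q : Model n → Fin n → ℂ}, (∀ j, ContDiffOn ℝ ∞ (fun w => Q w j) Ω) →
      (∀ w ∈ Ω, Q w ∈ N w) → ∑ i, P u i • ∑ j, (pd i (fun w => Q w j) u • r j u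
        + Q u j • D.nabla i (r j) u) ∈ VanishesOn (N u) := by
    intro P Q hQs hQN
    refine Submodule.sum_mem _ fun i _ => Submodule.smul_mem _ _ ?_
    rw [← hP.nabla_sum_smul hQs hs hu]
    exact hP.nabla_mem (.sum _ fun j => .smul (hQs j) (hs j)) (fun w hw => hr w hw _ (hQN w hw)) hu i
  have h1 := key (P := P) hQs hQN
  have h2 := key (P := Q) hPs hPN
  have h3 := hr u hu _ (hP.bracket_mem hPs hPN hQs hQN hu)
  convert! (VanishesOn (N u)).sub_mem ((VanishesOn (N u)).sub_mem h1 h2) h3 using 1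
  have h4 : ∑ i, ∑ j, (P u i * Q u j) • D.dNabla1 r i j u
      = ∑ i, ∑ j, (P u i * Q u j) • D.nabla i (r j) u
        - ∑ i, ∑ j, (Q u i * P u j) • D.nabla i (r j) u := by
    rw [sum_comm (f := fun i j => (Q u i * P u j) • D.nabla i (r j) u), ← sum_sub_distrib]
    refine sum_congr rfl fun i _ => ?_
    rw [← sum_sub_distrib]
    refine sum_congr rfl fun j _ => ?_
    rw [mul_comm (Q u j), ← smul_sub]
    rfl
  rw [h4]
  have h5 : ∑ k, complexBracket P Q u k • r k u
      = ∑ i, ∑ j, (P u i * pd i (fun w => Q w j) u) • r j u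
        - ∑ i, ∑ j, (Q u i * pd i (fun w => P w j) u) • r j u := by
    rw [sum_comm, sum_comm (f := fun i j => (Q u i * pd i (fun w => P w j) u) • r j u),
      ← sum_sub_distrib]
    refine sum_congr rfl fun k _ => ?_
    rw [← sum_smul, ← sum_smul, ← sub_smul, complexBracket, sum_sub_distrib]
  rw [h5]
  simp only [smul_sum, smul_add, sum_add_distrib, smul_smul]
  abel

/-- On `(p, q)` the form is `(i/ν)[r(p), r(q)]`, a commutator of two members of the ideal. -/
lemma adapted2_sqForm {r : WForm1 n} (hr : Adapted1 Ω N r) : Adapted2 Ω N (D.sqForm r) := by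
  intro u hu p hp q hq
  have h1 := commBilin_mem_vanishesOn (hP.compatible u hu) (hr u hu p hp) (c := 0)
    (fun i => dy_zero i) (by simpa using hr u hu q hq)
  convert! h1 using 1
  simp only [map_sum, map_smul, LinearMap.sum_apply, LinearMap.smul_apply, smul_sum, smul_smul]
  rw [sum_comm]
  exact sum_congr rfl fun i _ => sum_congr rfl fun j _ => by rw [mul_comm]; rfl

/-- At `y = v` the value on `(p, q)` is `ω(v, T(p, q))`, with `v` and `T(p, q)` in the isotropic
space `N`. -/
lemma adapted2_torsionElt : Adapted2 Ω N D.torsionElt := by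
  intro u hu p hp q hq k d v hv
  have h1 := hP.isotropic u hu v hv _ (hP.torsion_mem u hu p hp q hq)
  simp only [torsionElt, const_mul, map_sum, map_smul, PowerSeries.coeff_smul, smul_eq_mul]
  have h2 : ∀ i, homEval d v (PowerSeries.coeff k (y i : Wick n))
      = (if k = 0 ∧ d = 1 then 1 else 0) * v i := fun i => by
    rw [y, PowerSeries.coeff_C]
    split_ifs <;> simp_all [homEval_X]
  simp only [h2]
  trans (if k = 0 ∧ d = 1 then 1 else 0) * ∑ i, ∑ j, (D.omega u i j : ℂ)
      * (v i * ∑ a, ∑ b, (D.torsion u j a b : ℂ) * (p a * q b))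
  · simp only [mul_sum, sum_mul, Complex.ofReal_sum, Complex.ofReal_mul]
    rw [sum_congr rfl fun a _ => sum_comm, sum_comm]
    refine sum_congr rfl fun i _ => ?_
    rw [sum_congr rfl fun a _ => sum_comm, sum_comm]
    refine sum_congr rfl fun j _ => sum_congr rfl fun a _ => sum_congr rfl fun b _ => ?_
    ring
  · rw [h1, mul_zero]

/-- At `y = v` the component `(a, b)` is `-½ ω(v, R(∂ₐ, ∂_b) v)`. As the curvature endomorphisms
preserve `N`, each component vanishes on `N`, not only the contractions. -/
lemma adapted2_curvatureElt : Adapted2 Ω N D.curvatureElt := by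
  intro u hu p hp q hq
  refine Submodule.sum_mem _ fun a _ => Submodule.sum_mem _ fun b _ => Submodule.smul_mem _ _ ?_
  intro k d v hv
  have h1 := hP.isotropic u hu v hv _ (hP.curvature_mem u hu v hv a b)
  simp only [curvatureElt, const_mul, map_sum, map_smul, PowerSeries.coeff_smul, smul_eq_mul]
  have h2 : ∀ i j, homEval d v (PowerSeries.coeff k (y i * y j : Wick n))
      = (if k = 0 ∧ d = 2 then 1 else 0) * (v i * v j) := fun i j => by
    rcases d with _ | d
    · simp [homEval_coeff_y_mul_zero]
    · rw [homEval_coeff_y_mul_succ, y, PowerSeries.coeff_C]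
      split_ifs <;> simp_all [homEval_X]
  simp only [h2]
  trans (if k = 0 ∧ d = 2 then 1 else 0) * (-(1 / 2) * ∑ i, ∑ m, (D.omega u i m : ℂ)
      * (v i * ∑ j, (D.curvature u m j a b : ℂ) * v j))
  · simp only [mul_sum, sum_mul, Complex.ofReal_sum, Complex.ofReal_mul, Complex.ofReal_neg]
    refine sum_congr rfl fun i _ => ?_
    rw [sum_comm]
    refine sum_congr rfl fun j _ => sum_congr rfl fun m _ => ?_
    push_cast
    ring
  · rw [h1, mul_zero, mul_zero]

/-- The value on `(p, q)` is `λ(p) B(ξ, q) - λ(q) B(ξ, p)`; this is where `ξ` has to belong to `N`.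
It allows the two summands on which `δ⁻¹` has different weights to be separated. -/
lemma adapted2_lamPart2 {B : WForm2 n} (hB : Adapted2 Ω N B) : Adapted2 Ω N (D.lamPart2 B) := by
  intro u hu p hp q hq
  have h1 := (VanishesOn (N u)).smul_mem (∑ i, p i * (D.lam u i : ℂ))
    (hB u hu _ (hP.xi_mem u hu) q hq)
  have h2 := (VanishesOn (N u)).smul_mem (∑ i, q i * (D.lam u i : ℂ))
    (hB u hu _ (hP.xi_mem u hu) p hp)
  convert! (VanishesOn (N u)).sub_mem h1 h2 using 1
  simp only [lamPart2, const_mul, smul_sub, sum_sub_distrib, sum_smul]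
  simp only [smul_sum, smul_smul]
  congr 1
  · refine sum_congr rfl fun i _ => ?_
    rw [sum_comm]
    exact sum_congr rfl fun i _ => sum_congr rfl fun j _ => by congr 1; ring
  · rw [sum_comm]
    refine sum_congr rfl fun i _ => ?_
    rw [sum_comm]
    exact sum_congr rfl fun i _ => sum_congr rfl fun j _ => by congr 1; ring

lemma adapted1_lamPart1 {b : WForm1 n} (hb : Adapted1 Ω N b) : Adapted1 Ω N (D.lamPart1 b) := by
  intro u hu p hp
  have h1 := (VanishesOn (N u)).smul_mem (∑ i, p i * (D.lam u i : ℂ))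
    (hb u hu _ (hP.xi_mem u hu))
  convert! h1 using 1
  simp only [lamPart1, const_mul, sum_smul]
  simp only [smul_sum, smul_smul]
  exact sum_congr rfl fun i _ => sum_congr rfl fun j _ => by congr 1; ring

/-- Evaluation at `v` in `N` puts the projection of `v`, again in `N`, into the first slot of `B`,
while the second slot holds `q`; the weights preserve the ideal. -/
lemma adapted1_deltaInv2 {B : WForm2 n} (hB : Adapted2 Ω N B) :
    Adapted1 Ω N (D.deltaInv2 B) := by
  intro u hu q hq
  set W : Fin n → Fin n → Wick n := fun j k =>
    weightLin (fun m => 1 / ((m : ℂ) + 2)) (B j k u - D.lamPart2 B j k u)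
      + weightLin (fun m => 1 / ((m : ℂ) + 1)) (D.lamPart2 B j k u) with hW
  have h1 : ∑ k, q k • D.deltaInv2 B k u
      = ∑ i, ∑ j, (D.proj u j i : ℂ) • (y i * ∑ k, q k • W j k) := by
    simp only [deltaInv2, deltaStar2, const_mul, smul_sum, mul_sum]
    rw [sum_comm]
    refine sum_congr rfl fun i _ => ?_
    rw [sum_comm]
    refine sum_congr rfl fun j _ => sum_congr rfl fun k _ => ?_
    rw [smul_comm, mul_smul_comm]
    rfl
  rw [h1]
  refine sum_y_mul_mem_vanishesOn fun v hv => ?_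
  have hp := hP.proj_mem hu hv
  set p : Fin n → ℂ := fun j => ∑ i, (D.proj u j i : ℂ) * v i
  have h2 : ∑ j, p j • ∑ k, q k • W j k
      = weightLin (fun m => 1 / ((m : ℂ) + 2)) (∑ j, ∑ k, (p j * q k) • B j k u
          - ∑ j, ∑ k, (p j * q k) • D.lamPart2 B j k u)
        + weightLin (fun m => 1 / ((m : ℂ) + 1)) (∑ j, ∑ k, (p j * q k) • D.lamPart2 B j k u) := by
    simp only [hW, smul_sum, map_sub, map_sum, map_smul, smul_add, smul_sub, sum_add_distrib,
      sum_sub_distrib, smul_smul]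
  change ∑ j, p j • ∑ k, q k • W j k ∈ _
  rw [h2]
  have h3 := hP.adapted2_lamPart2 hB u hu p hp q hq
  exact Submodule.add_mem _
    (weight_mem_vanishesOn _ (Submodule.sub_mem _ (hB u hu p hp q hq) h3))
    (weight_mem_vanishesOn _ h3)

/-- The argument of `adapted1_deltaInv2` with one form slot less. -/
lemma deltaInv1_mem {b : WForm1 n} (hb : Adapted1 Ω N b) {u : Model n} (hu : u ∈ Ω) :
    D.deltaInv1 b u ∈ VanishesOn (N u) := by
  simp only [deltaInv1, deltaStar1, const_mul]
  refine sum_y_mul_mem_vanishesOn fun v hv => ?_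
  have hp := hP.proj_mem hu hv
  set p : Fin n → ℂ := fun j => ∑ i, (D.proj u j i : ℂ) * v i
  set c1 : ℕ → ℂ := fun m => 1 / ((m : ℂ) + 1)
  set c2 : ℕ → ℂ := fun m => if m = 0 then 0 else 1 / (m : ℂ)
  have h2 : ∑ j, p j • (weight c1 (b j u - D.lamPart1 b j u) + weight c2 (D.lamPart1 b j u))
      = weightLin c1 (∑ j, p j • b j u - ∑ j, p j • D.lamPart1 b j u)
        + weightLin c2 (∑ j, p j • D.lamPart1 b j u) := by
    change ∑ j, p j • (weightLin c1 (b j u - D.lamPart1 b j u)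
      + weightLin c2 (D.lamPart1 b j u)) = _
    simp only [map_sub, map_sum, map_smul, smul_add, smul_sub, sum_add_distrib, sum_sub_distrib]
  change ∑ j, p j • (weight c1 (b j u - D.lamPart1 b j u) + weight c2 (D.lamPart1 b j u)) ∈ _
  rw [h2]
  have h3 := hP.adapted1_lamPart1 hb u hu p hp
  exact Submodule.add_mem _
    (weight_mem_vanishesOn _ (Submodule.sub_mem _ (hb u hu p hp) h3))
    (weight_mem_vanishesOn _ h3)

lemma adapted1_fedosovIter (K : ℕ) : Adapted1 Ω N (D.fedosovIter K) := by
  induction K with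
  | zero => intro u hu p hp; simp [fedosovIter]
  | succ K ih =>
    rw [fedosovIter, Function.iterate_succ_apply']
    exact (hP.adapted1_deltaInv2 (hP.adapted2_torsionElt.add hP.adapted2_curvatureElt)).add
      (hP.adapted1_deltaInv2 ((hP.adapted2_dNabla1 (hP.smooth.fedosovIter K) ih).add
        (hP.adapted2_sqForm ih)))

lemma adapted1_fedosovForm : Adapted1 Ω N D.fedosovForm := by
  intro u hu p hp k d v hv
  have h1 := hP.adapted1_fedosovIter (2 * k + d) u hu p hp k d v hv
  simp only [map_sum, map_smul, PowerSeries.coeff_smul] at h1 ⊢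
  simpa only [fedosovForm, homEval_coeff_stableLimit] using h1

end Polarization

/-! ### The quantum lift of a function constant along the polarization -/

lemma cf_embed (a : Model n → PowerSeries ℂ) (u : Model n) (k : ℕ) (α : Fin n →₀ ℕ) :
    cf k α (embed a u) = if α = 0 then PowerSeries.coeff k (a u) else 0 := by
  classical
  simp [cf, embed, MvPowerSeries.coeff_C]

lemma dy_embed (a : Model n → PowerSeries ℂ) (u : Model n) (i : Fin n) : dy i (embed a u) = 0 := by
  ext1 k
  simp [coeff_dy, embed]

lemma smoothSec_embed {a : Model n → PowerSeries ℂ}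
    (ha : ∀ k, ContDiffOn ℝ ∞ (fun u => PowerSeries.coeff k (a u)) Ω) : SmoothSec Ω (embed a) := by
  intro k α
  simp only [cf_embed]
  split_ifs
  · exact ha k
  · exact contDiffOn_const

/-- A function of `x` alone has no `y`-derivatives, so its covariant derivative is the ordinary one.
-/
lemma sum_smul_nabla_embed {a : Model n → PowerSeries ℂ} {u : Model n} {p : Fin n → ℂ}
    (h : ∀ k, ∑ i, p i * pd i (fun w => PowerSeries.coeff k (a w)) u = 0) :
    ∑ i, p i • D.nabla i (embed a) u = 0 := by
  refine ext_cf fun k α => ?_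
  have h1 : ∀ i, D.nabla i (embed a) u = dx i (embed a) u := fun i => by
    rw [nabla_apply]
    simp only [gammaDy, LinearMap.coe_mk, AddHom.coe_mk, dy_embed, mul_zero, smul_zero,
      sum_const_zero, sub_zero]
  simp only [h1, cf_sum, cf_smul, dx, cf_ofCf, cf_embed]
  by_cases hα : α = 0
  · simpa [hα, cf] using h k
  · simp [hα, pd_const, cf]

lemma cf_zero_deltaInv1 (b : WForm1 n) (u : Model n) (k : ℕ) : cf k 0 (D.deltaInv1 b u) = 0 := by
  have h : ∀ i (c : Wick n), cf k 0 (y i * c) = 0 := fun i c => by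
    have := homEval_coeff_y_mul_zero c i k 0
    rwa [homEval_zero] at this
  simp only [deltaInv1, deltaStar1, const_mul, cf_sum, cf_smul, h, mul_zero, sum_const_zero]

/-- `δ⁻¹` always carries a factor `yⁱ`, so no correction in the recursion is visible at `y = 0`. -/
lemma atZero_lift (a : Model n → PowerSeries ℂ) (u : Model n) : atZero (D.lift a u) = a u := by
  ext k
  rw [atZero, PowerSeries.coeff_mk, lift, stableLimit, cf_ofCf]
  have : ∀ K, cf k 0 (D.liftIter a K u) = PowerSeries.coeff k (a u) := by
    intro K
    rcases K with _ | K
    · simp [liftIter, cf_embed]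
    · rw [liftIter, Function.iterate_succ_apply', Pi.add_apply, cf_add, cf_zero_deltaInv1,
        cf_embed, if_pos rfl, add_zero]
  exact this _

lemma coeff_atZero (a : Wick n) (k : ℕ) : PowerSeries.coeff k (atZero a) = cf k 0 a := by
  simp [atZero]

/-- The constant term is the homogeneous part of degree `0`, tested at the zero vector. -/
lemma atZero_eq_zero {L : Submodule ℂ (Fin n → ℂ)} {a : Wick n} (ha : a ∈ VanishesOn L) :
    atZero a = 0 := by
  ext k
  have := ha k 0 0 L.zero_mem
  rw [homEval_zero] at this
  rw [coeff_atZero, cf, this, map_zero]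

lemma atZero_add (a b : Wick n) : atZero (a + b) = atZero a + atZero b := by
  ext k; simp [coeff_atZero, cf_add]

lemma atZero_mul (a b : Wick n) : atZero (a * b) = atZero a * atZero b := by
  classical
  ext k
  simp [coeff_atZero, cf, PowerSeries.coeff_mul, MvPowerSeries.coeff_mul]

lemma atZero_embed (a : Model n → PowerSeries ℂ) (u : Model n) : atZero (embed a u) = a u := by
  ext k; simp [coeff_atZero, cf_embed]

/-- The function `a` is constant along the polarization. -/
structure ConstantAlong (Ω : Set (Model n)) (N : Model n → Submodule ℂ (Fin n → ℂ))
    (a : Model n → PowerSeries ℂ) : Prop where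
  smooth : ∀ k, ContDiffOn ℝ ∞ (fun u => PowerSeries.coeff k (a u)) Ω
  deriv : ∀ u ∈ Ω, ∀ p ∈ N u, ∀ k, ∑ i, p i * pd i (fun w => PowerSeries.coeff k (a w)) u = 0

namespace Polarization

variable (hP : D.Polarization Ω N) {a : Model n → PowerSeries ℂ} (ha : ConstantAlong Ω N a)
include hP ha

/-- Write `b = (b - a) + a`. In a direction `p` of `N`, the covariant derivative of `b - a` stays in
the ideal, that of `a` is zero, and the commutator of `r(p)` with `b` is covered by
`commBilin_mem_vanishesOn` with `a` as the constant. -/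
lemma adapted1_connPlusDelta {b : WSec n} (hb : SmoothSec Ω b)
    (h : ∀ u ∈ Ω, b u - embed a u ∈ VanishesOn (N u)) : Adapted1 Ω N (D.connPlusDelta b) := by
  intro u hu p hp
  have hs := smoothSec_embed ha.smooth
  have h1 : ∑ i, p i • D.connPlusDelta b i u
      = ∑ i, p i • D.nabla i (fun w => b w - embed a w) u + ∑ i, p i • D.nabla i (embed a) u
        + commBilin (D.wickTensor u) (∑ i, p i • D.fedosovForm i u) (b u) := by
    simp only [map_sum, map_smul, LinearMap.sum_apply, LinearMap.smul_apply]
    rw [← sum_add_distrib, ← sum_add_distrib]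
    refine sum_congr rfl fun i _ => ?_
    rw [← smul_add, ← smul_add, nabla_apply, nabla_apply,
      dx_sub hP.smooth.isOpen hb hs hu, map_sub, connPlusDelta, Pi.add_apply, nabla_apply,
      comm_apply]
    congr 1
    abel
  rw [h1, sum_smul_nabla_embed (ha.deriv u hu p hp), add_zero]
  refine Submodule.add_mem _ (Submodule.sum_mem _ fun i _ => Submodule.smul_mem _ _
    (hP.nabla_mem (hb.sub hs) h hu i)) ?_
  exact commBilin_mem_vanishesOn (hP.compatible u hu) (hP.adapted1_fedosovForm u hu p hp)
    (fun i => dy_embed a u i) (h u hu)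

lemma liftIter_sub_mem (K : ℕ) : ∀ u ∈ Ω, D.liftIter a K u - embed a u ∈ VanishesOn (N u) := by
  induction K with
  | zero => intro u _; simp [liftIter]
  | succ K ih =>
    intro u hu
    rw [liftIter, Function.iterate_succ_apply', Pi.add_apply, add_sub_cancel_left]
    exact hP.deltaInv1_mem (hP.adapted1_connPlusDelta ha
      (hP.smooth.liftIter (smoothSec_embed ha.smooth) K) ih) hu

lemma lift_sub_mem : ∀ u ∈ Ω, D.lift a u - embed a u ∈ VanishesOn (N u) := by
  intro u hu k d v hv
  have h1 := hP.liftIter_sub_mem ha (2 * k + d) u hu k d v hv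
  rw [map_sub, map_sub] at h1 ⊢
  rwa [lift, homEval_coeff_stableLimit]

/-- Both parts of `D Qa` contracted with `ξ` vanish on `N`: the part `D + δ` by
`adapted1_connPlusDelta`, and the part `δ` because it is the derivative along `ξ` of `Qa`,
equivalently of `Qa - a`. -/
lemma delta_eq_zero {u : Model n} (hu : u ∈ Ω) : D.delta a u = 0 := by
  have hξ := hP.xi_mem u hu
  have h1 := hP.adapted1_connPlusDelta ha (hP.smooth.lift (smoothSec_embed ha.smooth))
    (hP.lift_sub_mem ha) u hu _ hξ
  have h2 := dirDy_mem_vanishesOn (hP.lift_sub_mem ha u hu) hξ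
  have h3 : ∑ j, const (D.xi u j : ℂ) * D.conn (D.lift a) j u ∈ VanishesOn (N u) := by
    convert! (VanishesOn (N u)).sub_mem h1 h2 using 1
    simp only [dirDy, dy_sub, dy_embed, sub_zero, const_mul, ← sum_sub_distrib, ← smul_sub]
    rfl
  simp only [delta, reebPi1, atZero_eq_zero h3, mul_zero, sum_const_zero]

/-- Splitting off `a` from `Qa` leaves `Qc ∘ (Qa - a)`, whose right factor is differentiated only
along `N`; its constant term is therefore zero. -/
lemma star_eq_mul_right {u : Model n} (hu : u ∈ Ω) (hN : ∀ i, D.wickTensor u i ∈ N u)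
    (c : Model n → PowerSeries ℂ) : D.star c a u = c u * a u := by
  have h : D.mul (D.lift c) (D.lift a) u
      = circ (D.wickTensor u) (D.lift c u) (D.lift a u - embed a u) + D.lift c u * embed a u := by
    rw [← circ_eq_mul_of_right (D.wickTensor u) _ (dy_embed a u), ← circ_add_right,
      sub_add_cancel]
    rfl
  rw [star, h, atZero_add, atZero_eq_zero (circ_mem_of_right _ hN _ (hP.lift_sub_mem ha u hu)),
    zero_add, atZero_mul, atZero_lift, atZero_embed]

lemma star_eq_mul_left {u : Model n} (hu : u ∈ Ω) (hN : ∀ j, (fun i => D.wickTensor u i j) ∈ N u)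
    (c : Model n → PowerSeries ℂ) : D.star a c u = a u * c u := by
  have h : D.mul (D.lift a) (D.lift c) u
      = circ (D.wickTensor u).transpose (D.lift c u) (D.lift a u - embed a u)
        + D.lift c u * embed a u := by
    rw [← circ_eq_mul_of_right (D.wickTensor u).transpose _ (dy_embed a u), ← circ_add_right,
      sub_add_cancel, circ_transpose]
    rfl
  rw [star, h, atZero_add, atZero_eq_zero (circ_mem_of_right (D.wickTensor u).transpose
    (fun j => hN j) _ (hP.lift_sub_mem ha u hu)), zero_add, atZero_mul, atZero_lift, atZero_embed, mul_comm]

end Polarization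

end CoordData

end ContactWick

end

/-! ### Contact metric geometry in a chart: connection, curvature and eigenspaces of `φ` -/

noncomputable section

namespace ContactWick

open Finset Wick

variable {n : ℕ}

/-! ### Matrix-valued functions -/

section MatrixDerivative

variable {𝔸 : Type*} [NormedCommRing 𝔸] [NormedAlgebra ℝ 𝔸] {Ω : Set (Model n)}

/-- The entries of the matrix-valued function `F` are smooth on `Ω`. -/
def SmoothMat (Ω : Set (Model n)) (F : Model n → Matrix (Fin n) (Fin n) 𝔸) : Prop :=
  ∀ i j, ContDiffOn ℝ ∞ (fun w => F w i j) Ω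

/-- The partial derivative of a matrix-valued function. -/
def matPd (k : Fin n) (F : Model n → Matrix (Fin n) (Fin n) 𝔸) (u : Model n) :
    Matrix (Fin n) (Fin n) 𝔸 :=
  Matrix.of fun i j => pd k (fun w => F w i j) u

/-- The partial derivative of a vector-valued function. -/
def vecPd (k : Fin n) (V : Model n → Fin n → 𝔸) (u : Model n) : Fin n → 𝔸 :=
  fun i => pd k (fun w => V w i) u

variable {F G : Model n → Matrix (Fin n) (Fin n) 𝔸} {V W : Model n → Fin n → 𝔸} {u : Model n}

lemma SmoothMat.mul (hF : SmoothMat Ω F) (hG : SmoothMat Ω G) :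
    SmoothMat Ω fun w => F w * G w := fun i j => by
  simp only [Matrix.mul_apply]
  exact ContDiffOn.sum fun l _ => (hF i l).mul (hG l j)

lemma SmoothMat.mulVec (hF : SmoothMat Ω F) (hV : ∀ j, ContDiffOn ℝ ∞ (fun w => V w j) Ω)
    (i : Fin n) : ContDiffOn ℝ ∞ (fun w => (F w).mulVec (V w) i) Ω := by
  simp only [Matrix.mulVec, dotProduct]
  exact ContDiffOn.sum fun l _ => (hF i l).mul (hV l)

lemma matPd_congr (hΩ : IsOpen Ω) (hu : u ∈ Ω) (h : ∀ w ∈ Ω, F w = G w) (k : Fin n) :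
    matPd k F u = matPd k G u := by
  ext i j
  exact pd_congr hΩ hu (fun w hw => by rw [h w hw]) k

lemma vecPd_congr (hΩ : IsOpen Ω) (hu : u ∈ Ω) (h : ∀ w ∈ Ω, V w = W w) (k : Fin n) :
    vecPd k V u = vecPd k W u := by
  funext i
  exact pd_congr hΩ hu (fun w hw => by rw [h w hw]) k

lemma matPd_const (A : Matrix (Fin n) (Fin n) 𝔸) (k : Fin n) : matPd k (fun _ => A) u = 0 := by
  ext i j
  exact pd_const _ k u

lemma matPd_add (hΩ : IsOpen Ω) (hu : u ∈ Ω) (hF : SmoothMat Ω F) (hG : SmoothMat Ω G)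
    (k : Fin n) : matPd k (fun w => F w + G w) u = matPd k F u + matPd k G u := by
  ext i j
  exact pd_add ((hF i j).differentiableAt_of_isOpen hΩ hu)
    ((hG i j).differentiableAt_of_isOpen hΩ hu) k

lemma matPd_sub (hΩ : IsOpen Ω) (hu : u ∈ Ω) (hF : SmoothMat Ω F) (hG : SmoothMat Ω G)
    (k : Fin n) : matPd k (fun w => F w - G w) u = matPd k F u - matPd k G u := by
  ext i j
  exact pd_sub ((hF i j).differentiableAt_of_isOpen hΩ hu)
    ((hG i j).differentiableAt_of_isOpen hΩ hu) k

lemma matPd_mul (hΩ : IsOpen Ω) (hu : u ∈ Ω) (hF : SmoothMat Ω F) (hG : SmoothMat Ω G)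
    (k : Fin n) : matPd k (fun w => F w * G w) u = matPd k F u * G u + F u * matPd k G u := by
  ext i j
  have h1 := fun i j => (hF i j).differentiableAt_of_isOpen hΩ hu
  have h2 := fun i j => (hG i j).differentiableAt_of_isOpen hΩ hu
  simp only [matPd, Matrix.mul_apply, Matrix.of_apply, Matrix.add_apply]
  rw [pd_sum _ fun l _ => (h1 i l).fun_mul (h2 l j), ← sum_add_distrib]
  exact sum_congr rfl fun l _ => pd_mul (h1 i l) (h2 l j) k

lemma vecPd_mulVec (hΩ : IsOpen Ω) (hu : u ∈ Ω) (hF : SmoothMat Ω F)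
    (hV : ∀ j, ContDiffOn ℝ ∞ (fun w => V w j) Ω) (k : Fin n) :
    vecPd k (fun w => (F w).mulVec (V w)) u
      = (matPd k F u).mulVec (V u) + (F u).mulVec (vecPd k V u) := by
  funext i
  have h1 := fun i j => (hF i j).differentiableAt_of_isOpen hΩ hu
  have h2 := fun i => (hV i).differentiableAt_of_isOpen hΩ hu
  simp only [matPd, vecPd, Matrix.mulVec, dotProduct, Matrix.of_apply, Pi.add_apply]
  rw [pd_sum _ fun l _ => (h1 i l).fun_mul (h2 l), ← sum_add_distrib]
  exact sum_congr rfl fun l _ => pd_mul (h1 i l) (h2 l) k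

lemma vecPd_vecMul (hΩ : IsOpen Ω) (hu : u ∈ Ω) (hF : SmoothMat Ω F)
    (hV : ∀ j, ContDiffOn ℝ ∞ (fun w => V w j) Ω) (k : Fin n) :
    vecPd k (fun w => (F w).vecMul (V w)) u
      = (F u).vecMul (vecPd k V u) + (matPd k F u).vecMul (V u) := by
  funext i
  have h1 := fun i j => (hF i j).differentiableAt_of_isOpen hΩ hu
  have h2 := fun i => (hV i).differentiableAt_of_isOpen hΩ hu
  simp only [matPd, vecPd, Matrix.vecMul, dotProduct, Matrix.of_apply, Pi.add_apply]
  rw [pd_sum _ fun l _ => (h2 l).fun_mul (h1 l i), ← sum_add_distrib]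
  exact sum_congr rfl fun l _ => pd_mul (h2 l) (h1 l i) k

lemma matPd_vecMulVec (hΩ : IsOpen Ω) (hu : u ∈ Ω)
    (hV : ∀ j, ContDiffOn ℝ ∞ (fun w => V w j) Ω) (hW : ∀ j, ContDiffOn ℝ ∞ (fun w => W w j) Ω)
    (k : Fin n) : matPd k (fun w => Matrix.vecMulVec (V w) (W w)) u
      = Matrix.vecMulVec (vecPd k V u) (W u) + Matrix.vecMulVec (V u) (vecPd k W u) := by
  ext i j
  exact pd_mul ((hV i).differentiableAt_of_isOpen hΩ hu)
    ((hW j).differentiableAt_of_isOpen hΩ hu) k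

lemma pd_comm {E : Type*} [NormedAddCommGroup E] [NormedSpace ℝ E] (hΩ : IsOpen Ω) (hu : u ∈ Ω)
    {f : Model n → E} (hf : ContDiffOn ℝ ∞ f Ω) (i j : Fin n) :
    pd i (pd j f) u = pd j (pd i f) u := by
  have h1 : ContDiffAt ℝ ∞ f u := hf.contDiffAt (hΩ.mem_nhds hu)
  have h2 : DifferentiableAt ℝ (fderiv ℝ f) u :=
    (h1.fderiv_right (m := 1) (by norm_cast)).differentiableAt (by simp)
  have h3 : ∀ a b, pd a (pd b f) u = fderiv ℝ (fderiv ℝ f) u (EuclideanSpace.single a 1)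
      (EuclideanSpace.single b 1) := by
    intro a b
    exact pd_clm (ContinuousLinearMap.apply ℝ E (EuclideanSpace.single b (1 : ℝ))) h2 a
  rw [h3, h3]
  exact h1.isSymmSndFDerivAt (by simp [minSmoothness_of_isRCLikeNormedField]; norm_cast) _ _

lemma matPd_comm (hΩ : IsOpen Ω) (hu : u ∈ Ω) (hF : SmoothMat Ω F) (k l : Fin n) :
    matPd k (matPd l F) u = matPd l (matPd k F) u := by
  ext i j
  exact pd_comm hΩ hu (hF i j) k l

lemma contDiffOn_det (hF : SmoothMat Ω F) : ContDiffOn ℝ ∞ (fun w => (F w).det) Ω := by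
  simp only [Matrix.det_apply]
  exact ContDiffOn.sum fun σ _ => (contDiffOn_prod fun i _ => hF _ _).const_smul (Equiv.Perm.sign σ : ℤ)

end MatrixDerivative

lemma SmoothMat.inv {Ω : Set (Model n)} {F : Model n → Matrix (Fin n) (Fin n) ℝ}
    (hF : SmoothMat Ω F) (h : ∀ u ∈ Ω, (F u).det ≠ 0) : SmoothMat Ω fun w => (F w)⁻¹ := by
  intro i j
  simp only [Matrix.inv_def, Ring.inverse_eq_inv', Matrix.smul_apply, smul_eq_mul,
    Matrix.adjugate_apply]
  refine ((contDiffOn_det hF).inv h).mul (contDiffOn_det fun a b => ?_)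
  by_cases ha : a = j
  · simpa [ha] using contDiffOn_const
  · simpa [Matrix.updateRow_apply, ha] using hF a b

lemma SmoothMat.ofReal {Ω : Set (Model n)} {F : Model n → Matrix (Fin n) (Fin n) ℝ}
    (hF : SmoothMat Ω F) : SmoothMat Ω fun w => (F w).map ((↑) : ℝ → ℂ) :=
  fun i j => contDiffOn_ofReal (hF i j)

lemma matPd_ofReal {Ω : Set (Model n)} (hΩ : IsOpen Ω) {u : Model n} (hu : u ∈ Ω)
    {F : Model n → Matrix (Fin n) (Fin n) ℝ} (hF : SmoothMat Ω F) (k : Fin n) :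
    matPd k (fun w => (F w).map ((↑) : ℝ → ℂ)) u = (matPd k F u).map ((↑) : ℝ → ℂ) := by
  ext i j
  exact pd_ofReal ((hF i j).differentiableAt_of_isOpen hΩ hu) k

lemma map_ofReal_mul (A B : Matrix (Fin n) (Fin n) ℝ) :
    (A * B).map ((↑) : ℝ → ℂ) = A.map ((↑) : ℝ → ℂ) * B.map ((↑) : ℝ → ℂ) :=
  Matrix.map_mul (f := Complex.ofRealHom)

/-- The identity behind `∇φ = 0`. -/
lemma phi_parallel_identity {R : Type*} [Ring R] [Algebra ℝ R] {A B C C₁ C₂ : R}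
    (h1 : A * A = -1 + C) (h2 : B * A + A * B = C₁ + C₂) (h3 : C₁ * A = 0) (h4 : A * C₂ = 0)
    (h5 : C₂ * A + C * B = 0) :
    (-((1 / 2 : ℝ) • (A * B)) - (1 / 2 : ℝ) • C₁ + C₂) * A
      - A * (-((1 / 2 : ℝ) • (A * B)) - (1 / 2 : ℝ) • C₁ + C₂) = -B := by
  -- Here `A = φ`, `B = ∇ᵍφ`, `C = ξ ⊗ λ`, `C₁ = ∇ᵍξ ⊗ λ` and `C₂ = ξ ⊗ ∇ᵍλ`. The assumptions are
  -- `φ² = -1 + ξ ⊗ λ` and its derivative, `λ ∘ φ = 0`, `φ ξ = 0`, and the derivative of `λ ∘ φ =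
  -- 0`.
  have h6 : A * B * A = A * C₁ - A * A * B := by
    have : A * (B * A + A * B) = A * (C₁ + C₂) := by rw [h2]
    rw [mul_add, mul_add, h4, add_zero] at this
    rw [← this]; noncomm_ring
  have h7 : C₂ * A = - (C * B) := eq_neg_of_add_eq_zero_left h5
  simp only [add_mul, mul_add, sub_mul, mul_sub, neg_mul, mul_neg, smul_mul_assoc, mul_smul_comm,
    h3, h4, h6, h7, smul_zero, smul_sub, ← mul_assoc]
  rw [h1, add_mul, neg_one_mul, smul_add, smul_neg]
  module

namespace CoordData

variable (D : CoordData n)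

/-! ### Contact metric structures in a chart -/

/-- The data `D` are the components of a contact metric structure on the open set `Ω`. -/
structure IsContact (Ω : Set (Model n)) : Prop where
  isOpen : IsOpen Ω
  smooth_g : SmoothMat Ω D.g
  smooth_lam : ∀ i, ContDiffOn ℝ ∞ (fun u => D.lam u i) Ω
  smooth_xi : ∀ i, ContDiffOn ℝ ∞ (fun u => D.xi u i) Ω
  smooth_phi : SmoothMat Ω D.phi
  g_symm : ∀ u ∈ Ω, ∀ i j, D.g u i j = D.g u j i
  det_ne_zero : ∀ u ∈ Ω, (D.g u).det ≠ 0
  phi_phi : ∀ u ∈ Ω, D.phi u * D.phi u = -1 + Matrix.vecMulVec (D.xi u) (D.lam u)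
  lam_xi : ∀ u ∈ Ω, ∑ i, D.lam u i * D.xi u i = 1
  phi_xi : ∀ u ∈ Ω, (D.phi u).mulVec (D.xi u) = 0
  lam_phi : ∀ u ∈ Ω, (D.phi u).vecMul (D.lam u) = 0
  omega_eq : ∀ u ∈ Ω, ∀ i j, D.omega u i j = (D.g u * D.phi u) i j

/-- The matrices of the Levi-Civita connection. -/
def lcMat (k : Fin n) (u : Model n) : Matrix (Fin n) (Fin n) ℝ :=
  Matrix.of fun i j => D.lcGamma u i j k

/-- The matrices of the contact metric connection. -/
def gammaMat (k : Fin n) (u : Model n) : Matrix (Fin n) (Fin n) ℝ :=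
  Matrix.of fun i j => D.gamma u i j k

/-- The curvature matrices of the contact metric connection. -/
def curvMat (k l : Fin n) (u : Model n) : Matrix (Fin n) (Fin n) ℝ :=
  Matrix.of fun i j => D.curvature u i j k l

/-- The complexification of `φ`. -/
def phiC (u : Model n) : Matrix (Fin n) (Fin n) ℂ := (D.phi u).map ((↑) : ℝ → ℂ)

/-- The sum of the eigenspace of `φ` for the eigenvalue `s` and the span of `ξ`, as the kernel of
`φ² - s φ`. -/
def eigenSum (s : ℂ) (u : Model n) : Submodule ℂ (Fin n → ℂ) :=
  LinearMap.ker (D.phiC u * D.phiC u - s • D.phiC u).mulVecLin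

variable {D} {s : ℂ}

lemma mem_eigenSum {u : Model n} {v : Fin n → ℂ} : v ∈ D.eigenSum s u ↔
    (D.phiC u * D.phiC u - s • D.phiC u).mulVec v = 0 := LinearMap.mem_ker

lemma mem_eigenSum_of_eigen {u : Model n} {v : Fin n → ℂ} (h : (D.phiC u).mulVec v = s • v) :
    v ∈ D.eigenSum s u := by
  rw [mem_eigenSum, Matrix.sub_mulVec, ← Matrix.mulVec_mulVec, h, Matrix.mulVec_smul, h,
    Matrix.smul_mulVec, h, sub_self]

variable {Ω : Set (Model n)}

namespace IsContact

variable (hD : D.IsContact Ω)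
include hD

lemma smooth_gInv : SmoothMat Ω D.gInv := hD.smooth_g.inv hD.det_ne_zero

lemma gInv_mul {u : Model n} (hu : u ∈ Ω) : D.gInv u * D.g u = 1 :=
  Matrix.nonsing_inv_mul _ (isUnit_iff_ne_zero.2 (hD.det_ne_zero u hu))

lemma mul_gInv {u : Model n} (hu : u ∈ Ω) : D.g u * D.gInv u = 1 :=
  Matrix.mul_nonsing_inv _ (isUnit_iff_ne_zero.2 (hD.det_ne_zero u hu))

lemma smooth_lcGamma (i j k : Fin n) : ContDiffOn ℝ ∞ (fun u => D.lcGamma u i j k) Ω := by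
  have h := fun a b c => contDiffOn_pd hD.isOpen (hD.smooth_g a b) c
  exact contDiffOn_const.mul (ContDiffOn.sum fun l _ =>
    (hD.smooth_gInv i l).mul (((h l k j).add (h l j k)).sub (h j k l)))

lemma smooth_lcPhi (k l j : Fin n) : ContDiffOn ℝ ∞ (fun u => D.lcPhi u k l j) Ω :=
  (contDiffOn_pd hD.isOpen (hD.smooth_phi l j) k).add (ContDiffOn.sum fun m _ =>
    ((hD.smooth_lcGamma l m k).mul (hD.smooth_phi m j)).sub
      ((hD.smooth_lcGamma m j k).mul (hD.smooth_phi l m)))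

lemma smooth_lcXi (k i : Fin n) : ContDiffOn ℝ ∞ (fun u => D.lcXi u k i) Ω :=
  (contDiffOn_pd hD.isOpen (hD.smooth_xi i) k).add (ContDiffOn.sum fun m _ =>
    (hD.smooth_lcGamma i m k).mul (hD.smooth_xi m))

lemma smooth_lcLam (k j : Fin n) : ContDiffOn ℝ ∞ (fun u => D.lcLam u k j) Ω :=
  (contDiffOn_pd hD.isOpen (hD.smooth_lam j) k).sub (ContDiffOn.sum fun m _ =>
    (hD.smooth_lcGamma m j k).mul (hD.smooth_lam m))

lemma smooth_potential (i j k : Fin n) : ContDiffOn ℝ ∞ (fun u => D.potential u i j k) Ω :=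
  ((contDiffOn_const.mul (ContDiffOn.sum fun l _ =>
    (hD.smooth_phi i l).mul (hD.smooth_lcPhi k l j))).sub
    (contDiffOn_const.mul ((hD.smooth_lam j).mul (hD.smooth_lcXi k i)))).add
    ((hD.smooth_xi i).mul (hD.smooth_lcLam k j))

lemma smooth_gamma (i j k : Fin n) : ContDiffOn ℝ ∞ (fun u => D.gamma u i j k) Ω :=
  (hD.smooth_lcGamma i j k).add (hD.smooth_potential i j k)

lemma isSmoothOn : D.IsSmoothOn Ω where
  isOpen := hD.isOpen
  gamma := hD.smooth_gamma
  lam := hD.smooth_lam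
  xi := hD.smooth_xi
  omega i j := (contDiffOn_pd hD.isOpen (hD.smooth_lam j) i).sub
    (contDiffOn_pd hD.isOpen (hD.smooth_lam i) j)
  torsion i j k := (hD.smooth_potential i j k).sub (hD.smooth_potential i k j)
  curvature i j k l :=
    ((contDiffOn_pd hD.isOpen (hD.smooth_gamma i j l) k).sub
      (contDiffOn_pd hD.isOpen (hD.smooth_gamma i j k) l)).add (ContDiffOn.sum fun m _ =>
        ((hD.smooth_gamma i m k).mul (hD.smooth_gamma m j l)).sub
          ((hD.smooth_gamma i m l).mul (hD.smooth_gamma m j k)))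
  wick i j := (contDiffOn_ofReal (hD.smooth_gInv i j)).add (contDiffOn_const.mul
    (contDiffOn_ofReal (ContDiffOn.sum fun l _ =>
      (hD.smooth_gInv i l).mul (hD.smooth_phi j l))))

/-- The Christoffel symbols of the Levi-Civita connection are symmetric and drop out. -/
lemma torsion_eq {u : Model n} (hu : u ∈ Ω) (i j k : Fin n) :
    D.torsion u i j k = D.gamma u i j k - D.gamma u i k j := by
  have h : D.lcGamma u i j k = D.lcGamma u i k j := by
    simp only [lcGamma]
    congr 1
    refine sum_congr rfl fun l _ => ?_
    rw [pd_congr (f := fun w => D.g w j k) (g := fun w => D.g w k j) hD.isOpen hu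
      (fun w hw => hD.g_symm w hw j k) l]
    ring
  simp only [torsion, gamma, h]
  ring

/-! ### The contact metric connection preserves `φ` -/

/-- `∇φ = 0`. -/
lemma matPd_phi {u : Model n} (hu : u ∈ Ω) (k : Fin n) :
    matPd k D.phi u = D.phi u * D.gammaMat k u - D.gammaMat k u * D.phi u := by
  have hΩ := hD.isOpen
  set A := D.phi u
  set L := D.lcMat k u
  set B := matPd k D.phi u + L * A - A * L with hB
  set ξ := D.xi u
  set lam := D.lam u
  set ξ' := vecPd k D.xi u
  set lam' := vecPd k D.lam u
  have hAA : A * A = -1 + Matrix.vecMulVec ξ lam := hD.phi_phi u hu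
  -- The definition of `S` in matrix form, with `B` the covariant derivative of `φ` for the
  -- Levi-Civita connection.
  have hG : D.gammaMat k u = L + (-((1 / 2 : ℝ) • (A * B))
      - (1 / 2 : ℝ) • Matrix.vecMulVec (ξ' + L.mulVec ξ) lam
      + Matrix.vecMulVec ξ (lam' - L.vecMul lam)) := by
    have hB' : ∀ l j, D.lcPhi u k l j = B l j := fun l j => by
      simp only [lcPhi, hB, matPd, Matrix.sub_apply, Matrix.add_apply, Matrix.of_apply,
        Matrix.mul_apply, sum_sub_distrib]
      rw [add_sub_assoc]
      congr 2
      exact sum_congr rfl fun m _ => mul_comm _ _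
    have hX : ∀ i, D.lcXi u k i = (ξ' + L.mulVec ξ) i := fun i => rfl
    have hl : ∀ j, D.lcLam u k j = (lam' - L.vecMul lam) j := fun j => by
      simp only [lcLam, Pi.sub_apply, Matrix.vecMul, dotProduct]
      congr 1
      exact sum_congr rfl fun m _ => mul_comm _ _
    ext i j
    simp only [gammaMat, gamma, potential, Matrix.of_apply, Matrix.add_apply, Matrix.sub_apply,
      Matrix.neg_apply, Matrix.smul_apply, Matrix.mul_apply, Matrix.vecMulVec_apply, hB', hX, hl,
      smul_eq_mul]
    change D.lcGamma u i j k + _ = D.lcGamma u i j k + _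
    ring
  have h2 : B * A + A * B = Matrix.vecMulVec (ξ' + L.mulVec ξ) lam
      + Matrix.vecMulVec ξ (lam' - L.vecMul lam) := by
    have e1 : matPd k D.phi u * A + A * matPd k D.phi u
        = Matrix.vecMulVec ξ' lam + Matrix.vecMulVec ξ lam' := by
      rw [← matPd_mul hΩ hu hD.smooth_phi hD.smooth_phi, matPd_congr hΩ hu hD.phi_phi,
        matPd_add (F := fun _ => -1) (G := fun w => Matrix.vecMulVec (D.xi w) (D.lam w)) hΩ hu
          (fun i j => contDiffOn_const)
          (fun i j => (hD.smooth_xi i).mul (hD.smooth_lam j)), matPd_const, zero_add,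
        matPd_vecMulVec hΩ hu hD.smooth_xi hD.smooth_lam]
    have e2 : B * A + A * B = (matPd k D.phi u * A + A * matPd k D.phi u) + L * (A * A)
        - (A * A) * L := by
      rw [hB]; noncomm_ring
    rw [e2, e1, hAA, Matrix.add_vecMulVec, Matrix.vecMulVec_sub, ← Matrix.mul_vecMulVec,
      ← Matrix.vecMulVec_mul]
    noncomm_ring
  have h3 : Matrix.vecMulVec (ξ' + L.mulVec ξ) lam * A = 0 := by
    rw [Matrix.vecMulVec_mul, hD.lam_phi u hu, Matrix.vecMulVec_zero]
  have h4 : A * Matrix.vecMulVec ξ (lam' - L.vecMul lam) = 0 := by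
    rw [Matrix.mul_vecMulVec, hD.phi_xi u hu, Matrix.zero_vecMulVec]
  have h5 : Matrix.vecMulVec ξ (lam' - L.vecMul lam) * A + Matrix.vecMulVec ξ lam * B = 0 := by
    rw [Matrix.vecMulVec_mul, Matrix.vecMulVec_mul, ← Matrix.vecMulVec_add]
    have e1 : A.vecMul lam' + (matPd k D.phi u).vecMul lam = 0 := by
      rw [← vecPd_vecMul hΩ hu hD.smooth_phi hD.smooth_lam, vecPd_congr hΩ hu hD.lam_phi]
      funext i
      exact pd_const _ k u
    have e2 : A.vecMul lam = 0 := hD.lam_phi u hu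
    have e3 : A.vecMul (lam' - L.vecMul lam) + B.vecMul lam = 0 := by
      rw [hB, Matrix.vecMul_sub, Matrix.vecMul_add, Matrix.sub_vecMul, ← Matrix.vecMul_vecMul,
        ← Matrix.vecMul_vecMul, e2, Matrix.zero_vecMul]
      linear_combination e1
    rw [e3, Matrix.vecMulVec_zero]
  have h6 := phi_parallel_identity hAA h2 h3 h4 h5
  have h7 : matPd k D.phi u = -(-B) - L * A + A * L := by rw [hB]; abel
  rw [hG, mul_add, add_mul, h7, ← h6]
  abel

lemma smooth_gammaMat (k : Fin n) : SmoothMat Ω (D.gammaMat k) := fun i j => hD.smooth_gamma i j k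

/-- The curvature of the contact metric connection commutes with `φ`. -/
lemma phi_mul_curvMat {u : Model n} (hu : u ∈ Ω) (k l : Fin n) :
    D.phi u * D.curvMat k l u = D.curvMat k l u * D.phi u := by
  have hΩ := hD.isOpen
  have hR : D.curvMat k l u = matPd k (D.gammaMat l) u - matPd l (D.gammaMat k) u
      + (D.gammaMat k u * D.gammaMat l u - D.gammaMat l u * D.gammaMat k u) := by
    ext i j
    simp only [curvMat, curvature, matPd, gammaMat, Matrix.of_apply, Matrix.add_apply,
      Matrix.sub_apply, Matrix.mul_apply, sum_sub_distrib]
  have key : ∀ a b, matPd a (matPd b D.phi) u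
      = (D.phi u * D.gammaMat a u - D.gammaMat a u * D.phi u) * D.gammaMat b u
        + D.phi u * matPd a (D.gammaMat b) u
        - (matPd a (D.gammaMat b) u * D.phi u
          + D.gammaMat b u * (D.phi u * D.gammaMat a u - D.gammaMat a u * D.phi u)) := by
    intro a b
    rw [matPd_congr hΩ hu (fun w hw => hD.matPd_phi hw b),
      matPd_sub hΩ hu (hD.smooth_phi.mul (hD.smooth_gammaMat b))
        ((hD.smooth_gammaMat b).mul hD.smooth_phi),
      matPd_mul hΩ hu hD.smooth_phi (hD.smooth_gammaMat b),
      matPd_mul hΩ hu (hD.smooth_gammaMat b) hD.smooth_phi, hD.matPd_phi hu]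
  -- Equality of the mixed second derivatives of `φ` is the integrability condition of `∂φ = [φ,
  -- Γ]`, namely that `φ` commutes with the curvature.
  have h := matPd_comm hΩ hu hD.smooth_phi k l
  rw [key, key, ← sub_eq_zero] at h
  rw [← sub_eq_zero, ← h, hR]
  noncomm_ring

/-! ### The eigenspaces of `φ` -/

lemma smooth_phiC : SmoothMat Ω D.phiC := hD.smooth_phi.ofReal

/-- From `φ² = -1 + ξ ⊗ λ` and `λ ∘ φ = 0`. The eigenvalues of `φ` are thus among `0, i, -i`, and
every projector below is a polynomial in `φ`. -/
lemma phiC_cube {u : Model n} (hu : u ∈ Ω) : D.phiC u * D.phiC u * D.phiC u = -D.phiC u := by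
  have h : D.phi u * D.phi u * D.phi u = -D.phi u := by
    rw [hD.phi_phi u hu, add_mul, neg_one_mul, Matrix.vecMulVec_mul, hD.lam_phi u hu,
      Matrix.vecMulVec_zero, add_zero]
  rw [phiC, ← map_ofReal_mul, ← map_ofReal_mul, h]
  ext i j
  simp

/-- The complexified connection matrices. -/
lemma matPd_phiC {u : Model n} (hu : u ∈ Ω) (k : Fin n) :
    matPd k D.phiC u = D.phiC u * (D.gammaMat k u).map ((↑) : ℝ → ℂ)
      - (D.gammaMat k u).map ((↑) : ℝ → ℂ) * D.phiC u := by
  have h := matPd_ofReal hD.isOpen hu hD.smooth_phi k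
  rw [hD.matPd_phi hu] at h
  refine h.trans ?_
  rw [phiC, ← map_ofReal_mul, ← map_ofReal_mul]
  ext i j
  simp

lemma smooth_quadratic (s : ℂ) : SmoothMat Ω fun w => D.phiC w * D.phiC w - s • D.phiC w :=
  fun i j => (hD.smooth_phiC.mul hD.smooth_phiC i j).sub (contDiffOn_const.mul (hD.smooth_phiC i j))

/-- `M = φ² - sφ` is a polynomial in the parallel tensor `φ`, so `∂M = [M, Γ]`; differentiating `M V
= 0` gives `M (∂V + ΓV) = 0`. -/
lemma parallel {V : Model n → Fin n → ℂ} (hV : ∀ j, ContDiffOn ℝ ∞ (fun w => V w j) Ω)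
    (hVN : ∀ w ∈ Ω, V w ∈ D.eigenSum s w) {u : Model n} (hu : u ∈ Ω) (i : Fin n) :
    (fun k => pd i (fun w => V w k) u + ∑ j, (D.gamma u k j i : ℂ) * V u j)
      ∈ D.eigenSum s u := by
  have hΩ := hD.isOpen
  set G := (D.gammaMat i u).map ((↑) : ℝ → ℂ)
  have hM := hD.smooth_quadratic s
  have h1 : vecPd i (fun w => (D.phiC w * D.phiC w - s • D.phiC w).mulVec (V w)) u = 0 := by
    rw [vecPd_congr hΩ hu fun w hw => mem_eigenSum.1 (hVN w hw)]
    funext j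
    exact pd_const _ i u
  rw [vecPd_mulVec hΩ hu hM hV] at h1
  have hsm : matPd i (fun w => s • D.phiC w) u = s • matPd i D.phiC u := by
    ext a b
    have := pd_mul (differentiableAt_const s)
      ((hD.smooth_phiC a b).differentiableAt_of_isOpen hΩ hu) i
    rw [pd_const, zero_mul, zero_add] at this
    exact this
  have h2 : matPd i (fun w => D.phiC w * D.phiC w - s • D.phiC w) u
      = (D.phiC u * D.phiC u - s • D.phiC u) * G - G * (D.phiC u * D.phiC u - s • D.phiC u) := by
    rw [matPd_sub (G := fun w => s • D.phiC w) hΩ hu (hD.smooth_phiC.mul hD.smooth_phiC)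
      (fun a b => contDiffOn_const.mul (hD.smooth_phiC a b)),
      matPd_mul hΩ hu hD.smooth_phiC hD.smooth_phiC, hsm, hD.matPd_phiC hu]
    simp only [sub_mul, mul_sub, smul_sub, Matrix.smul_mul, Matrix.mul_smul, mul_assoc]
    abel
  have h3 := mem_eigenSum.1 (hVN u hu)
  rw [h2, Matrix.sub_mulVec, ← Matrix.mulVec_mulVec, ← Matrix.mulVec_mulVec, h3,
    Matrix.mulVec_zero, sub_zero, ← Matrix.mulVec_add, add_comm] at h1
  exact mem_eigenSum.2 h1

/-- On the eigenvalues `0, s, -s` the polynomial `1 + ½(φ² - sφ)` takes the values `1, 1, 0`. It is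
a smooth projector onto `eigenSum`, applied here to the constant vector `v`. -/
lemma extend (hs : s * s = -1) {u : Model n} {v : Fin n → ℂ} (hv : v ∈ D.eigenSum s u) :
    ∃ V : Model n → Fin n → ℂ, (∀ j, ContDiffOn ℝ ∞ (fun w => V w j) Ω) ∧
      (∀ w ∈ Ω, V w ∈ D.eigenSum s w) ∧ V u = v := by
  have hE : ∀ w, 1 + (1 / 2 : ℂ) • (D.phiC w * D.phiC w - s • D.phiC w)
      = 1 + (1 / 2 : ℂ) • (D.phiC w * D.phiC w) - (s / 2) • D.phiC w := fun w => by
    rw [smul_sub, smul_smul]; ring_nf; abel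
  refine ⟨fun w => (1 + (1 / 2 : ℂ) • (D.phiC w * D.phiC w - s • D.phiC w)).mulVec v, ?_, ?_, ?_⟩
  · refine SmoothMat.mulVec (fun i j => ?_) fun j => contDiffOn_const
    exact contDiffOn_const.add (contDiffOn_const.mul (hD.smooth_quadratic s i j))
  · intro w hw
    rw [mem_eigenSum, Matrix.mulVec_mulVec]
    have h3 := hD.phiC_cube hw
    set A := D.phiC w
    have h4 : A * A * (A * A) = -(A * A) := by rw [← mul_assoc, h3, neg_mul]
    have h5 : A * (A * A) = -A := by rw [← mul_assoc, h3]
    have : (A * A - s • A) * (1 + (1 / 2 : ℂ) • (A * A - s • A)) = 0 := by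
      simp only [mul_add, mul_one, sub_mul, mul_sub, smul_sub, Matrix.smul_mul,
        Matrix.mul_smul, h3, h4, h5, smul_smul, smul_neg]
      have e : 1 / 2 * s * s = -(1 / 2) := by linear_combination (1 / 2 : ℂ) * hs
      rw [e]
      module
    rw [this, Matrix.zero_mulVec]
  · change (1 + (1 / 2 : ℂ) • (D.phiC u * D.phiC u - s • D.phiC u)).mulVec v = v
    rw [Matrix.add_mulVec, Matrix.smul_mulVec, mem_eigenSum.1 hv, smul_zero, add_zero,
      Matrix.one_mulVec]

lemma curvature_mem {u : Model n} (hu : u ∈ Ω) {v : Fin n → ℂ} (hv : v ∈ D.eigenSum s u)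
    (k l : Fin n) : (fun m => ∑ j, (D.curvature u m j k l : ℂ) * v j) ∈ D.eigenSum s u := by
  set R := (D.curvMat k l u).map ((↑) : ℝ → ℂ)
  have h : D.phiC u * R = R * D.phiC u := by
    rw [phiC, ← map_ofReal_mul, ← map_ofReal_mul, hD.phi_mul_curvMat hu]
  change R.mulVec v ∈ _
  rw [mem_eigenSum, Matrix.mulVec_mulVec]
  have h2 : (D.phiC u * D.phiC u - s • D.phiC u) * R
      = R * (D.phiC u * D.phiC u - s • D.phiC u) := by
    rw [sub_mul, mul_sub, mul_assoc, h, ← mul_assoc, h, mul_assoc, Matrix.smul_mul,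
      Matrix.mul_smul, h]
  rw [h2, ← Matrix.mulVec_mulVec, mem_eigenSum.1 hv, Matrix.mulVec_zero]

lemma xi_mem {u : Model n} (hu : u ∈ Ω) : (fun i => (D.xi u i : ℂ)) ∈ D.eigenSum s u := by
  have h : (D.phiC u).mulVec (fun i => (D.xi u i : ℂ)) = 0 := by
    funext i
    have := congrFun (hD.phi_xi u hu) i
    simp only [Matrix.mulVec, dotProduct, Pi.zero_apply] at this ⊢
    simp only [phiC, Matrix.map_apply]
    exact_mod_cast this
  rw [mem_eigenSum, Matrix.sub_mulVec, ← Matrix.mulVec_mulVec, Matrix.smul_mulVec, h]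
  simp

/-- `φ` is skew-adjoint. -/
lemma transpose_phi_mul {u : Model n} (hu : u ∈ Ω) :
    (D.phi u).transpose * D.g u = -(D.g u * D.phi u) := by
  have hg : (D.g u).transpose = D.g u := by
    ext i j
    exact hD.g_symm u hu j i
  -- `gφ` is the matrix of `dλ`, hence antisymmetric.
  have h : (D.g u * D.phi u).transpose = -(D.g u * D.phi u) := by
    ext i j
    rw [Matrix.transpose_apply, Matrix.neg_apply, ← hD.omega_eq u hu, ← hD.omega_eq u hu]
    simp [omega]
  rwa [Matrix.transpose_mul, hg] at h

/-- Evaluate `g(φ²p, φq)` twice. Moving both `φ` across and using `φ³ = -φ` gives `-ω(p, q)`; using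
`φ²p = sφp`, skewness and `φ²q = sφq` gives `-s² ω(p, q) = ω(p, q)`. -/
lemma isotropic (hs : s * s = -1) {u : Model n} (hu : u ∈ Ω) {p q : Fin n → ℂ}
    (hp : p ∈ D.eigenSum s u) (hq : q ∈ D.eigenSum s u) :
    ∑ i, ∑ j, (D.omega u i j : ℂ) * (p i * q j) = 0 := by
  set A := D.phiC u with hA
  set G := (D.g u).map ((↑) : ℝ → ℂ) with hG
  have hskew : A.transpose * G = -(G * A) := by
    have := congrArg (fun M => M.map ((↑) : ℝ → ℂ)) (hD.transpose_phi_mul hu)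
    simp only [map_ofReal_mul] at this
    refine this.trans ?_
    rw [hA, hG, phiC, ← map_ofReal_mul]
    ext i j
    simp
  have hp' : (A * A).mulVec p = s • A.mulVec p := by
    have := mem_eigenSum.1 hp
    rwa [Matrix.sub_mulVec, Matrix.smul_mulVec, sub_eq_zero] at this
  have hq' : (A * A).mulVec q = s • A.mulVec q := by
    have := mem_eigenSum.1 hq
    rwa [Matrix.sub_mulVec, Matrix.smul_mulVec, sub_eq_zero] at this
  have hω : ∑ i, ∑ j, (D.omega u i j : ℂ) * (p i * q j) = dotProduct p ((G * A).mulVec q) := by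
    simp only [dotProduct, Matrix.mulVec, mul_sum]
    refine sum_congr rfl fun i _ => sum_congr rfl fun j _ => ?_
    rw [hD.omega_eq u hu, hG, hA, phiC, ← map_ofReal_mul, Matrix.map_apply]
    ring
  have move : ∀ (M : Matrix (Fin n) (Fin n) ℂ) (x y : Fin n → ℂ),
      dotProduct (M.mulVec x) y = dotProduct x (M.transpose.mulVec y) := fun M x y => by
    rw [Matrix.dotProduct_mulVec, Matrix.vecMul_transpose]
  rw [hω]
  have e1 : dotProduct ((A * A).mulVec p) ((G * A).mulVec q)
      = -dotProduct p ((G * A).mulVec q) := by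
    rw [move, Matrix.mulVec_mulVec, Matrix.transpose_mul]
    have : A.transpose * A.transpose * (G * A) = -(G * A) := by
      calc A.transpose * A.transpose * (G * A) = A.transpose * (A.transpose * G) * A := by
            simp only [mul_assoc]
        _ = -((A.transpose * G) * A * A) := by
            rw [hskew]; simp only [mul_neg, neg_mul, ← mul_assoc, hskew]
        _ = G * (A * A * A) := by rw [hskew]; simp only [mul_assoc, neg_mul, neg_neg]
        _ = -(G * A) := by rw [hD.phiC_cube hu, mul_neg]
    rw [this, Matrix.neg_mulVec, dotProduct_neg]
  have e2 : dotProduct (A.mulVec p) ((G * A).mulVec q)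
      = -(s * dotProduct p ((G * A).mulVec q)) := by
    rw [move, Matrix.mulVec_mulVec, ← mul_assoc, hskew, neg_mul, mul_assoc, Matrix.neg_mulVec,
      ← Matrix.mulVec_mulVec, hq', Matrix.mulVec_smul, Matrix.mulVec_mulVec, dotProduct_neg,
      dotProduct_smul, smul_eq_mul]
  rw [hp', smul_dotProduct, e2, smul_eq_mul] at e1
  have e3 : dotProduct p ((G * A).mulVec q) = -dotProduct p ((G * A).mulVec q) := by
    linear_combination e1 + dotProduct p ((G * A).mulVec q) * hs
  exact self_eq_neg.1 e3

lemma gInv_mul_transpose {u : Model n} (hu : u ∈ Ω) :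
    D.gInv u * (D.phi u).transpose = -(D.phi u * D.gInv u) := by
  have h := congrArg (fun M => D.gInv u * M * D.gInv u) (hD.transpose_phi_mul hu)
  simp only [mul_neg, neg_mul] at h
  rwa [← mul_assoc, mul_assoc _ (D.g u), hD.mul_gInv hu, mul_one, ← mul_assoc, hD.gInv_mul hu,
    one_mul] at h

omit hD in
lemma wickTensor_eq (u : Model n) : D.wickTensor u = (D.gInv u).map ((↑) : ℝ → ℂ)
    + Complex.I • ((D.gInv u).map ((↑) : ℝ → ℂ) * (D.phiC u).transpose) := by
  ext i j
  simp [wickTensor, bivector, phiC, Matrix.mul_apply]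

/-- With `B = φᵗ` the tensor is `g⁻¹(1 + iB)`, and `(1 + iB)(B² + iB) = i(B + B³) = 0`. -/
lemma wickTensor_row_mem {u : Model n} (hu : u ∈ Ω) (i : Fin n) :
    D.wickTensor u i ∈ D.eigenSum (-Complex.I) u := by
  set A := D.phiC u with hA
  set H := (D.gInv u).map ((↑) : ℝ → ℂ)
  have h3 : A.transpose * A.transpose * A.transpose = -A.transpose := by
    rw [← Matrix.transpose_mul, ← Matrix.transpose_mul, ← mul_assoc, hD.phiC_cube hu,
      Matrix.transpose_neg]
  have h : D.wickTensor u * (A * A - (-Complex.I) • A).transpose = 0 := by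
    have hw : D.wickTensor u = H + Complex.I • (H * A.transpose) := wickTensor_eq u
    rw [hw, Matrix.transpose_sub, Matrix.transpose_mul, Matrix.transpose_smul,
      mul_sub, add_mul, add_mul, Matrix.smul_mul, Matrix.smul_mul, Matrix.mul_smul,
      Matrix.mul_smul, mul_assoc H, ← mul_assoc A.transpose, h3, mul_assoc H, smul_smul]
    simp
    abel
  rw [mem_eigenSum, ← Matrix.vecMul_transpose]
  exact congrFun h i

/-- Skewness of `φ` rewrites the tensor as `(1 - iφ)g⁻¹`, and `(φ² - iφ)(1 - iφ) = -i(φ + φ³) = 0`.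
-/
lemma wickTensor_col_mem {u : Model n} (hu : u ∈ Ω) (j : Fin n) :
    (fun i => D.wickTensor u i j) ∈ D.eigenSum Complex.I u := by
  set A := D.phiC u with hA
  set H := (D.gInv u).map ((↑) : ℝ → ℂ) with hH
  have hw : H * A.transpose = -(A * H) := by
    have := congrArg (fun M => M.map ((↑) : ℝ → ℂ)) (hD.gInv_mul_transpose hu)
    simp only [map_ofReal_mul] at this
    refine this.trans ?_
    rw [hA, hH, phiC, ← map_ofReal_mul]
    ext i j
    simp
  have h : (A * A - Complex.I • A) * D.wickTensor u = 0 := by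
    have hw' : D.wickTensor u = H + Complex.I • (H * A.transpose) := wickTensor_eq u
    have h3 : A * A * A = -A := hD.phiC_cube hu
    rw [hw', hw, smul_neg, sub_mul, mul_add, mul_add, Matrix.smul_mul,
      Matrix.smul_mul, mul_neg, mul_neg, Matrix.mul_smul, Matrix.mul_smul, ← mul_assoc,
      ← mul_assoc, h3, smul_neg, smul_smul]
    simp
    abel
  rw [mem_eigenSum]
  funext i
  exact congrFun (congrFun h i) j

end IsContact

end CoordData

end ContactWick

end

/-! ### The Sasakian condition and the torsion -/

noncomputable section

namespace ContactWick

open Finset Wick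

variable {n : ℕ}

namespace CoordData

variable {D : CoordData n} {Ω : Set (Model n)} {s : ℂ}

/-- The eigenspaces of `φ` for the eigenvalue `s` form an involutive distribution on `Ω`. -/
def EigenInvolutive (D : CoordData n) (Ω : Set (Model n)) (s : ℂ) : Prop :=
  ∀ Z W : Model n → Fin n → ℂ, (∀ j, ContDiffOn ℝ ∞ (fun w => Z w j) Ω) →
    (∀ j, ContDiffOn ℝ ∞ (fun w => W w j) Ω) →
    (∀ w ∈ Ω, (D.phiC w).mulVec (Z w) = s • Z w) →
    (∀ w ∈ Ω, (D.phiC w).mulVec (W w) = s • W w) →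
    ∀ u ∈ Ω, (D.phiC u).mulVec (complexBracket Z W u) = s • complexBracket Z W u

lemma conj_mulVec_phiC (u : Model n) (v : Fin n → ℂ) :
    (D.phiC u).mulVec (fun i => starRingEnd ℂ (v i))
      = fun i => starRingEnd ℂ ((D.phiC u).mulVec v i) := by
  funext i
  simp [Matrix.mulVec, dotProduct, phiC]

lemma complexBracket_conj (hΩ : IsOpen Ω) {Z W : Model n → Fin n → ℂ}
    (hZ : ∀ j, ContDiffOn ℝ ∞ (fun w => Z w j) Ω) (hW : ∀ j, ContDiffOn ℝ ∞ (fun w => W w j) Ω)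
    {u : Model n} (hu : u ∈ Ω) :
    complexBracket (fun w i => starRingEnd ℂ (Z w i)) (fun w i => starRingEnd ℂ (W w i)) u
      = fun i => starRingEnd ℂ (complexBracket Z W u i) := by
  have h : ∀ {V : Model n → Fin n → ℂ} (_ : ∀ j, ContDiffOn ℝ ∞ (fun w => V w j) Ω) (j i : Fin n),
      pd j (fun w => starRingEnd ℂ (V w i)) u = starRingEnd ℂ (pd j (fun w => V w i) u) :=
    fun hV j i => pd_clm (Complex.conjCLE : ℂ →L[ℝ] ℂ)
      ((hV i).differentiableAt_of_isOpen hΩ hu) j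
  funext i
  simp only [complexBracket, h hZ, h hW, map_sum, map_sub, map_mul]

/-- `φ` and the coordinate derivatives are real, so complex conjugation exchanges the two
eigenspaces and commutes with the bracket. -/
lemma EigenInvolutive.conj (hΩ : IsOpen Ω) (h : D.EigenInvolutive Ω s) :
    D.EigenInvolutive Ω (starRingEnd ℂ s) := by
  intro Z W hZ hW hZs hWs u hu
  have hc : ∀ {V : Model n → Fin n → ℂ} (_ : ∀ j, ContDiffOn ℝ ∞ (fun w => V w j) Ω) (j : Fin n),
      ContDiffOn ℝ ∞ (fun w => starRingEnd ℂ (V w j)) Ω := fun hV j =>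
    (Complex.conjCLE : ℂ →L[ℝ] ℂ).contDiff.comp_contDiffOn (hV j)
  have he : ∀ {V : Model n → Fin n → ℂ}
      (_ : ∀ w ∈ Ω, (D.phiC w).mulVec (V w) = starRingEnd ℂ s • V w), ∀ w ∈ Ω,
      (D.phiC w).mulVec (fun i => starRingEnd ℂ (V w i)) = s • fun i => starRingEnd ℂ (V w i) := by
    intro V hV w hw
    rw [conj_mulVec_phiC, hV w hw]
    funext i
    simp
  have h1 := h _ _ (hc hZ) (hc hW) (he hZs) (he hWs) u hu
  rw [complexBracket_conj hΩ hZ hW hu, conj_mulVec_phiC] at h1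
  funext i
  have h2 := congrArg (starRingEnd ℂ) (congrFun h1 i)
  simpa using h2

namespace IsContact

variable (hD : D.IsContact Ω)
include hD

lemma mono {Ω' : Set (Model n)} (hΩ' : IsOpen Ω') (h : Ω' ⊆ Ω) : D.IsContact Ω' where
  isOpen := hΩ'
  smooth_g i j := (hD.smooth_g i j).mono h
  smooth_lam i := (hD.smooth_lam i).mono h
  smooth_xi i := (hD.smooth_xi i).mono h
  smooth_phi i j := (hD.smooth_phi i j).mono h
  g_symm u hu := hD.g_symm u (h hu)
  det_ne_zero u hu := hD.det_ne_zero u (h hu)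
  phi_phi u hu := hD.phi_phi u (h hu)
  lam_xi u hu := hD.lam_xi u (h hu)
  phi_xi u hu := hD.phi_xi u (h hu)
  lam_phi u hu := hD.lam_phi u (h hu)
  omega_eq u hu := hD.omega_eq u (h hu)

/-! ### The Lie derivative of `φ` along `ξ` -/

/-- `dω = 0`. -/
lemma cyclic_pd_omega {u : Model n} (hu : u ∈ Ω) (i j k : Fin n) :
    pd k (fun w => D.omega w i j) u + pd i (fun w => D.omega w j k) u
      + pd j (fun w => D.omega w k i) u = 0 := by
  have hΩ := hD.isOpen
  have h1 : ∀ a b c, pd c (fun w => D.omega w a b) u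
      = pd c (pd a fun w => D.lam w b) u - pd c (pd b fun w => D.lam w a) u := fun a b c =>
    pd_sub ((contDiffOn_pd hΩ (hD.smooth_lam b) a).differentiableAt_of_isOpen hΩ hu)
      ((contDiffOn_pd hΩ (hD.smooth_lam a) b).differentiableAt_of_isOpen hΩ hu) c
  have h2 := fun a b c => pd_comm hΩ hu (hD.smooth_lam c) a b
  rw [h1, h1, h1, h2 k i j, h2 k j i, h2 i j k]
  ring

/-- The Jacobian matrix of `ξ`. -/
def _root_.ContactWick.CoordData.xiJac (D : CoordData n) (u : Model n) :
    Matrix (Fin n) (Fin n) ℝ :=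
  Matrix.of fun i k => pd k (fun w => D.xi w i) u

/-- The derivative of a matrix-valued function along `ξ`. -/
def _root_.ContactWick.CoordData.xiDeriv (D : CoordData n)
    (F : Model n → Matrix (Fin n) (Fin n) ℝ) (u : Model n) : Matrix (Fin n) (Fin n) ℝ :=
  ∑ k, D.xi u k • matPd k F u

lemma xiDeriv_mul {F G : Model n → Matrix (Fin n) (Fin n) ℝ} (hF : SmoothMat Ω F)
    (hG : SmoothMat Ω G) {u : Model n} (hu : u ∈ Ω) :
    D.xiDeriv (fun w => F w * G w) u = D.xiDeriv F u * G u + F u * D.xiDeriv G u := by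
  simp only [xiDeriv, matPd_mul hD.isOpen hu hF hG, smul_add, sum_add_distrib, Matrix.sum_mul,
    Matrix.mul_sum, Matrix.smul_mul, Matrix.mul_smul]

/-- `L_ξ ω = 0`. -/
lemma lieReeb_omega {u : Model n} (hu : u ∈ Ω) :
    D.xiDeriv (fun w => D.g w * D.phi w) u + (D.xiJac u).transpose * (D.g u * D.phi u)
      + (D.g u * D.phi u) * D.xiJac u = 0 := by
  have hΩ := hD.isOpen
  have hs : ∀ i j, ContDiffOn ℝ ∞ (fun w => D.omega w i j) Ω := hD.isSmoothOn.omega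
  have hanti : ∀ w i j, D.omega w i j = -D.omega w j i := fun w i j => by simp [omega]
  have hzero : ∀ w ∈ Ω, ∀ i, ∑ k, D.omega w i k * D.xi w k = 0 := by
    intro w hw i
    have h := congrFun (congrArg (D.g w).mulVec (hD.phi_xi w hw)) i
    rw [Matrix.mulVec_mulVec, Matrix.mulVec_zero] at h
    simp only [hD.omega_eq w hw]
    exact h
  -- The derivative of `ι_ξ ω = 0`. Together with `dω = 0`, which enters in `h4`, it gives Cartan's
  -- `L_ξ ω = ι_ξ dω + d ι_ξ ω = 0`.
  have hd : ∀ i j, ∑ k, D.xi u k * pd i (fun w => D.omega w j k) u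
      = -∑ k, D.omega u j k * pd i (fun w => D.xi w k) u := by
    intro i j
    have h1 := fun k => (hs j k).differentiableAt_of_isOpen hΩ hu
    have h2 := fun k => (hD.smooth_xi k).differentiableAt_of_isOpen hΩ hu
    have h3 : pd i (fun w => ∑ k, D.omega w j k * D.xi w k) u = 0 := by
      rw [pd_congr hΩ hu fun w hw => hzero w hw j]
      exact pd_const _ i u
    rw [pd_sum _ fun k _ => (h1 k).fun_mul (h2 k),
      sum_congr rfl fun k _ => pd_mul (h1 k) (h2 k) i, sum_add_distrib] at h3
    rw [← eq_neg_of_add_eq_zero_left h3]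
    exact sum_congr rfl fun k _ => mul_comm _ _
  ext i j
  have h4 : ∀ k, pd k (fun w => (D.g w * D.phi w) i j) u
      = -pd i (fun w => D.omega w j k) u + pd j (fun w => D.omega w i k) u := by
    intro k
    rw [pd_congr hΩ hu (fun w hw => (hD.omega_eq w hw i j).symm)]
    have h5 := hD.cyclic_pd_omega hu i j k
    have h6 : pd j (fun w => D.omega w k i) u = -pd j (fun w => D.omega w i k) u := by
      rw [pd_congr (g := fun w => 0 - D.omega w i k) hΩ hu
        (fun w _ => by rw [hanti w k i, zero_sub]),
        pd_sub (differentiableAt_const _) ((hs i k).differentiableAt_of_isOpen hΩ hu), pd_const,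
        zero_sub]
    linarith
  simp only [xiDeriv, xiJac, matPd, Matrix.add_apply, Matrix.sum_apply, Matrix.smul_apply,
    Matrix.of_apply, smul_eq_mul, Matrix.zero_apply, h4, mul_add, mul_neg,
    sum_add_distrib, sum_neg_distrib, hd]
  rw [Matrix.mul_apply, Matrix.mul_apply]
  simp only [← hD.omega_eq u hu, Matrix.transpose_apply, Matrix.of_apply]
  have h7 : ∑ k, pd i (fun w => D.xi w k) u * D.omega u k j
      = -∑ k, D.omega u j k * pd i (fun w => D.xi w k) u := by
    rw [← sum_neg_distrib]
    exact sum_congr rfl fun k _ => by rw [hanti u k j]; ring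
  rw [h7]
  ring

/-- If `ξ` is a Killing field, then `L_ξ φ = 0`. -/
lemma lieReeb_phi (hK : ∀ u ∈ Ω, ∀ i j, D.lieReebMetric u i j = 0) {u : Model n} (hu : u ∈ Ω) :
    D.xiDeriv D.phi u = D.xiJac u * D.phi u - D.phi u * D.xiJac u := by
  have h1 := hD.lieReeb_omega hu
  rw [hD.xiDeriv_mul hD.smooth_g hD.smooth_phi hu] at h1
  have h2 : D.xiDeriv D.g u + (D.xiJac u).transpose * D.g u + D.g u * D.xiJac u = 0 := by
    ext i j
    have := hK u hu i j
    simp only [lieReebMetric, sum_add_distrib] at this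
    simp only [xiDeriv, Matrix.add_apply, Matrix.sum_apply, Matrix.smul_apply, smul_eq_mul,
      Matrix.mul_apply, Matrix.transpose_apply, Matrix.zero_apply]
    rw [← this]
    congr 2
    exact sum_congr rfl fun k _ => mul_comm _ _
  -- Since `ω = gφ`, subtracting `(L_ξ g)φ = 0` from `L_ξ ω = 0` leaves `g (L_ξ φ) = 0`.
  have h3 : D.g u * (D.xiDeriv D.phi u - (D.xiJac u * D.phi u - D.phi u * D.xiJac u)) = 0 := by
    have h4 := congrArg (· * D.phi u) h2
    simp only [zero_mul] at h4
    rw [← sub_eq_zero] at h1 h4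
    calc _ = (D.xiDeriv D.g u * D.phi u + D.g u * D.xiDeriv D.phi u
          + (D.xiJac u).transpose * (D.g u * D.phi u) + D.g u * D.phi u * D.xiJac u - 0)
          - ((D.xiDeriv D.g u + (D.xiJac u).transpose * D.g u + D.g u * D.xiJac u) * D.phi u
            - 0) := by noncomm_ring
      _ = 0 := by rw [h1, h4, sub_zero]
  have h5 := congrArg (D.gInv u * ·) h3
  simp only [mul_zero, ← mul_assoc, hD.gInv_mul hu, one_mul] at h5
  exact sub_eq_zero.1 h5

/-- If `ξ` is a Killing field, then the bracket with `ξ` preserves the eigenspaces of `φ`. -/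
lemma bracket_xi (hK : ∀ u ∈ Ω, ∀ i j, D.lieReebMetric u i j = 0) {Z : Model n → Fin n → ℂ}
    (hZ : ∀ j, ContDiffOn ℝ ∞ (fun w => Z w j) Ω)
    (hZs : ∀ w ∈ Ω, (D.phiC w).mulVec (Z w) = s • Z w) {u : Model n} (hu : u ∈ Ω) :
    (D.phiC u).mulVec (complexBracket (fun w i => (D.xi w i : ℂ)) Z u)
      = s • complexBracket (fun w i => (D.xi w i : ℂ)) Z u := by
  have hΩ := hD.isOpen
  set A := D.phiC u
  set K := (D.xiJac u).map ((↑) : ℝ → ℂ) with hK'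
  set Z' : Fin n → ℂ := ∑ k, (D.xi u k : ℂ) • vecPd k Z u with hZ'
  have hb : complexBracket (fun w i => (D.xi w i : ℂ)) Z u = Z' - K.mulVec (Z u) := by
    funext i
    simp only [complexBracket, sum_sub_distrib, hZ', Pi.sub_apply, Finset.sum_apply, Pi.smul_apply,
      smul_eq_mul, vecPd]
    congr 1
    refine sum_congr rfl fun k _ => ?_
    rw [pd_ofReal ((hD.smooth_xi i).differentiableAt_of_isOpen hΩ hu)]
    exact mul_comm _ _
  have h1 : ∑ k, (D.xi u k : ℂ) • matPd k D.phiC u = K * A - A * K := by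
    have h2 := congrArg (fun M => M.map ((↑) : ℝ → ℂ)) (hD.lieReeb_phi hK hu)
    have h3 : (D.xiJac u * D.phi u - D.phi u * D.xiJac u).map ((↑) : ℝ → ℂ) = K * A - A * K := by
      rw [Matrix.map_sub _ (by simp), map_ofReal_mul, map_ofReal_mul]
      rfl
    rw [← h3]
    refine Eq.trans ?_ h2
    ext i j
    have h4 : ∀ k, matPd k D.phiC u = (matPd k D.phi u).map ((↑) : ℝ → ℂ) := fun k =>
      matPd_ofReal hΩ hu hD.smooth_phi k
    simp [h4, xiDeriv, Matrix.sum_apply]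
  -- The derivative of `φ Z = s Z` along `ξ`, with `L_ξ φ = 0` inserted.
  have h5 : (K * A - A * K).mulVec (Z u) + A.mulVec Z' = s • Z' := by
    rw [← h1, hZ', Matrix.sum_mulVec, Matrix.mulVec_sum, smul_sum, ← sum_add_distrib]
    refine sum_congr rfl fun k _ => ?_
    rw [Matrix.smul_mulVec, Matrix.mulVec_smul, ← smul_add,
      ← vecPd_mulVec hΩ hu hD.smooth_phiC hZ, vecPd_congr hΩ hu hZs, smul_comm]
    congr 1
    funext i
    have := pd_mul (differentiableAt_const s) ((hZ i).differentiableAt_of_isOpen hΩ hu) k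
    rw [pd_const, zero_mul, zero_add] at this
    exact this
  rw [Matrix.sub_mulVec, ← Matrix.mulVec_mulVec, ← Matrix.mulVec_mulVec, hZs u hu,
    Matrix.mulVec_smul] at h5
  rw [hb, Matrix.mulVec_sub, smul_sub, ← h5]
  abel

/-! ### The torsion -/

/-- In `[P, Q] = ∇_P Q - ∇_Q P + T(P, Q)` the covariant derivatives stay in `eigenSum`, so the
torsion lies there once the bracket does. -/
lemma torsion_mem_of_bracket {P Q : Model n → Fin n → ℂ}
    (hPs : ∀ j, ContDiffOn ℝ ∞ (fun w => P w j) Ω) (hPN : ∀ w ∈ Ω, P w ∈ D.eigenSum s w)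
    (hQs : ∀ j, ContDiffOn ℝ ∞ (fun w => Q w j) Ω) (hQN : ∀ w ∈ Ω, Q w ∈ D.eigenSum s w)
    {u : Model n} (hu : u ∈ Ω) (h : complexBracket P Q u ∈ D.eigenSum s u) :
    (fun m => ∑ i, ∑ j, (D.torsion u m i j : ℂ) * (P u i * Q u j)) ∈ D.eigenSum s u := by
  rw [complexBracket_eq (hD.torsion_eq hu)] at h
  exact ((D.eigenSum s u).add_mem_iff_right ((D.eigenSum s u).sub_mem
    ((D.eigenSum s u).sum_mem fun i _ =>
      (D.eigenSum s u).smul_mem (P u i) (hD.parallel hQs hQN hu i))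
    ((D.eigenSum s u).sum_mem fun i _ =>
      (D.eigenSum s u).smul_mem (Q u i) (hD.parallel hPs hPN hu i)))).1 h

omit hD in
/-- The torsion as a bilinear map. -/
def _root_.ContactWick.CoordData.torsionBilin (D : CoordData n) (u : Model n) :
    (Fin n → ℂ) →ₗ[ℂ] (Fin n → ℂ) →ₗ[ℂ] (Fin n → ℂ) :=
  LinearMap.mk₂ ℂ (fun p q m => ∑ i, ∑ j, (D.torsion u m i j : ℂ) * (p i * q j))
    (fun p p' q => by
      funext m; simp only [Pi.add_apply, add_mul, mul_add, sum_add_distrib])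
    (fun c p q => by
      funext m
      simp only [Pi.smul_apply, smul_eq_mul, mul_sum]
      exact sum_congr rfl fun i _ => sum_congr rfl fun j _ => by ring)
    (fun p q q' => by
      funext m; simp only [Pi.add_apply, mul_add, sum_add_distrib])
    (fun c p q => by
      funext m
      simp only [Pi.smul_apply, smul_eq_mul, mul_sum]
      exact sum_congr rfl fun i _ => sum_congr rfl fun j _ => by ring)

omit hD in
lemma torsionBilin_swap (u : Model n) (p q : Fin n → ℂ) :
    D.torsionBilin u p q = -D.torsionBilin u q p := by
  funext m
  change ∑ i, ∑ j, (D.torsion u m i j : ℂ) * (p i * q j)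
    = -∑ i, ∑ j, (D.torsion u m i j : ℂ) * (q i * p j)
  rw [sum_comm, ← sum_neg_distrib]
  refine sum_congr rfl fun i _ => ?_
  rw [← sum_neg_distrib]
  refine sum_congr rfl fun j _ => ?_
  have : D.torsion u m j i = -D.torsion u m i j := by simp [torsion]
  rw [this]
  push_cast
  ring

/-- `-½(φ² + sφ)` takes the values `0, 1, 0` on the eigenvalues `0, s, -s`: it is the projector onto
the eigenspace, now without `ξ`. -/
lemma eigen_extend (hs : s * s = -1) {u : Model n} {v : Fin n → ℂ}
    (hv : (D.phiC u).mulVec v = s • v) :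
    ∃ V : Model n → Fin n → ℂ, (∀ j, ContDiffOn ℝ ∞ (fun w => V w j) Ω) ∧
      (∀ w ∈ Ω, (D.phiC w).mulVec (V w) = s • V w) ∧ V u = v := by
  refine ⟨fun w => ((-(1 / 2) : ℂ) • (D.phiC w * D.phiC w + s • D.phiC w)).mulVec v, ?_, ?_, ?_⟩
  · exact SmoothMat.mulVec (fun i j => contDiffOn_const.mul
      ((hD.smooth_phiC.mul hD.smooth_phiC i j).add
        (contDiffOn_const.mul (hD.smooth_phiC i j)))) fun j => contDiffOn_const
  · intro w hw
    rw [Matrix.mulVec_mulVec, ← Matrix.smul_mulVec]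
    congr 1
    rw [Matrix.mul_smul, mul_add, ← mul_assoc, hD.phiC_cube hw, Matrix.mul_smul, smul_comm s,
      smul_add s, smul_smul s s, hs]
    module
  · change ((-(1 / 2) : ℂ) • (D.phiC u * D.phiC u + s • D.phiC u)).mulVec v = v
    rw [Matrix.smul_mulVec, Matrix.add_mulVec, ← Matrix.mulVec_mulVec, Matrix.smul_mulVec, hv,
      Matrix.mulVec_smul, hv, smul_smul, hs]
    module

/-- A vector in `eigenSum` is the sum of an eigenvector and a multiple of `ξ`. -/
lemma exists_decomp (hs : s * s = -1) {u : Model n} (hu : u ∈ Ω) {v : Fin n → ℂ}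
    (hv : v ∈ D.eigenSum s u) : ∃ (p : Fin n → ℂ) (c : ℂ),
      (D.phiC u).mulVec p = s • p ∧ v = p + c • fun i => (D.xi u i : ℂ) := by
  set A := D.phiC u
  have hv' : (A * A).mulVec v = s • A.mulVec v := by
    have := mem_eigenSum.1 hv
    rwa [Matrix.sub_mulVec, Matrix.smul_mulVec, sub_eq_zero] at this
  -- This is `v = -φ²v + λ(v) ξ`, a rewriting of `φ² = -1 + ξ ⊗ λ`.
  refine ⟨-(A * A).mulVec v, ∑ i, (D.lam u i : ℂ) * v i, ?_, ?_⟩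
  · rw [Matrix.mulVec_neg, Matrix.mulVec_mulVec, ← mul_assoc, hD.phiC_cube hu, hv', smul_neg,
      smul_smul, hs, Matrix.neg_mulVec]
    module
  · have h : A * A = -1 + Matrix.vecMulVec (fun i => (D.xi u i : ℂ)) (fun i => (D.lam u i : ℂ)) := by
      change (D.phi u).map _ * (D.phi u).map _ = _
      rw [← map_ofReal_mul, hD.phi_phi u hu]
      ext i j
      simp [Matrix.vecMulVec_apply, Matrix.one_apply, apply_ite]
    rw [h, Matrix.add_mulVec, Matrix.neg_mulVec, Matrix.one_mulVec, Matrix.vecMulVec_mulVec]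
    funext i
    simp [dotProduct, mul_comm]

/-- On a Sasakian manifold, the torsion of the contact metric connection preserves `eigenSum`. -/
lemma torsion_mem (hs : s * s = -1) (hK : ∀ u ∈ Ω, ∀ i j, D.lieReebMetric u i j = 0)
    (hI : D.EigenInvolutive Ω s) {u : Model n} (hu : u ∈ Ω) {p q : Fin n → ℂ}
    (hp : p ∈ D.eigenSum s u) (hq : q ∈ D.eigenSum s u) :
    (fun m => ∑ i, ∑ j, (D.torsion u m i j : ℂ) * (p i * q j)) ∈ D.eigenSum s u := by
  set ξ : Fin n → ℂ := fun i => (D.xi u i : ℂ) with hξ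
  have hξs : ∀ j, ContDiffOn ℝ ∞ (fun w => (D.xi w j : ℂ)) Ω := fun j =>
    contDiffOn_ofReal (hD.smooth_xi j)
  change D.torsionBilin u p q ∈ _
  obtain ⟨p, a, hp', rfl⟩ := hD.exists_decomp hs hu hp
  obtain ⟨q, b, hq', rfl⟩ := hD.exists_decomp hs hu hq
  -- Two eigenvectors: involutivity of the eigenspaces.
  have h1 : D.torsionBilin u p q ∈ D.eigenSum s u := by
    obtain ⟨P, hPs, hPN, rfl⟩ := hD.eigen_extend hs hp'
    obtain ⟨Q, hQs, hQN, rfl⟩ := hD.eigen_extend hs hq'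
    exact hD.torsion_mem_of_bracket hPs (fun w hw => mem_eigenSum_of_eigen (hPN w hw)) hQs
      (fun w hw => mem_eigenSum_of_eigen (hQN w hw)) hu
      (mem_eigenSum_of_eigen (hI P Q hPs hQs hPN hQN u hu))
  -- `ξ` and an eigenvector: the Killing condition, through `bracket_xi`.
  have h2 : ∀ q, (D.phiC u).mulVec q = s • q → D.torsionBilin u ξ q ∈ D.eigenSum s u := by
    intro q hq'
    obtain ⟨Q, hQs, hQN, rfl⟩ := hD.eigen_extend hs hq'
    exact hD.torsion_mem_of_bracket (P := fun w i => (D.xi w i : ℂ)) hξs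
      (fun w hw => hD.xi_mem hw) hQs
      (fun w hw => mem_eigenSum_of_eigen (hQN w hw)) hu
      (mem_eigenSum_of_eigen (hD.bracket_xi hK hQs hQN hu))
  have h3 : D.torsionBilin u ξ ξ = 0 := self_eq_neg.1 (torsionBilin_swap u ξ ξ)
  have h4 : D.torsionBilin u (p + a • ξ) (q + b • ξ) = D.torsionBilin u p q
      + a • D.torsionBilin u ξ q + b • -D.torsionBilin u ξ p := by
    rw [← torsionBilin_swap]
    simp only [map_add, map_smul, LinearMap.add_apply, LinearMap.smul_apply, h3, smul_zero,
      add_zero]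
  rw [h4]
  exact Submodule.add_mem _ (Submodule.add_mem _ h1 (Submodule.smul_mem _ _ (h2 q hq')))
    (Submodule.smul_mem _ _ (Submodule.neg_mem _ (h2 p hp')))

/-- The polarization of a Sasakian manifold by `eigenSum`. -/
lemma polarization (hs : s * s = -1)
    (hT : ∀ u ∈ Ω, ∀ p ∈ D.eigenSum s u, ∀ q ∈ D.eigenSum s u,
      (fun m => ∑ i, ∑ j, (D.torsion u m i j : ℂ) * (p i * q j)) ∈ D.eigenSum s u)
    (hC : ∀ u ∈ Ω, Compatible (D.wickTensor u) (D.eigenSum s u)) :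
    D.Polarization Ω (D.eigenSum s) where
  smooth := hD.isSmoothOn
  extend _ _ _ hv := hD.extend hs hv
  parallel _ hV hVN _ hu i := hD.parallel hV hVN hu i
  torsion_eq _ hu := hD.torsion_eq hu
  torsion_mem := hT
  curvature_mem _ hu _ hv := hD.curvature_mem hu hv
  isotropic _ hu _ hp _ hq := hD.isotropic hs hu hp hq
  xi_mem _ hu := hD.xi_mem hu
  compatible := hC

end IsContact

end CoordData

end ContactWick

end

/-! ### From the manifold to the chart -/

noncomputable section

namespace ContactWick

open Finset Wick

/-! ### Coordinate expressions of tensors -/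

section Coordinates

variable {n : ℕ} {M : Type*} [TopologicalSpace M] [ChartedSpace (Model n) M]
  [IsManifold (𝓡 n) ∞ M] {e : OpenPartialHomeomorph M (Model n)}

omit [IsManifold (𝓡 n) ∞ M] in
lemma mdifferentiable_of_mem_maximalAtlas (he : e ∈ IsManifold.maximalAtlas (𝓡 n) ∞ M) :
    e.MDifferentiable (𝓡 n) (𝓡 n) :=
  ⟨(contMDiffOn_of_mem_maximalAtlas he).mdifferentiableOn (by simp),
    (contMDiffOn_symm_of_mem_maximalAtlas he).mdifferentiableOn (by simp)⟩

omit [IsManifold (𝓡 n) ∞ M] in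
lemma coordComp_coordVec (he : e ∈ IsManifold.maximalAtlas (𝓡 n) ∞ M) {u : Model n}
    (hu : u ∈ e.target) (i j : Fin n) :
    coordComp e u (coordVec e u j) i = if i = j then 1 else 0 := by
  have h := DFunLike.congr_fun ((mdifferentiable_of_mem_maximalAtlas he).comp_symm_deriv hu)
    (EuclideanSpace.single j (1 : ℝ) : Model n)
  refine (congrArg (fun v : Model n => v i) h).trans ?_
  change (EuclideanSpace.single j (1 : ℝ) : Model n) i = _
  simp

omit [IsManifold (𝓡 n) ∞ M] in
lemma sum_coordComp (he : e ∈ IsManifold.maximalAtlas (𝓡 n) ∞ M) {u : Model n}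
    (hu : u ∈ e.target) (v : TangentSpace (𝓡 n) (e.symm u)) :
    ∑ i, coordComp e u v i • coordVec e u i = v := by
  have h := DFunLike.congr_fun
    ((mdifferentiable_of_mem_maximalAtlas he).symm_comp_deriv (e.map_target hu)) v
  rw [e.right_inv hu] at h
  have h1 : ∀ w : Model n, w = ∑ i, w i • (EuclideanSpace.single i (1 : ℝ) : Model n) :=
    fun w => by
      ext j
      simp [Pi.single_apply]
  have h2 : (mfderiv (𝓡 n) (𝓡 n) e (e.symm u) v : Model n)
      = ∑ i, coordComp e u v i • (EuclideanSpace.single i (1 : ℝ) : Model n) :=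
    h1 (mfderiv (𝓡 n) (𝓡 n) e (e.symm u) v : Model n)
  refine Eq.trans ?_ h
  change _ = mfderiv (𝓡 n) (𝓡 n) e.symm u (mfderiv (𝓡 n) (𝓡 n) e (e.symm u) v : Model n)
  rw [h2]
  simp only [coordVec]
  exact ((map_sum (mfderiv (𝓡 n) (𝓡 n) e.symm u) _ _).trans
    (sum_congr rfl fun i _ => map_smul (mfderiv (𝓡 n) (𝓡 n) e.symm u) _ _)).symm

/-- `coordComp` as a linear map. -/
def coordCompLin (e : OpenPartialHomeomorph M (Model n)) (u : Model n) (i : Fin n) :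
    TangentSpace (𝓡 n) (e.symm u) →ₗ[ℝ] ℝ :=
  ((EuclideanSpace.proj i : Model n →L[ℝ] ℝ).comp
    (mfderiv (𝓡 n) (𝓡 n) e (e.symm u) : Model n →L[ℝ] Model n)).toLinearMap

omit [IsManifold (𝓡 n) ∞ M] in
lemma coordCompLin_apply (u : Model n) (i : Fin n) (v : TangentSpace (𝓡 n) (e.symm u)) :
    coordCompLin e u i v = coordComp e u v i := rfl

omit [IsManifold (𝓡 n) ∞ M] in
lemma sum_coordComp_mul (he : e ∈ IsManifold.maximalAtlas (𝓡 n) ∞ M) {u : Model n}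
    (hu : u ∈ e.target) (v : TangentSpace (𝓡 n) (e.symm u))
    (L : TangentSpace (𝓡 n) (e.symm u) →ₗ[ℝ] ℝ) :
    ∑ i, L (coordVec e u i) * coordComp e u v i = L v := by
  conv_rhs => rw [← sum_coordComp he hu v]
  simp [mul_comm]

/-- The coordinate field is the tangent map of `e.symm` composed with a constant field on the model
space. -/
lemma contMDiffOn_coordVec (he : e ∈ IsManifold.maximalAtlas (𝓡 n) ∞ M) (j : Fin n) :
    ContMDiffOn (𝓡 n) ((𝓡 n).prod 𝓘(ℝ, Model n)) ∞
      (fun u => TotalSpace.mk' (Model n) (E := TangentSpace (𝓡 n)) (e.symm u) (coordVec e u j))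
      e.target := by
  have h1 := (contMDiffOn_symm_of_mem_maximalAtlas he).contMDiffOn_tangentMapWithin (m := ∞)
    (by norm_num) e.open_target.uniqueMDiffOn
  have h2 : ContMDiffOn (𝓡 n) ((𝓡 n).prod 𝓘(ℝ, Model n)) ∞
      (fun u : Model n => TotalSpace.mk' (Model n) (E := TangentSpace (𝓡 n)) u
        (EuclideanSpace.single j (1 : ℝ) : Model n)) e.target :=
    contMDiffOn_vectorSpace_iff_contDiffOn.2 contDiffOn_const
  refine (h1.comp h2 fun u hu => hu).congr fun u hu => ?_
  simp only [Function.comp, tangentMapWithin, coordVec]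
  rw [mfderivWithin_of_isOpen e.open_target hu]

lemma contDiffOn_coordComp (he : e ∈ IsManifold.maximalAtlas (𝓡 n) ∞ M)
    {X : ∀ u, TangentSpace (𝓡 n) (e.symm u)}
    (hX : ContMDiffOn (𝓡 n) ((𝓡 n).prod 𝓘(ℝ, Model n)) ∞
      (fun u => TotalSpace.mk' (Model n) (E := TangentSpace (𝓡 n)) (e.symm u) (X u)) e.target)
    (i : Fin n) : ContDiffOn ℝ ∞ (fun u => coordComp e u (X u) i) e.target := by
  have h1 := (contMDiffOn_of_mem_maximalAtlas he).contMDiffOn_tangentMapWithin (m := ∞)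
    (by norm_num) e.open_source.uniqueMDiffOn
  have h2 := h1.comp hX fun u hu => e.map_target hu
  have h3 : ContMDiffOn (𝓡 n) 𝓘(ℝ, Model n) ∞
      (fun u => (mfderiv (𝓡 n) (𝓡 n) e (e.symm u) (X u) : Model n)) e.target := by
    refine (contMDiff_snd_tangentBundle_modelSpace (Model n) (𝓡 n)).comp_contMDiffOn h2 |>.congr
      fun u hu => ?_
    simp only [Function.comp, tangentMapWithin]
    rw [mfderivWithin_of_isOpen e.open_source (e.map_target hu)]
  exact (EuclideanSpace.proj i : Model n →L[ℝ] ℝ).contDiff.comp_contDiffOn h3.contDiffOn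

omit [IsManifold (𝓡 n) ∞ M] in
lemma pd_comp_symm (he : e ∈ IsManifold.maximalAtlas (𝓡 n) ∞ M) {f : M → ℂ} {u : Model n}
    (hu : u ∈ e.target) (hf : MDifferentiableAt (𝓡 n) 𝓘(ℝ, ℂ) f (e.symm u)) (j : Fin n) :
    pd j (fun w => f (e.symm w)) u = diff f (e.symm u) (coordVec e u j) := by
  have h := mfderiv_comp u hf ((mdifferentiable_of_mem_maximalAtlas he).mdifferentiableAt_symm hu)
  rw [mfderiv_eq_fderiv] at h
  exact DFunLike.congr_fun h (EuclideanSpace.single j (1 : ℝ) : Model n)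

namespace ContactMetric

variable (S : ContactMetric n M)

lemma coord_phi_mulVec (he : e ∈ IsManifold.maximalAtlas (𝓡 n) ∞ M) {u : Model n}
    (hu : u ∈ e.target) (v : TangentSpace (𝓡 n) (e.symm u)) (i : Fin n) :
    ∑ j, (S.coord e).phi u i j * coordComp e u v j = coordComp e u (S.phi (e.symm u) v) i :=
  sum_coordComp_mul he hu v ((coordCompLin e u i).comp (S.phi (e.symm u)).toLinearMap)

/-- The components of a contact metric structure in a chart. -/
lemma isContact_coord (he : e ∈ IsManifold.maximalAtlas (𝓡 n) ∞ M) :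
    (S.coord e).IsContact e.target where
  isOpen := e.open_target
  smooth_g i j := by
    have h1 : ContMDiffOn (𝓡 n) ((𝓡 n).prod 𝓘(ℝ, Model n →L[ℝ] Model n →L[ℝ] ℝ)) ∞
        (fun u => TotalSpace.mk' (Model n →L[ℝ] Model n →L[ℝ] ℝ)
          (E := fun x : M => TangentSpace (𝓡 n) x →L[ℝ] TangentSpace (𝓡 n) x →L[ℝ] ℝ)
          (e.symm u) (S.metric.inner (e.symm u))) e.target :=
      S.metric.contMDiff.comp_contMDiffOn (contMDiffOn_symm_of_mem_maximalAtlas he)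
    have h2 : ContMDiffOn (𝓡 n) ((𝓡 n).prod 𝓘(ℝ, ℝ)) ∞
        (fun u => TotalSpace.mk' ℝ (E := Bundle.Trivial M ℝ) (e.symm u)
          (S.metric.inner (e.symm u) (coordVec e u i) (coordVec e u j))) e.target :=
      ContMDiffOn.clm_bundle_apply₂ (F₁ := Model n) (F₂ := Model n) h1
        (contMDiffOn_coordVec he i) (contMDiffOn_coordVec he j)
    intro u hu
    have h3 := h2 u hu
    rw [contMDiffWithinAt_totalSpace] at h3
    exact h3.2.contDiffWithinAt
  smooth_lam i := by
    have h1 : ContMDiffOn (𝓡 n) ((𝓡 n).prod 𝓘(ℝ, Model n →L[ℝ] ℝ)) ∞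
        (fun u => TotalSpace.mk' (Model n →L[ℝ] ℝ)
          (E := fun x : M => TangentSpace (𝓡 n) x →L[ℝ] ℝ)
          (e.symm u) (S.form (e.symm u))) e.target :=
      S.form_smooth.comp_contMDiffOn (contMDiffOn_symm_of_mem_maximalAtlas he)
    have h2 : ContMDiffOn (𝓡 n) ((𝓡 n).prod 𝓘(ℝ, ℝ)) ∞
        (fun u => TotalSpace.mk' ℝ (E := Bundle.Trivial M ℝ) (e.symm u)
          (S.form (e.symm u) (coordVec e u i))) e.target :=
      ContMDiffOn.clm_bundle_apply (F₁ := Model n) h1 (contMDiffOn_coordVec he i)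
    intro u hu
    have h3 := h2 u hu
    rw [contMDiffWithinAt_totalSpace] at h3
    exact h3.2.contDiffWithinAt
  smooth_xi i := contDiffOn_coordComp he (X := fun u => S.reeb (e.symm u))
    (S.reeb_smooth.comp_contMDiffOn (contMDiffOn_symm_of_mem_maximalAtlas he)) i
  smooth_phi i j := by
    have h1 : ContMDiffOn (𝓡 n) ((𝓡 n).prod 𝓘(ℝ, Model n →L[ℝ] Model n)) ∞
        (fun u => TotalSpace.mk' (Model n →L[ℝ] Model n)
          (E := fun x : M => TangentSpace (𝓡 n) x →L[ℝ] TangentSpace (𝓡 n) x)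
          (e.symm u) (S.phi (e.symm u))) e.target :=
      S.phi_smooth.comp_contMDiffOn (contMDiffOn_symm_of_mem_maximalAtlas he)
    exact contDiffOn_coordComp he (X := fun u => S.phi (e.symm u) (coordVec e u j))
      (ContMDiffOn.clm_bundle_apply (F₁ := Model n) h1 (contMDiffOn_coordVec he j)) i
  g_symm u _ i j := S.metric.symm _ _ _
  -- A kernel vector of the Gram matrix would give a tangent vector `X` with `g(X, X) = 0`, and
  -- hence `X = 0`.
  det_ne_zero u hu := by
    intro h0
    obtain ⟨v, hv, hgv⟩ := Matrix.exists_mulVec_eq_zero_iff.2 h0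
    set X : TangentSpace (𝓡 n) (e.symm u) := ∑ i, v i • coordVec e u i with hX
    have h1 : S.metric.inner (e.symm u) X X = 0 := by
      have h2 : ∀ i, S.metric.inner (e.symm u) (coordVec e u i) X = 0 := fun i => by
        refine Eq.trans ?_ (congrFun hgv i)
        simp only [hX, map_sum, map_smul, smul_eq_mul]
        exact sum_congr rfl fun j _ => mul_comm _ _
      have h2' : ∀ Y, S.metric.inner (e.symm u) (∑ i, v i • coordVec e u i) Y
          = ∑ i, v i * S.metric.inner (e.symm u) (coordVec e u i) Y := fun Y => by simp
      refine (h2' X).trans ?_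
      simp [h2]
    have h3 : X = 0 := by
      by_contra hne
      exact (S.metric.pos _ X hne).ne' h1
    apply hv
    funext j
    have h4 : coordCompLin e u j X = v j := by
      simp [hX, coordCompLin_apply, coordComp_coordVec he hu]
    rw [← h4, h3, map_zero]
    rfl
  phi_phi u hu := by
    ext i j
    rw [Matrix.mul_apply]
    refine (S.coord_phi_mulVec he hu (S.phi (e.symm u) (coordVec e u j)) i).trans ?_
    rw [S.phi_phi, ← coordCompLin_apply, map_add, map_neg, map_smul, coordCompLin_apply,
      coordComp_coordVec he hu, Matrix.add_apply, Matrix.neg_apply, Matrix.one_apply, smul_eq_mul,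
      mul_comm]
    rfl
  lam_xi u hu := (sum_coordComp_mul he hu (S.reeb (e.symm u))
    (S.form (e.symm u)).toLinearMap).trans (S.form_reeb _)
  phi_xi u hu := by
    funext i
    refine (S.coord_phi_mulVec he hu (S.reeb (e.symm u)) i).trans ?_
    rw [S.phi_reeb, ← coordCompLin_apply, map_zero]
    rfl
  lam_phi u hu := by
    funext j
    exact (sum_coordComp_mul he hu (S.phi (e.symm u) (coordVec e u j))
      (S.form (e.symm u)).toLinearMap).trans (S.form_phi _ _)
  omega_eq u hu i j := by
    refine (S.extDeriv_form e he u hu i j).trans ?_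
    rw [Matrix.mul_apply]
    exact (sum_coordComp_mul he hu (S.phi (e.symm u) (coordVec e u j))
      (S.metric.inner (e.symm u) (coordVec e u i)).toLinearMap).symm

/-- For `X` in `ker λ`, `φ(X - iφX) = φX + iX = i(X - iφX)`. Conversely, an eigenvector `Z` has
imaginary part `-φ(Re Z)`, and `Re Z = φ(Im Z)` lies in `ker λ`. -/
lemma mem_holDist_iff (he : e ∈ IsManifold.maximalAtlas (𝓡 n) ∞ M) {u : Model n}
    (hu : u ∈ e.target) (Z : Fin n → ℂ) :
    Z ∈ (S.coord e).holDist u ↔ ((S.coord e).phiC u).mulVec Z = Complex.I • Z := by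
  have hD := S.isContact_coord he
  set D := S.coord e
  constructor
  · rintro ⟨X, hX, hZ⟩
    have h1 : ∀ i, ∑ j, D.phi u i j * ∑ k, D.phi u j k * X k = -X i := fun i => by
      have h2 := congrFun (congrArg (fun A => A.mulVec X) (hD.phi_phi u hu)) i
      simp only [← Matrix.mulVec_mulVec, Matrix.add_mulVec, Matrix.neg_mulVec, Matrix.one_mulVec,
        Matrix.vecMulVec_mulVec] at h2
      have h3 : dotProduct (D.lam u) X = 0 := hX
      rw [h3] at h2
      simpa [Matrix.mulVec, dotProduct] using h2
    funext i
    simp only [CoordData.phiC, Matrix.mulVec, dotProduct, Matrix.map_apply, hZ, Pi.smul_apply,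
      smul_eq_mul, mul_sub, sum_sub_distrib]
    have h4 : ∑ j, (D.phi u i j : ℂ) * (Complex.I * ((∑ k, D.phi u j k * X k : ℝ) : ℂ))
        = Complex.I * ((-X i : ℝ) : ℂ) := by
      rw [← h1 i, Complex.ofReal_sum, mul_sum]
      exact sum_congr rfl fun j _ => by rw [Complex.ofReal_mul]; ring
    rw [h4, ← mul_assoc, Complex.I_mul_I]
    push_cast
    ring
  · intro h
    have hre : ∀ i, ∑ j, D.phi u i j * (Z j).re = -(Z i).im := fun i => by
      have := congrArg Complex.re (congrFun h i)
      simpa [CoordData.phiC, Matrix.mulVec, dotProduct] using this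
    have him : ∀ i, ∑ j, D.phi u i j * (Z j).im = (Z i).re := fun i => by
      have := congrArg Complex.im (congrFun h i)
      simpa [CoordData.phiC, Matrix.mulVec, dotProduct] using this
    refine ⟨fun i => (Z i).re, ?_, fun i => ?_⟩
    · have h1 := congrArg (dotProduct · fun j => (Z j).im) (hD.lam_phi u hu)
      simp only [zero_dotProduct] at h1
      rw [← Matrix.dotProduct_mulVec] at h1
      have h2 : (D.phi u).mulVec (fun j => (Z j).im) = fun i => (Z i).re := funext him
      rwa [h2] at h1
    · rw [hre]
      apply Complex.ext <;> simp

lemma eigenInvolutive_coord (hS : S.IsCRIntegrable)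
    (he : e ∈ IsManifold.maximalAtlas (𝓡 n) ∞ M) :
    (S.coord e).EigenInvolutive e.target Complex.I := by
  intro Z W hZ hW hZs hWs u hu
  rw [← S.mem_holDist_iff he hu]
  exact hS e he Z W (contDiffOn_pi.2 hZ) (contDiffOn_pi.2 hW)
    (fun w hw => (S.mem_holDist_iff he hw _).2 (hZs w hw))
    (fun w hw => (S.mem_holDist_iff he hw _).2 (hWs w hw)) u hu

/-- The coordinate domain on which the functions on `U` are defined. -/
def chartDomain (U : Set M) (e : OpenPartialHomeomorph M (Model n)) : Set (Model n) :=
  e.target ∩ e.symm ⁻¹' U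

lemma polarization_coord (hS : S.IsSasakian) (he : e ∈ IsManifold.maximalAtlas (𝓡 n) ∞ M)
    {U : Set M} (hU : IsOpen U) {s : ℂ} (hs : s = Complex.I ∨ s = -Complex.I) :
    (S.coord e).Polarization (chartDomain U e) ((S.coord e).eigenSum s) := by
  have hD := S.isContact_coord he
  have hI := S.eigenInvolutive_coord hS.2 he
  have hsI : (S.coord e).EigenInvolutive e.target s := by
    rcases hs with rfl | rfl
    · exact hI
    · simpa using hI.conj e.open_target
  have hss : s * s = -1 := by rcases hs with rfl | rfl <;> simp
  -- CR integrability speaks of fields on all of `e.target`. The torsion condition is therefore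
  -- proved there and restricted, being pointwise.
  refine (hD.mono (e.symm.isOpen_inter_preimage hU) fun u hu => hu.1).polarization hss
    (fun u hu p hp q hq => hD.torsion_mem hss (hS.1 e he) hsI hu.1 hp hq) fun u hu => ?_
  rcases hs with rfl | rfl
  · exact Or.inr fun j => hD.wickTensor_col_mem hu.1 j
  · exact Or.inl fun i => hD.wickTensor_row_mem hu.1 i

/-- A vector of `eigenSum` is `q + cξ`. Invariance kills the `ξ` part. With `q = X + iY` and `s =
σi`, the eigenvalue equation says `φX = -σY` and `φY = σX`, so the equation `df(X) - s df(φX) = 0`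
is `df(X) + i df(Y) = 0`. -/
lemma constantAlong_inChart (he : e ∈ IsManifold.maximalAtlas (𝓡 n) ∞ M) {U : Set M}
    (hU : IsOpen U) {a : PowerSeries (M → ℂ)} (ha : SmoothOn (n := n) U a)
    (hξ : S.IsReebInvariant U a) {s : ℂ} (hs : s = Complex.I ∨ s = -Complex.I)
    (h : ∀ k, ∀ p ∈ U, ∀ v : TangentSpace (𝓡 n) p, S.form p v = 0 →
      diff (PowerSeries.coeff k a) p v - s * diff (PowerSeries.coeff k a) p (S.phi p v) = 0) :
    CoordData.ConstantAlong (chartDomain U e) ((S.coord e).eigenSum s) (inChart e a) where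
  smooth k := by
    simp only [inChart, PowerSeries.coeff_mk]
    exact ((ha k).comp ((contMDiffOn_symm_of_mem_maximalAtlas he).mono fun u hu => hu.1)
      fun u hu => hu.2).contDiffOn
  deriv u hu p hp k := by
    have hD := S.isContact_coord he
    set D := S.coord e
    set f := PowerSeries.coeff k a
    have hss : s * s = -1 := by rcases hs with rfl | rfl <;> simp
    have hf : MDifferentiableAt (𝓡 n) 𝓘(ℝ, ℂ) f (e.symm u) :=
      ((ha k).contMDiffAt (hU.mem_nhds hu.2)).mdifferentiableAt (by simp)
    have hin : ∀ w, PowerSeries.coeff k (inChart e a w) = f (e.symm w) := fun w => by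
      simp [inChart, f]
    have hpd : ∀ i, pd i (fun w => f (e.symm w)) u = diff f (e.symm u) (coordVec e u i) :=
      pd_comp_symm he hu.1 hf
    set df : TangentSpace (𝓡 n) (e.symm u) →ₗ[ℝ] ℂ :=
      (mfderiv (𝓡 n) 𝓘(ℝ, ℂ) f (e.symm u) : Model n →L[ℝ] ℂ).toLinearMap with hdf
    have hdf' : ∀ v, diff f (e.symm u) v = df v := fun _ => rfl
    simp only [hin, hpd, hdf']
    obtain ⟨q, c, hq, rfl⟩ := hD.exists_decomp hss hu.1 hp
    have hreeb : ∑ i, (D.xi u i : ℂ) * df (coordVec e u i) = 0 := by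
      refine Eq.trans ?_ (hξ k _ hu.2)
      rw [hdf', ← sum_coordComp he hu.1 (S.reeb (e.symm u)), map_sum]
      refine sum_congr rfl fun i _ => ?_
      rw [map_smul, Complex.real_smul]
      rfl
    set X : TangentSpace (𝓡 n) (e.symm u) := ∑ i, (q i).re • coordVec e u i with hX
    set Y : TangentSpace (𝓡 n) (e.symm u) := ∑ i, (q i).im • coordVec e u i with hY
    have hphi : ∀ x : Fin n → ℝ, S.phi (e.symm u) (∑ i, x i • coordVec e u i)
        = ∑ i, (∑ j, D.phi u i j * x j) • coordVec e u i := fun x => by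
      rw [map_sum]
      simp only [map_smul]
      have h1 : ∀ j, S.phi (e.symm u) (coordVec e u j) = ∑ i, D.phi u i j • coordVec e u i :=
        fun j => (sum_coordComp he hu.1 _).symm
      simp only [h1, smul_sum, sum_smul]
      rw [sum_comm]
      refine sum_congr rfl fun i _ => sum_congr rfl fun j _ => ?_
      rw [smul_smul, mul_comm]
    have hsre : s.re = 0 := by rcases hs with rfl | rfl <;> simp
    have hre : ∀ i, ∑ j, D.phi u i j * (q j).re = -s.im * (q i).im := fun i => by
      have := congrArg Complex.re (congrFun hq i)
      simpa [CoordData.phiC, Matrix.mulVec, dotProduct, hsre] using this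
    have him : ∀ i, ∑ j, D.phi u i j * (q j).im = s.im * (q i).re := fun i => by
      have := congrArg Complex.im (congrFun hq i)
      simpa [CoordData.phiC, Matrix.mulVec, dotProduct, hsre] using this
    have hφX : S.phi (e.symm u) X = (-s.im) • Y := by
      rw [hX, hphi, hY, smul_sum]
      simp only [hre, smul_smul]
    have hφY : S.phi (e.symm u) Y = s.im • X := by
      rw [hY, hphi, hX, smul_sum]
      simp only [him, smul_smul]
    have hsim : s.im * s.im = 1 := by rcases hs with rfl | rfl <;> simp
    have hformX : S.form (e.symm u) X = 0 := by
      -- `X` lies in the image of `φ`, hence in `ker λ`, where the CR equation applies.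
      have h1 : X = s.im • S.phi (e.symm u) Y := by rw [hφY, smul_smul, hsim, one_smul]
      rw [h1, map_smul, S.form_phi, smul_zero]
    have hcr := h k _ hu.2 X hformX
    rw [hφX, hdf', hdf', map_smul, Complex.real_smul] at hcr
    have hs' : s = s.im * Complex.I := by
      apply Complex.ext <;> simp [hsre]
    have hsum : ∑ i, q i * df (coordVec e u i) = df X + Complex.I * df Y := by
      rw [hX, hY, map_sum, map_sum, mul_sum, ← sum_add_distrib]
      refine sum_congr rfl fun i _ => ?_
      rw [map_smul, map_smul, Complex.real_smul, Complex.real_smul]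
      conv_lhs => rw [← Complex.re_add_im (q i)]
      ring
    have hsum2 : ∑ i, (q + c • fun i => (D.xi u i : ℂ)) i * df (coordVec e u i)
        = ∑ i, q i * df (coordVec e u i) + c * ∑ i, (D.xi u i : ℂ) * df (coordVec e u i) := by
      rw [mul_sum, ← sum_add_distrib]
      refine sum_congr rfl fun i _ => ?_
      simp only [Pi.add_apply, Pi.smul_apply, smul_eq_mul]
      ring
    rw [hsum2, hreeb, mul_zero, add_zero, hsum]
    have hsim' : (s.im : ℂ) * s.im = 1 := by exact_mod_cast hsim
    have h5 : s * (((-s.im : ℝ) : ℂ) * df Y) = -(Complex.I * df Y) := by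
      refine (congrArg (· * (((-s.im : ℝ) : ℂ) * df Y)) hs').trans ?_
      push_cast
      linear_combination (-(Complex.I * df Y)) * hsim'
    rw [h5] at hcr
    linear_combination hcr

lemma isQuantumObservable_of_constantAlong (hS : S.IsSasakian) {U : Set M} (hU : IsOpen U)
    {a : PowerSeries (M → ℂ)} (ha : SmoothOn (n := n) U a) {s : ℂ}
    (hs : s = Complex.I ∨ s = -Complex.I)
    (h : ∀ e ∈ IsManifold.maximalAtlas (𝓡 n) ∞ M,
      CoordData.ConstantAlong (chartDomain U e) ((S.coord e).eigenSum s) (inChart e a)) :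
    S.IsQuantumObservable U a := by
  refine ⟨ha, fun e he k p hp => ?_⟩
  have hu : e p ∈ chartDomain U e := ⟨e.map_source hp.2, by simpa [e.left_inv hp.2] using hp.1⟩
  simp only [deltaIn, PowerSeries.coeff_mk]
  rw [(S.polarization_coord hS he hU hs).delta_eq_zero (h e he) hu]
  simp

omit [ChartedSpace (Model n) M] [IsManifold (𝓡 n) ∞ M] in
lemma inChart_mul_apply {p : M} (hp : p ∈ e.source) (a b : PowerSeries (M → ℂ)) (k : ℕ) :
    PowerSeries.coeff k (inChart e a (e p) * inChart e b (e p))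
      = PowerSeries.coeff k (a * b) p := by
  simp [PowerSeries.coeff_mul, inChart, e.left_inv hp, Finset.sum_apply]

end ContactMetric

end Coordinates

end ContactWick

end

/-! ### The theorem -/

open ContactWick in
theorem theorem5p4 {m : ℕ} {M : Type*} [TopologicalSpace M]
    [ChartedSpace (Model (2 * m + 1)) M] [IsManifold (𝓡 (2 * m + 1)) ∞ M]
    (S : ContactMetric (2 * m + 1) M) (hS : S.IsSasakian) (U : Set M) (hU : IsOpen U)
    (a : PowerSeries (M → ℂ)) (ha : SmoothOn (n := 2 * m + 1) U a)
    (hξ : S.IsReebInvariant U a) :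
    (S.IsCRHolomorphic U a →
      S.IsQuantumObservable U a ∧
        ∀ c : PowerSeries (M → ℂ), S.IsQuantumObservable U c →
          ∀ e ∈ IsManifold.maximalAtlas (𝓡 (2 * m + 1)) ∞ M,
            ContactMetric.EqIn U e (S.starIn e c a) (c * a)) ∧
    (S.IsCRAntiholomorphic U a →
      S.IsQuantumObservable U a ∧
        ∀ c : PowerSeries (M → ℂ), S.IsQuantumObservable U c →
          ∀ e ∈ IsManifold.maximalAtlas (𝓡 (2 * m + 1)) ∞ M,
            ContactMetric.EqIn U e (S.starIn e a c) (a * c)) := by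
  have key : ∀ s : ℂ, s = Complex.I ∨ s = -Complex.I →
      (∀ k, ∀ p ∈ U, ∀ v : TangentSpace (𝓡 (2 * m + 1)) p, S.form p v = 0 →
        diff (PowerSeries.coeff k a) p v
          - s * diff (PowerSeries.coeff k a) p (S.phi p v) = 0) →
      ∀ e ∈ IsManifold.maximalAtlas (𝓡 (2 * m + 1)) ∞ M, CoordData.ConstantAlong
        (ContactMetric.chartDomain U e) ((S.coord e).eigenSum s) (inChart e a) :=
    fun s hs h e he => S.constantAlong_inChart he hU ha hξ hs h
  have mem : ∀ e : OpenPartialHomeomorph M (Model (2 * m + 1)), ∀ p ∈ U ∩ e.source,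
      e p ∈ ContactMetric.chartDomain U e := fun e p hp =>
    ⟨e.map_source hp.2, by simpa [e.left_inv hp.2] using hp.1⟩
  constructor
  · intro ha'
    -- The vectors `X + iφX` have eigenvalue `-i`, and so do the rows of the Wick tensor modulo `ξ`:
    -- the right factor is differentiated along them.
    have hs : -Complex.I = Complex.I ∨ -Complex.I = -Complex.I := Or.inr rfl
    have hc := key (-Complex.I) hs fun k p hp v hv => by
      rw [neg_mul, sub_neg_eq_add]
      exact ha' k p hp v hv
    refine ⟨S.isQuantumObservable_of_constantAlong hS hU ha hs hc, fun c _ e he k p hp => ?_⟩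
    have hu := mem e p hp
    simp only [ContactMetric.starIn, PowerSeries.coeff_mk]
    rw [(S.polarization_coord hS he hU hs).star_eq_mul_right (hc e he) hu
      fun i => (S.isContact_coord he).wickTensor_row_mem hu.1 i]
    exact ContactMetric.inChart_mul_apply hp.2 _ _ k
  · intro ha'
    -- The vectors `X - iφX` have eigenvalue `i`, matching the columns, along which the left factor
    -- is differentiated.
    have hs : Complex.I = Complex.I ∨ Complex.I = -Complex.I := Or.inl rfl
    have hc := key Complex.I hs ha'
    refine ⟨S.isQuantumObservable_of_constantAlong hS hU ha hs hc, fun c _ e he k p hp => ?_⟩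
    have hu := mem e p hp
    simp only [ContactMetric.starIn, PowerSeries.coeff_mk]
    rw [(S.polarization_coord hS he hU hs).star_eq_mul_left (hc e he) hu
      fun j => (S.isContact_coord he).wickTensor_col_mem hu.1 j]
    exact ContactMetric.inChart_mul_apply hp.2 _ _ k
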